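/- Let $p,m\ge 1$, $q\ge 0$ be integers, $n=q+m$, $r=\min\{p,m\}$, $v=\max\{p,m\}$. Let $\Sigma$ be a real symmetric positive definite $p\times p$ matrix, $\theta$ a real $q\times p$ matrix, and $f\ge 0$ a measurable function such that the random pair $(Z,U)$, with $Z$ a $q\times p$ and $U$ an $m\times p$ matrix, has the probability density, with respect to Lebesgue measure, $$(z,u)\mapsto |\Sigma|^{-n/2}\,f\big(\mathrm{tr}\,(z-\theta)\Sigma^{-1}(z-\theta)^\top+\mathrm{tr}\,u\Sigma^{-1}u^\top\big).$$ Write $E$ for the expectation under this density. Let $F^*(t)=\frac12\int_t^\infty f(\nu)\,d\nu$ for $t\ge 0$, let $$K^*=\int |\Sigma|^{-n/2}F^*\big(\mathrm{tr}\,(z-\theta)\Sigma^{-1}(z-\theta)^\top+\mathrm{tr}\,u\Sigma^{-1}u^\top\big)\,dz\,du,$$ assume $K^*<\infty$, and write $E^*$ for the expectation under the probability density $$(z,u)\mapsto \frac1{K^*}|\Sigma|^{-n/2}F^*\big(\mathrm{tr}\,(z-\theta)\Sigma^{-1}(z-\theta)^\top+\mathrm{tr}\,u\Sigma^{-1}u^\top\big).$$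 Let $S=U^\top U=HLH^\top$ be the eigenvalue decomposition of $S$, where $H$ is $p\times r$ with $H^\top H=I_r$ and $L=\mathrm{diag}(l_1,\dots,l_r)$ holds the $r$ largest eigenvalues of $S$ in decreasing order (almost surely $l_1>\dots>l_r>0$). Let $\Phi(L)=\mathrm{diag}(\phi_1,\dots,\phi_r)$, where each $\phi_i=\phi_i(l_1,\dots,l_r)$ is a differentiable real function on $\{l_1>\dots>l_r>0\}$. Assume that $E\big[|\mathrm{tr}(\Sigma^{-1}HL\Phi(L)H^\top)|\big]<\infty$ and that the expectations of the individual terms on the right-hand side below exist, that is, $E^*[|\phi_i|]<\infty$, $E^*\big[|l_i\,\partial\phi_i/\partial l_i|\big]<\infty$ and $E^*\big[|(l_i\phi_i-l_j\phi_j)/(l_i-l_j)|\big]<\infty$ for all $i$ and all $j\ne i$. Then $$E\big[\mathrm{tr}(\Sigma^{-1}HL\Phi(L)H^\top)\big]=K^*\,E^*\Big[\sum_{i=1}^r\Big((v-r+1)\,\phi_i+2\,l_i\,\frac{\partial\phi_i}{\partial l_i}+\sum_{j\ne i}\frac{l_i\phi_i-l_j\phi_j}{l_i-l_j}\Big)\Big].$$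 -/

import Mathlib

open MeasureTheory Matrix
open scoped ENNReal

namespace EllipticalModel

/-- `tr (z - θ) Σ⁻¹ (z - θ)ᵀ + tr u Σ⁻¹ uᵀ` for a `q × p` matrix `z` and an `m × p` matrix `u`. -/
noncomputable def quadForm {p q m : ℕ} (Sig : Matrix (Fin p) (Fin p) ℝ)
    (θ : Matrix (Fin q) (Fin p) ℝ) (x : (Fin q → Fin p → ℝ) × (Fin m → Fin p → ℝ)) : ℝ :=
  ((Matrix.of x.1 - θ) * Sig⁻¹ * (Matrix.of x.1 - θ)ᵀ).trace
    + (Matrix.of x.2 * Sig⁻¹ * (Matrix.of x.2)ᵀ).trace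

/-- `(z, u) ↦ |Σ|^(-n/2) g (tr (z - θ) Σ⁻¹ (z - θ)ᵀ + tr u Σ⁻¹ uᵀ)`, where `n = q + m`. -/
noncomputable def ellDensity {p q m : ℕ} (Sig : Matrix (Fin p) (Fin p) ℝ)
    (θ : Matrix (Fin q) (Fin p) ℝ) (g : ℝ → ℝ≥0∞)
    (x : (Fin q → Fin p → ℝ) × (Fin m → Fin p → ℝ)) : ℝ≥0∞ :=
  ENNReal.ofReal (Sig.det ^ (-((q + m : ℕ) : ℝ) / 2)) * g (quadForm Sig θ x)

/-- The distribution of `(Z, U)`, with generating function `f`; its expectation is `E`. -/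
noncomputable def law {p q : ℕ} (m : ℕ) (Sig : Matrix (Fin p) (Fin p) ℝ)
    (θ : Matrix (Fin q) (Fin p) ℝ) (f : ℝ → ℝ) :
    Measure ((Fin q → Fin p → ℝ) × (Fin m → Fin p → ℝ)) :=
  volume.withDensity (ellDensity Sig θ fun t => ENNReal.ofReal (f t))

/-- `F*(t) = (1/2) ∫_t^∞ f(ν) dν`, as an extended nonnegative number. -/
noncomputable def Fstar (f : ℝ → ℝ) (t : ℝ) : ℝ≥0∞ :=
  2⁻¹ * ∫⁻ ν in Set.Ioi t, ENNReal.ofReal (f ν)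

/-- The normalizing constant `K*`, i.e. the total mass of
`|Σ|^(-n/2) F*(tr (z - θ) Σ⁻¹ (z - θ)ᵀ + tr u Σ⁻¹ uᵀ)`. -/
noncomputable def Kstar {p q : ℕ} (m : ℕ) (Sig : Matrix (Fin p) (Fin p) ℝ)
    (θ : Matrix (Fin q) (Fin p) ℝ) (f : ℝ → ℝ) : ℝ≥0∞ :=
  ∫⁻ x : (Fin q → Fin p → ℝ) × (Fin m → Fin p → ℝ), ellDensity Sig θ (Fstar f) x

/-- The distribution with density `(1/K*) |Σ|^(-n/2) F*(...)`; its expectation is `E*`. -/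
noncomputable def lawStar {p q : ℕ} (m : ℕ) (Sig : Matrix (Fin p) (Fin p) ℝ)
    (θ : Matrix (Fin q) (Fin p) ℝ) (f : ℝ → ℝ) :
    Measure ((Fin q → Fin p → ℝ) × (Fin m → Fin p → ℝ)) :=
  volume.withDensity fun x => (Kstar m Sig θ f)⁻¹ * ellDensity Sig θ (Fstar f) x

/-- `S = uᵀ u`. -/
def scatter {p m : ℕ} (u : Fin m → Fin p → ℝ) : Matrix (Fin p) (Fin p) ℝ :=
  (Matrix.of u)ᵀ * Matrix.of u

theorem scatter_isHermitian {p m : ℕ} (u : Fin m → Fin p → ℝ) : (scatter u).IsHermitian := by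
  have h := Matrix.isHermitian_conjTranspose_mul_self (Matrix.of u)
  rwa [Matrix.conjTranspose_eq_transpose_of_trivial] at h

/-- The `r = min p m` largest eigenvalues `l₁ ≥ ... ≥ l_r` of `S = uᵀ u`, with multiplicity
(`Matrix.IsHermitian.eigenvalues₀` lists all `p` eigenvalues in decreasing order). -/
noncomputable def eig {p m : ℕ} (u : Fin m → Fin p → ℝ) (i : Fin (min p m)) : ℝ :=
  (scatter_isHermitian u).eigenvalues₀
    ⟨i, by rw [Fintype.card_fin]; exact lt_of_lt_of_le i.2 (min_le_left p m)⟩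

/-- `S = H L Hᵀ` with `H` semi-orthogonal (`p × r`) and `L = diag(l₁, ..., l_r)`. -/
def IsEigenvectorMatrix {p m : ℕ} (u : Fin m → Fin p → ℝ)
    (H : Matrix (Fin p) (Fin (min p m)) ℝ) : Prop :=
  Hᵀ * H = 1 ∧ scatter u = H * Matrix.diagonal (eig u) * Hᵀ

/-- The domain of the functions `φ_i`: all `(l₁, ..., l_r)` with `l₁ > ... > l_r > 0`. -/
def chamber (r : ℕ) : Set (Fin r → ℝ) := {l | StrictAnti l ∧ ∀ i, 0 < l i}

/-- `∂φ/∂l_i` at `l`. -/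
noncomputable def partialDeriv {r : ℕ} (φ : (Fin r → ℝ) → ℝ) (i : Fin r) (l : Fin r → ℝ) : ℝ :=
  fderiv ℝ φ l (Pi.single i 1)

/-- `tr (Σ⁻¹ H L Φ(L) Hᵀ)` with `L = diag(l)` and `Φ(L) = diag(φ₁(l), ..., φ_r(l))`. -/
noncomputable def traceTerm {p r : ℕ} (Sig : Matrix (Fin p) (Fin p) ℝ)
    (H : Matrix (Fin p) (Fin r) ℝ) (l : Fin r → ℝ) (φ : Fin r → (Fin r → ℝ) → ℝ) : ℝ :=
  (Sig⁻¹ * (H * Matrix.diagonal l * Matrix.diagonal (fun i => φ i l) * Hᵀ)).trace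

end EllipticalModel

/-! ### Spectral decomposition of `S` and the discriminant polynomial. -/

namespace EllipticalModel

/-! Write q(u) = tr u Σ⁻¹ uᵀ, S = uᵀu, B = H Φ(L) Hᵀ, and consider the vector field V(u) = uB on m ×
p matrices. Two computations drive the proof: the derivative of q along V is 2 tr(Σ⁻¹ S B)
(`fderiv_rowForm_field`), and the divergence of V is the sum inside E* (`divergence_field`). Fix z,
let c = tr (z - θ) Σ⁻¹ (z - θ)ᵀ and G(y) = ∫_y^∞ f(c + s) ds = 2 F*(c + y). Formally the gradient of
G(q) is -f(c + q) ∇q, so ∫ div(G(q) V) = 0 is the claim for the section at z, up to a factor 2 on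
both sides, and Fubini in z finishes (`integral_quadForm_mul_scoreTerm`). Three obstacles make this
formal argument into a proof.

Singularities. The field is controlled only where l₁ > ... > l_r > 0. The complement is the zero set
of the polynomial `disc`, which is null. The field is cut off by χ(n · disc) with χ a smooth step.
Along V the derivative of `disc` is `disc` times `discRate`, a combination of terms already assumed
integrable, so the error carries the factor tχ'(t) at t = n · disc. This factor is bounded and tends
to 0 off the zero set, and dominated convergence removes it (`integral_mul_steinHaff`).

Infinity, and rough f. Neither decay of G(q) V nor smoothness of G is available. Integration by
parts is therefore done with weights ψ(q), where ψ' (y) = -η(y) (t - y)⁺ and η is bounded and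
continuous; these have compact support. On {q < t} the weight G(q) is bounded below when G(t) > 0,
so the integrability assumed under E* gives integrability there, and |tr(Σ⁻¹ S B)| ≤ q ∑ |φ_i| takes
care of the remaining term.

From η back to f. With positive and negative parts on opposite sides, the identities for all η say
that two finite measures on the line coincide (`levelMeasure`). They hence extend to every
nonnegative measurable function vanishing on [t, ∞) (`lintegral_level_eq`). Letting t increase
through rationals with G(t) > 0 reaches f (`lintegral_level_eq_of_forall_rat`). -/

theorem posSemidef_scatter {p m : ℕ} (u : Fin m → Fin p → ℝ) : (scatter u).PosSemidef := by
  have h := Matrix.posSemidef_conjTranspose_mul_self (Matrix.of u)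
  rwa [Matrix.conjTranspose_eq_transpose_of_trivial] at h

/-- A spectral decomposition of `S = uᵀ u` with all `p` eigenvalues listed in decreasing order. -/
structure SpectralData {p m : ℕ} (u : Fin m → Fin p → ℝ) (O : Matrix (Fin p) (Fin p) ℝ)
    (e : Fin p → ℝ) : Prop where
  left : Oᵀ * O = 1
  right : O * Oᵀ = 1
  scatter_eq : scatter u = O * diagonal e * Oᵀ
  antitone : Antitone e
  nonneg : ∀ k, 0 ≤ e k
  eq_zero : ∀ k : Fin p, m ≤ k → e k = 0
  eig_eq : ∀ i, eig u i = e (Fin.castLE (min_le_left p m) i)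

/-- All p eigenvalues are kept, in decreasing order, so that conjugation by a square orthogonal
matrix is available; those of index at least m vanish because S has rank at most m. -/
theorem exists_spectralData {p m : ℕ} (u : Fin m → Fin p → ℝ) :
    ∃ O e, SpectralData u O e := by
  set hS := scatter_isHermitian u with hSdef
  let c : Fin p → Fin (Fintype.card (Fin p)) := Fin.cast (Fintype.card_fin p).symm
  let σ : Fin (Fintype.card (Fin p)) ≃ Fin p :=
    Fintype.equivOfCardEq (Fintype.card_fin _)
  let τ : Fin p ≃ Fin p := (finCongr (Fintype.card_fin p).symm).trans σ
  let O' : Matrix (Fin p) (Fin p) ℝ := (hS.eigenvectorUnitary : Matrix (Fin p) (Fin p) ℝ)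
  let e : Fin p → ℝ := fun k => hS.eigenvalues₀ (c k)
  have heig : ∀ k, hS.eigenvalues (τ k) = e k := by
    intro k
    simp only [Matrix.IsHermitian.eigenvalues, e, τ, c, σ]
    congr 1
    simp
  have hanti : Antitone e := by
    intro a b hab
    apply hS.eigenvalues₀_antitone
    simpa [c] using hab
  have hnn : ∀ k, 0 ≤ e k := by
    intro k
    rw [← heig]
    exact (posSemidef_scatter u).eigenvalues_nonneg _
  have hO'1 : O'ᵀ * O' = 1 := by
    have := Unitary.coe_star_mul_self hS.eigenvectorUnitary
    rwa [Matrix.star_eq_conjTranspose, Matrix.conjTranspose_eq_transpose_of_trivial] at this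
  have hO'2 : O' * O'ᵀ = 1 := mul_eq_one_comm.mp hO'1
  have hspec : scatter u = O' * diagonal hS.eigenvalues * O'ᵀ := by
    have := hS.spectral_theorem
    rw [Unitary.conjStarAlgAut_apply] at this
    rw [Matrix.star_eq_conjTranspose,
      Matrix.conjTranspose_eq_transpose_of_trivial] at this
    exact this
  refine ⟨O'.submatrix id τ, e, ?_, ?_, ?_, hanti, hnn, ?_, ?_⟩
  · rw [Matrix.transpose_submatrix, ← Equiv.coe_refl, Matrix.submatrix_mul_equiv, hO'1]
    simp
  · rw [Matrix.transpose_submatrix, Matrix.submatrix_mul_equiv, hO'2]; simp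
  · have hd : diagonal e = (diagonal hS.eigenvalues).submatrix τ τ := by
      rw [Matrix.submatrix_diagonal_equiv]
      congr 1
      ext k
      exact (heig k).symm
    rw [hd, Matrix.submatrix_mul_equiv, Matrix.transpose_submatrix, Matrix.submatrix_mul_equiv,
      ← hspec]
    simp
  · intro k hk
    by_contra hne
    have hrank : (scatter u).rank ≤ m := by
      refine (Matrix.rank_mul_le_right _ _).trans ?_
      simpa using Matrix.rank_le_height (Matrix.of u)
    rw [hS.rank_eq_card_non_zero_eigs] at hrank
    -- If e k ≠ 0 then e 0, ..., e k are all positive by monotonicity, which gives k + 1 > m nonzero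
    -- eigenvalues, more than the rank allows.
    have hinj : Fintype.card (Fin (k + 1)) ≤ Fintype.card {i // hS.eigenvalues i ≠ 0} := by
      refine Fintype.card_le_of_injective
        (fun j : Fin (k + 1) => ⟨τ ⟨j, by omega⟩, ?_⟩) ?_
      · rw [heig]
        have : e k ≤ e ⟨j, by omega⟩ := hanti (by
          rw [Fin.le_def]; simp; omega)
        have := lt_of_le_of_ne (hnn k) (Ne.symm hne)
        linarith
      · intro a b hab
        simp only [Subtype.mk.injEq, EmbeddingLike.apply_eq_iff_eq, Fin.mk.injEq] at hab
        exact Fin.ext hab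
    rw [Fintype.card_fin] at hinj
    omega
  · intro i
    rfl

theorem sum_eq_sum_castLE {p m : ℕ} {M : Type*} [AddCommMonoid M] (F : Fin p → M)
    (hF : ∀ k : Fin p, m ≤ k → F k = 0) :
    ∑ k, F k = ∑ i : Fin (min p m), F (Fin.castLE (min_le_left p m) i) := by
  classical
  rw [← Finset.sum_subset (Finset.subset_univ
    (Finset.univ.map (Fin.castLEEmb (min_le_left p m))))]
  · simp
  · intro k _ hk
    apply hF
    by_contra h
    apply hk
    simp only [Finset.mem_map, Finset.mem_univ, true_and]
    exact ⟨⟨k, by have := k.2; omega⟩, by ext; simp⟩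

namespace SpectralData
variable {p m : ℕ} {u : Fin m → Fin p → ℝ} {O : Matrix (Fin p) (Fin p) ℝ} {e : Fin p → ℝ}

theorem scatter_pow (h : SpectralData u O e) (n : ℕ) :
    scatter u ^ n = O * diagonal (fun k => e k ^ n) * Oᵀ := by
  induction n with
  | zero => simp [h.right]
  | succ n ih =>
    rw [pow_succ, ih]
    nth_rewrite 1 [h.scatter_eq]
    rw [show O * diagonal (fun k => e k ^ n) * Oᵀ * (O * diagonal e * Oᵀ)
      = O * diagonal (fun k => e k ^ n) * (Oᵀ * O) * diagonal e * Oᵀ by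
        simp only [Matrix.mul_assoc], h.left, Matrix.mul_one, Matrix.mul_assoc O,
      Matrix.diagonal_mul_diagonal]
    simp only [pow_succ]

theorem trace_scatter_pow (h : SpectralData u O e) (n : ℕ) :
    (scatter u ^ (n + 1)).trace = ∑ i, eig u i ^ (n + 1) := by
  rw [h.scatter_pow, Matrix.trace_mul_comm, ← Matrix.mul_assoc, h.left, Matrix.one_mul,
    Matrix.trace_diagonal, sum_eq_sum_castLE (m := m)]
  · simp [h.eig_eq]
  · intro k hk
    simp [h.eq_zero k hk]

theorem det_smul_one_sub (h : SpectralData u O e) (c : ℝ) :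
    (c • (1 : Matrix (Fin p) (Fin p) ℝ) - scatter u).det = ∏ k, (c - e k) := by
  have : c • (1 : Matrix (Fin p) (Fin p) ℝ) - scatter u
      = O * diagonal (fun k => c - e k) * Oᵀ := by
    rw [h.scatter_eq, show (diagonal (fun k => c - e k) : Matrix (Fin p) (Fin p) ℝ)
      = c • 1 - diagonal e by
        rw [Matrix.smul_one_eq_diagonal, Matrix.diagonal_sub], Matrix.mul_sub, Matrix.sub_mul]
    simp [h.right]
  rw [this, Matrix.det_mul, Matrix.det_mul, Matrix.det_diagonal, mul_right_comm,
    ← Matrix.det_mul, h.right]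
  simp

end SpectralData

theorem trace_scatter_pow {p m : ℕ} (u : Fin m → Fin p → ℝ) (n : ℕ) :
    (scatter u ^ (n + 1)).trace = ∑ i, eig u i ^ (n + 1) := by
  obtain ⟨O, e, h⟩ := exists_spectralData u
  exact h.trace_scatter_pow n

theorem eig_nonneg {p m : ℕ} (u : Fin m → Fin p → ℝ) (i) : 0 ≤ eig u i := by
  obtain ⟨O, e, h⟩ := exists_spectralData u
  rw [h.eig_eq]
  exact h.nonneg _

theorem eig_antitone {p m : ℕ} (u : Fin m → Fin p → ℝ) : Antitone (eig u) := by
  obtain ⟨O, e, h⟩ := exists_spectralData u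
  intro i j hij
  rw [h.eig_eq, h.eig_eq]
  exact h.antitone (by simpa using hij)

/-- The product of the eigenvalues and of their squared differences, as a polynomial in `u`. -/
noncomputable def disc {p m : ℕ} (u : Fin m → Fin p → ℝ) : ℝ :=
  (Matrix.of fun i j : Fin (min p m) => (scatter u ^ ((i : ℕ) + j + 1)).trace).det

/-- The Hankel matrix of power sums factors as Vᵀ L V with V the Vandermonde matrix. -/
theorem det_sum_pow {r : ℕ} (l : Fin r → ℝ) :
    (Matrix.of fun i j : Fin r => ∑ k, l k ^ ((i : ℕ) + j + 1)).det
      = (vandermonde l).det ^ 2 * ∏ k, l k := by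
  have : (Matrix.of fun i j : Fin r => ∑ k, l k ^ ((i : ℕ) + j + 1))
      = (vandermonde l)ᵀ * diagonal l * vandermonde l := by
    ext i j
    rw [Matrix.mul_apply]
    simp only [Matrix.of_apply, Matrix.mul_diagonal, Matrix.transpose_apply, vandermonde_apply]
    refine Finset.sum_congr rfl fun k _ => ?_
    ring
  rw [this, det_mul, det_mul, det_transpose, det_diagonal]
  ring

theorem disc_eq {p m : ℕ} (u : Fin m → Fin p → ℝ) :
    disc u = (vandermonde (eig u)).det ^ 2 * ∏ k, eig u k := by
  rw [← det_sum_pow, disc]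
  simp_rw [trace_scatter_pow]

theorem disc_nonneg {p m : ℕ} (u : Fin m → Fin p → ℝ) : 0 ≤ disc u := by
  rw [disc_eq]
  exact mul_nonneg (sq_nonneg _) (Finset.prod_nonneg fun i _ => eig_nonneg u i)

/-- This turns the regular set into the nonvanishing set of a polynomial in the entries of u, which
makes it open and conull and provides a smooth function to cut off with. -/
theorem disc_ne_zero_iff {p m : ℕ} (u : Fin m → Fin p → ℝ) :
    disc u ≠ 0 ↔ eig u ∈ chamber (min p m) := by
  rw [disc_eq, mul_ne_zero_iff, pow_ne_zero_iff two_ne_zero, det_vandermonde_ne_zero_iff,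
    Finset.prod_ne_zero_iff, chamber, Set.mem_ofPred_eq]
  constructor
  · rintro ⟨h1, h2⟩
    exact ⟨(eig_antitone u).strictAnti_of_injective h1,
      fun i => lt_of_le_of_ne (eig_nonneg u i) (h2 i (Finset.mem_univ i)).symm⟩
  · rintro ⟨h1, h2⟩
    exact ⟨h1.injective, fun i _ => (h2 i).ne'⟩

theorem continuous_scatter {p m : ℕ} : Continuous (scatter : (Fin m → Fin p → ℝ) → _) := by
  unfold scatter
  exact Continuous.matrix_mul (Continuous.matrix_transpose continuous_id) continuous_id

theorem continuous_disc {p m : ℕ} : Continuous (disc : (Fin m → Fin p → ℝ) → ℝ) := by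
  unfold disc
  refine Continuous.matrix_det ?_
  refine continuous_matrix fun i j => ?_
  exact (continuous_scatter.pow _).matrix_trace

theorem isOpen_disc_ne {p m : ℕ} : IsOpen {u : Fin m → Fin p → ℝ | disc u ≠ 0} :=
  isOpen_ne_fun continuous_disc continuous_const

theorem isOpen_chamber (r : ℕ) : IsOpen (chamber r) := by
  have : chamber r = {l | ∀ i j, i < j → l j < l i} ∩ {l | ∀ i, 0 < l i} := by
    ext l; simp [chamber, StrictAnti]
  rw [this]
  refine IsOpen.inter ?_ ?_
  · simp only [Set.ofPred_forall]
    refine isOpen_iInter_of_finite fun i => isOpen_iInter_of_finite fun j =>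
      isOpen_iInter_of_finite fun _ => isOpen_lt (continuous_apply _) (continuous_apply _)
  · simp only [Set.ofPred_forall]
    exact isOpen_iInter_of_finite fun i => isOpen_lt continuous_const (continuous_apply _)

end EllipticalModel

/-! ### Differentiability of eigenvalues and of spectral functions. -/

namespace EllipticalModel

open Filter Topology in
theorem exists_differentiableAt_implicit {E : Type*} [NormedAddCommGroup E] [NormedSpace ℝ E]
    [CompleteSpace E] {F : E × ℝ → ℝ} {x : E} {y c : ℝ} (hF : ContDiff ℝ 1 F)
    (h0 : F (x, y) = 0) (hc : HasDerivAt (fun s => F (x, s)) c y) (hc0 : c ≠ 0) :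
    ∃ ψ : E → ℝ, DifferentiableAt ℝ ψ x ∧ ψ x = y ∧ ∀ᶠ v in 𝓝 x, F (v, ψ v) = 0 := by
  have cdf : ContDiffAt ℝ 1 F (x, y) := hF.contDiffAt
  have h1 : HasDerivAt (fun s => F (x, s)) (fderiv ℝ F (x, y) (0, 1)) y := by
    have := (hF.differentiable one_ne_zero (x, y)).hasFDerivAt.comp_hasDerivAt y
      ((hasDerivAt_const y x).prodMk (hasDerivAt_id y))
    exact this
  have h2 : fderiv ℝ F (x, y) (0, 1) = c := h1.unique hc
  have hinv : (fderiv ℝ F (x, y) ∘L .inr ℝ E ℝ).IsInvertible := by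
    refine ⟨ContinuousLinearEquiv.unitsEquivAut ℝ (Units.mk0 c hc0), ?_⟩
    ext
    simp [ContinuousLinearEquiv.unitsEquivAut, h2]
  refine ⟨cdf.implicitFunction one_ne_zero hinv, ?_, ?_, ?_⟩
  · exact (cdf.hasStrictFDerivAt_implicitFunction one_ne_zero hinv).hasFDerivAt.differentiableAt
  · exact cdf.implicitFunction_apply_self one_ne_zero hinv
  · rw [← h0]
    exact cdf.eventually_apply_implicitFunction one_ne_zero hinv

theorem contDiff_det {E ι : Type*} [NormedAddCommGroup E] [NormedSpace ℝ E] [Fintype ι]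
    [DecidableEq ι] {n : WithTop ℕ∞} {M : E → Matrix ι ι ℝ}
    (hM : ∀ a b, ContDiff ℝ n fun v => M v a b) : ContDiff ℝ n fun v => (M v).det := by
  simp_rw [Matrix.det_apply']
  exact ContDiff.sum fun σ _ => contDiff_const.mul (contDiff_prod fun i _ => hM _ _)

theorem differentiableAt_det {E ι : Type*} [NormedAddCommGroup E] [NormedSpace ℝ E] [Fintype ι]
    [DecidableEq ι] {x : E} {M : E → Matrix ι ι ℝ}
    (hM : ∀ a b, DifferentiableAt ℝ (fun v => M v a b) x) :
    DifferentiableAt ℝ (fun v => (M v).det) x := by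
  simp_rw [Matrix.det_apply']
  exact DifferentiableAt.fun_sum fun σ _ =>
    (differentiableAt_const _).mul (HasFDerivAt.finsetProd fun i _ => (hM (σ i) i).hasFDerivAt).differentiableAt

theorem contDiff_scatter {p m : ℕ} {n : WithTop ℕ∞} (a b : Fin p) :
    ContDiff ℝ n fun u : Fin m → Fin p → ℝ => scatter u a b := by
  simp only [scatter, Matrix.mul_apply, Matrix.transpose_apply, Matrix.of_apply]
  fun_prop

theorem contDiff_scatter_pow {p m : ℕ} {n : WithTop ℕ∞} (k : ℕ) (a b : Fin p) :
    ContDiff ℝ n fun u : Fin m → Fin p → ℝ => (scatter u ^ k) a b := by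
  induction k generalizing a b with
  | zero => simpa using contDiff_const
  | succ k ih =>
    simp only [pow_succ, Matrix.mul_apply]
    exact ContDiff.sum fun c _ => (ih a c).mul (contDiff_scatter c b)

theorem contDiff_disc {p m : ℕ} {n : WithTop ℕ∞} :
    ContDiff ℝ n (disc : (Fin m → Fin p → ℝ) → ℝ) := by
  refine contDiff_det fun i j => ?_
  simp only [Matrix.of_apply, Matrix.trace, Matrix.diag]
  exact ContDiff.sum fun a _ => contDiff_scatter_pow _ _ _

/-- Positive values can only occupy the first r slots, and a strictly monotone self-map of `Fin r`
is the identity. Hence r distinct positive eigenvalues in decreasing order must be the list itself.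
-/
theorem eq_comp_castLE_of_strictAnti {p m : ℕ} {e : Fin p → ℝ} (he : Antitone e)
    (h0 : ∀ k : Fin p, m ≤ k → e k = 0) {l : Fin (min p m) → ℝ} (hl : StrictAnti l)
    (hpos : ∀ i, 0 < l i) (hmem : ∀ i, ∃ k, l i = e k) :
    ∀ i, l i = e (Fin.castLE (min_le_left p m) i) := by
  choose σ hσ using hmem
  have hlt : ∀ i, (σ i : ℕ) < min p m := by
    intro i
    by_contra h
    have := hpos i
    rw [hσ i, h0 _ (by have := (σ i).2; omega)] at this
    exact lt_irrefl _ this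
  let τ : Fin (min p m) → Fin (min p m) := fun i => ⟨σ i, hlt i⟩
  have hmono : StrictMono τ := by
    intro i j hij
    by_contra hle
    have h1 : σ j ≤ σ i := by
      simpa [τ] using hle
    have h2 := he h1
    rw [← hσ, ← hσ] at h2
    exact absurd (hl hij) (not_lt.mpr h2)
  have hid : τ = id := hmono.eq_id
  intro i
  rw [hσ i]
  congr 1
  have := congrArg Fin.val (congrFun hid i)
  exact Fin.ext this

/-- Each l_i is a simple root of det(s - S), so the implicit function theorem gives a differentiable
local root; the ordering identifies these roots with the eigenvalues. -/
theorem differentiableAt_eig {p m : ℕ} {u : Fin m → Fin p → ℝ} (hu : disc u ≠ 0)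
    (i : Fin (min p m)) : DifferentiableAt ℝ (fun v => eig v i) u := by
  have hch := (disc_ne_zero_iff u).mp hu
  obtain ⟨O, e, h⟩ := exists_spectralData u
  let F : (Fin m → Fin p → ℝ) × ℝ → ℝ := fun x =>
    (x.2 • (1 : Matrix (Fin p) (Fin p) ℝ) - scatter x.1).det
  have hF : ContDiff ℝ 1 F := by
    refine contDiff_det fun a b => ?_
    simp only [Matrix.sub_apply, Matrix.smul_apply, smul_eq_mul]
    exact (contDiff_snd.mul contDiff_const).sub ((contDiff_scatter a b).comp contDiff_fst)
  have hFe : ∀ (v : Fin m → Fin p → ℝ) O e s, SpectralData v O e →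
      F (v, s) = ∏ k, (s - e k) := fun v O e s hv => hv.det_smul_one_sub s
  have hloc : ∀ j, ∃ ψ : (Fin m → Fin p → ℝ) → ℝ, DifferentiableAt ℝ ψ u ∧ ψ u = eig u j ∧
      ∀ᶠ v in nhds u, F (v, ψ v) = 0 := by
    intro j
    set k := Fin.castLE (min_le_left p m) j with hk
    have hd : HasDerivAt (fun s => F (u, s))
        (∑ a, (∏ b ∈ Finset.univ.erase a, (eig u j - e b)) • (1 : ℝ)) (eig u j) := by
      simp_rw [hFe u O e _ h]
      exact HasDerivAt.fun_finsetProd fun a _ => (hasDerivAt_id _).sub_const _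
    refine exists_differentiableAt_implicit hF ?_ hd ?_
    · rw [hFe u O e _ h]
      exact Finset.prod_eq_zero (Finset.mem_univ k) (by rw [h.eig_eq, sub_self])
    -- At the root e k only the summand omitting the factor k survives, and it is a product of
    -- nonzero differences.
    · rw [Finset.sum_eq_single k]
      · rw [smul_eq_mul, mul_one, Finset.prod_ne_zero_iff]
        intro b hb
        rw [sub_ne_zero]
        by_cases hbm : (b : ℕ) < min p m
        · have : e b = eig u ⟨b, hbm⟩ := by rw [h.eig_eq]; rfl
          rw [this]
          intro heq
          have := hch.1.injective heq
          apply Finset.ne_of_mem_erase hb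
          rw [hk, this]
          rfl
        · rw [h.eq_zero b (by have := b.2; omega)]
          exact (hch.2 j).ne'
      · intro a _ ha
        rw [Finset.prod_eq_zero (i := k), zero_smul]
        · exact Finset.mem_erase.mpr ⟨ha.symm, Finset.mem_univ _⟩
        · rw [h.eig_eq, sub_self]
      · simp
  choose ψ hψd hψu hψF using hloc
  have hcont : ContinuousAt (fun v j => ψ j v) u :=
    continuousAt_pi.mpr fun j => (hψd j).continuousAt
  -- The chamber is open, so the local roots stay distinct, ordered and positive near u.
  have hev : ∀ᶠ v in nhds u, (fun j => ψ j v) ∈ chamber (min p m) := by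
    refine hcont.eventually_mem ((isOpen_chamber _).mem_nhds ?_)
    simp_rw [hψu]
    exact hch
  have hevF : ∀ᶠ v in nhds u, ∀ j, F (v, ψ j v) = 0 := Filter.eventually_all.mpr hψF
  refine (hψd i).congr_of_eventuallyEq ?_
  filter_upwards [hev, hevF] with v hv hvF
  obtain ⟨O', e', h'⟩ := exists_spectralData v
  rw [h'.eig_eq]
  refine (eq_comp_castLE_of_strictAnti h'.antitone h'.eq_zero hv.1 hv.2 (fun j => ?_) i).symm
  have := hvF j
  rw [hFe v O' e' _ h', Finset.prod_eq_zero_iff] at this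
  obtain ⟨k, -, hk⟩ := this
  exact ⟨k, sub_eq_zero.mp hk⟩

/-- Coefficients `c` with `∑ n, c k n * l j ^ (n + 1) = δ`: the inverse of the matrix
`(l j ^ (n + 1))`. -/
noncomputable def lagrangeCoeff {r : ℕ} (l : Fin r → ℝ) (k n : Fin r) : ℝ :=
  (Matrix.of fun n j : Fin r => l j ^ ((n : ℕ) + 1))⁻¹ k n

theorem det_pow_succ_ne_zero {r : ℕ} {l : Fin r → ℝ} (hl : l ∈ chamber r) :
    (Matrix.of fun n j : Fin r => l j ^ ((n : ℕ) + 1)).det ≠ 0 := by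
  have : (Matrix.of fun n j : Fin r => l j ^ ((n : ℕ) + 1))
      = (vandermonde l)ᵀ * diagonal l := by
    ext n j
    simp [Matrix.mul_diagonal, vandermonde_apply, pow_succ]
  rw [this, det_mul, det_transpose, det_diagonal]
  exact mul_ne_zero (det_vandermonde_ne_zero_iff.mpr hl.1.injective)
    (Finset.prod_ne_zero_iff.mpr fun i _ => (hl.2 i).ne')

/-- Row k holds the coefficients of an interpolation polynomial equal to 1 at l_k and 0 at the other
l_j. The exponents start at 1, so the polynomial also vanishes at 0 and annihilates the kernel of S.
-/
theorem sum_lagrangeCoeff {r : ℕ} {l : Fin r → ℝ} (hl : l ∈ chamber r) (k j : Fin r) :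
    ∑ n, lagrangeCoeff l k n * l j ^ ((n : ℕ) + 1) = if k = j then 1 else 0 := by
  have := congrFun (congrFun (Matrix.nonsing_inv_mul _
    ((det_pow_succ_ne_zero hl).isUnit)) k) j
  rw [Matrix.mul_apply, Matrix.one_apply] at this
  exact this

theorem differentiableAt_lagrangeCoeff {E : Type*} [NormedAddCommGroup E] [NormedSpace ℝ E] {r : ℕ}
    {x : E} {l : E → Fin r → ℝ} (hl : l x ∈ chamber r)
    (hd : ∀ i, DifferentiableAt ℝ (fun v => l v i) x) (k n : Fin r) :
    DifferentiableAt ℝ (fun v => lagrangeCoeff (l v) k n) x := by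
  simp only [lagrangeCoeff, Matrix.inv_def, Matrix.smul_apply, smul_eq_mul,
    Ring.inverse_eq_inv', Matrix.adjugate_apply]
  refine DifferentiableAt.mul (DifferentiableAt.inv (differentiableAt_det fun a b => ?_)
    (det_pow_succ_ne_zero hl)) (differentiableAt_det fun a b => ?_)
  · exact (hd b).pow _
  · by_cases h : a = n
    · subst h; simp
    · simp only [Matrix.updateRow_ne h, Matrix.of_apply]
      exact (hd b).pow _

/-- `∑ k, d k • h_k h_kᵀ`, written as a polynomial in `S = uᵀ u`. -/
noncomputable def spectralFun {p m : ℕ} (d : Fin (min p m) → ℝ) (u : Fin m → Fin p → ℝ) :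
    Matrix (Fin p) (Fin p) ℝ :=
  ∑ n : Fin (min p m), (∑ k, d k * lagrangeCoeff (eig u) k n) • scatter u ^ ((n : ℕ) + 1)

theorem sum_coeff_mul_pow {p m : ℕ} {u : Fin m → Fin p → ℝ} (hu : disc u ≠ 0)
    (d : Fin (min p m) → ℝ) (j : Fin (min p m)) :
    ∑ n : Fin (min p m), (∑ k, d k * lagrangeCoeff (eig u) k n) * eig u j ^ ((n : ℕ) + 1)
      = d j := by
  have hch := (disc_ne_zero_iff u).mp hu
  simp_rw [Finset.sum_mul]
  rw [Finset.sum_comm]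
  simp_rw [mul_assoc, ← Finset.mul_sum, sum_lagrangeCoeff hch]
  simp

theorem scatter_mul_spectralFun {p m : ℕ} (d : Fin (min p m) → ℝ) (u : Fin m → Fin p → ℝ) :
    scatter u * spectralFun d u = spectralFun d u * scatter u := by
  simp only [spectralFun, Finset.mul_sum, Finset.sum_mul, Matrix.mul_smul, Matrix.smul_mul]
  refine Finset.sum_congr rfl fun n _ => ?_
  rw [← pow_succ, ← pow_succ']

/-- Extension of a vector of length `min p m` by zeros. -/
def extend {p m : ℕ} (d : Fin (min p m) → ℝ) (k : Fin p) : ℝ :=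
  if h : (k : ℕ) < min p m then d ⟨k, h⟩ else 0

theorem extend_castLE {p m : ℕ} (d : Fin (min p m) → ℝ) (i : Fin (min p m)) :
    extend d (Fin.castLE (min_le_left p m) i) = d i := by
  simp [extend, i.2]

theorem extend_of_le {p m : ℕ} (d : Fin (min p m) → ℝ) {k : Fin p} (hk : m ≤ k) :
    extend d k = 0 := by
  rw [extend, dif_neg]
  omega

theorem forall_fin_min {p m : ℕ} {P : Fin p → Prop}
    (h1 : ∀ i : Fin (min p m), P (Fin.castLE (min_le_left p m) i))
    (h2 : ∀ k : Fin p, m ≤ k → P k) : ∀ k, P k := by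
  intro k
  by_cases hk : (k : ℕ) < min p m
  · exact h1 ⟨k, hk⟩
  · exact h2 k (by have := k.2; omega)

theorem SpectralData.eq_extend {p m : ℕ} {u : Fin m → Fin p → ℝ} {O : Matrix (Fin p) (Fin p) ℝ}
    {e : Fin p → ℝ} (h : SpectralData u O e) : ∀ k, e k = extend (eig u) k := by
  refine forall_fin_min (m := m) (P := fun k => e k = extend (eig u) k) ?_ ?_
  · intro i
    rw [extend_castLE, h.eig_eq]
  · intro k hk
    rw [h.eq_zero k hk, extend_of_le _ hk]

theorem mul_sum_smul_mul {ι k l n o : Type*} [Fintype l] [Fintype n] (s : Finset ι) (c : ι → ℝ)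
    (A : Matrix k l ℝ) (D : ι → Matrix l n ℝ) (B : Matrix n o ℝ) :
    A * (∑ i ∈ s, c i • D i) * B = ∑ i ∈ s, c i • (A * D i * B) := by
  simp only [Matrix.mul_sum, Matrix.sum_mul, Matrix.mul_smul, Matrix.smul_mul]

/-- Since the polynomial formula involves no eigenvectors, it is differentiable in u although O need
not depend continuously on u. -/
theorem SpectralData.spectralFun_eq {p m : ℕ} {u : Fin m → Fin p → ℝ}
    {O : Matrix (Fin p) (Fin p) ℝ} {e : Fin p → ℝ} (h : SpectralData u O e) (hu : disc u ≠ 0)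
    (d : Fin (min p m) → ℝ) : spectralFun d u = O * diagonal (extend d) * Oᵀ := by
  rw [spectralFun]
  simp only [h.scatter_pow, ← mul_sum_smul_mul]
  congr 2
  ext a b
  rw [Matrix.sum_apply]
  by_cases hab : a = b
  · subst hab
    simp only [Matrix.smul_apply, diagonal_apply_eq, smul_eq_mul]
    revert a
    refine forall_fin_min (m := m) ?_ ?_
    · intro i
      simp_rw [extend_castLE, ← h.eig_eq]
      exact sum_coeff_mul_pow hu d i
    · intro k hk
      simp [extend_of_le _ hk, h.eq_zero k hk]
  · simp [hab]

/-- This links an arbitrary admissible choice of H to the choice-free polynomial expression. -/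
theorem IsEigenvectorMatrix.scatter_mul_spectralFun {p m : ℕ} {u : Fin m → Fin p → ℝ}
    {H : Matrix (Fin p) (Fin (min p m)) ℝ} (h : IsEigenvectorMatrix u H) (hu : disc u ≠ 0)
    (d : Fin (min p m) → ℝ) :
    scatter u * spectralFun d u = H * diagonal (eig u) * diagonal d * Hᵀ := by
  have hpow : ∀ n : ℕ, scatter u ^ (n + 1) = H * diagonal (fun k => eig u k ^ (n + 1)) * Hᵀ := by
    intro n
    induction n with
    | zero => simpa using h.2
    | succ n ih =>
      rw [pow_succ, ih]
      nth_rewrite 1 [h.2]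
      rw [show H * diagonal (fun k => eig u k ^ (n + 1)) * Hᵀ * (H * diagonal (eig u) * Hᵀ)
        = H * diagonal (fun k => eig u k ^ (n + 1)) * (Hᵀ * H) * diagonal (eig u) * Hᵀ by
          simp only [Matrix.mul_assoc], h.1, Matrix.mul_one, Matrix.mul_assoc H,
        Matrix.diagonal_mul_diagonal]
      simp only [pow_succ]
  have : spectralFun d u = H * diagonal d * Hᵀ := by
    rw [spectralFun]
    simp only [hpow, ← mul_sum_smul_mul]
    congr 2
    ext a b
    rw [Matrix.sum_apply]
    by_cases hab : a = b
    · subst hab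
      simp only [Matrix.smul_apply, diagonal_apply_eq, smul_eq_mul]
      exact sum_coeff_mul_pow hu d a
    · simp [hab]
  rw [this]
  nth_rewrite 1 [h.2]
  rw [show H * diagonal (eig u) * Hᵀ * (H * diagonal d * Hᵀ)
    = H * diagonal (eig u) * (Hᵀ * H) * diagonal d * Hᵀ by simp only [Matrix.mul_assoc], h.1,
    Matrix.mul_one]

theorem differentiableAt_spectralFun {p m : ℕ} {u : Fin m → Fin p → ℝ} (hu : disc u ≠ 0)
    {d : (Fin m → Fin p → ℝ) → Fin (min p m) → ℝ}
    (hd : ∀ k, DifferentiableAt ℝ (fun v => d v k) u) (a b : Fin p) :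
    DifferentiableAt ℝ (fun v => spectralFun (d v) v a b) u := by
  simp only [spectralFun, Matrix.sum_apply, Matrix.smul_apply, smul_eq_mul]
  refine DifferentiableAt.fun_sum fun n _ => DifferentiableAt.mul
    (DifferentiableAt.fun_sum fun k _ => (hd k).mul
      (differentiableAt_lagrangeCoeff ((disc_ne_zero_iff u).mp hu)
        (fun i => differentiableAt_eig hu i) k n)) ?_
  exact (contDiff_scatter_pow (n := 1) _ _ _).differentiable one_ne_zero u

end EllipticalModel

/-! ### First-order perturbation of eigenvalues and spectral functions. -/

namespace EllipticalModel

/-- Entrywise directional derivative of a matrix-valued function. -/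
noncomputable def matD {E ι κ : Type*} [NormedAddCommGroup E] [NormedSpace ℝ E]
    (M : E → Matrix ι κ ℝ) (x W : E) : Matrix ι κ ℝ :=
  Matrix.of fun i j => fderiv ℝ (fun v => M v i j) x W

/-- Entrywise differentiability of a matrix-valued function. -/
def MatDiffAt {E ι κ : Type*} [NormedAddCommGroup E] [NormedSpace ℝ E]
    (M : E → Matrix ι κ ℝ) (x : E) : Prop :=
  ∀ i j, DifferentiableAt ℝ (fun v => M v i j) x

section MatD
variable {E ι κ η : Type*} [NormedAddCommGroup E] [NormedSpace ℝ E]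

theorem matD_congr {M N : E → Matrix ι κ ℝ} {x : E} (h : ∀ᶠ v in nhds x, M v = N v) (W : E) :
    matD M x W = matD N x W := by
  ext i j
  simp only [matD, Matrix.of_apply]
  rw [Filter.EventuallyEq.fderiv_eq]
  filter_upwards [h] with v hv
  rw [hv]

theorem MatDiffAt.mul [Fintype κ] {M : E → Matrix ι κ ℝ} {N : E → Matrix κ η ℝ} {x : E}
    (hM : MatDiffAt M x) (hN : MatDiffAt N x) : MatDiffAt (fun v => M v * N v) x := by
  intro i j
  simp only [Matrix.mul_apply]
  exact DifferentiableAt.fun_sum fun k _ => (hM i k).mul (hN k j)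

theorem matD_mul [Fintype κ] {M : E → Matrix ι κ ℝ} {N : E → Matrix κ η ℝ} {x : E}
    (hM : MatDiffAt M x) (hN : MatDiffAt N x) (W : E) :
    matD (fun v => M v * N v) x W = matD M x W * N x + M x * matD N x W := by
  ext i j
  simp only [matD, Matrix.of_apply, Matrix.add_apply, Matrix.mul_apply]
  rw [fderiv_fun_sum (A := fun k v => M v i k * N v k j) fun k _ => (hM i k).mul (hN k j),
    _root_.sum_apply,
    ← Finset.sum_add_distrib]
  refine Finset.sum_congr rfl fun k _ => ?_
  rw [fderiv_fun_mul (hM i k) (hN k j)]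
  simp only [_root_.add_apply, _root_.smul_apply, smul_eq_mul]
  ring

theorem matD_smul {c : E → ℝ} {N : E → Matrix κ η ℝ} {x : E}
    (hc : DifferentiableAt ℝ c x) (hN : MatDiffAt N x) (W : E) :
    matD (fun v => c v • N v) x W = fderiv ℝ c x W • N x + c x • matD N x W := by
  ext i j
  simp only [matD, Matrix.of_apply, Matrix.add_apply, Matrix.smul_apply, smul_eq_mul]
  rw [fderiv_fun_mul hc (hN i j)]
  simp only [_root_.add_apply, _root_.smul_apply, smul_eq_mul]
  ring

end MatD

variable {p m : ℕ}

theorem matDiffAt_of (u : Fin m → Fin p → ℝ) :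
    MatDiffAt (fun v : Fin m → Fin p → ℝ => Matrix.of v) u := by
  intro i j
  simp only [Matrix.of_apply]
  fun_prop

theorem matD_of (u W : Fin m → Fin p → ℝ) :
    matD (fun v : Fin m → Fin p → ℝ => Matrix.of v) u W = Matrix.of W := by
  ext i j
  simp only [matD, Matrix.of_apply]
  have h : HasFDerivAt (fun v : Fin m → Fin p → ℝ => v i j)
      ((ContinuousLinearMap.proj (R := ℝ) (φ := fun _ : Fin p => ℝ) j).comp
        (ContinuousLinearMap.proj (R := ℝ) (φ := fun _ : Fin m => Fin p → ℝ) i)) u :=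
    ((ContinuousLinearMap.proj (R := ℝ) (φ := fun _ : Fin p => ℝ) j).comp
        (ContinuousLinearMap.proj (R := ℝ) (φ := fun _ : Fin m => Fin p → ℝ) i)).hasFDerivAt
  rw [h.fderiv]
  rfl

theorem matDiffAt_scatter (u : Fin m → Fin p → ℝ) : MatDiffAt scatter u :=
  fun a b => (contDiff_scatter (n := 1) a b).differentiable one_ne_zero u

theorem matD_scatter (u W : Fin m → Fin p → ℝ) :
    matD scatter u W = (Matrix.of W)ᵀ * Matrix.of u + (Matrix.of u)ᵀ * Matrix.of W := by
  have h1 : MatDiffAt (fun v : Fin m → Fin p → ℝ => (Matrix.of v)ᵀ) u :=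
    fun i j => matDiffAt_of u j i
  have := matD_mul h1 (matDiffAt_of u) W
  rw [matD_of] at this
  have h2 : matD (fun v : Fin m → Fin p → ℝ => (Matrix.of v)ᵀ) u W = (Matrix.of W)ᵀ := by
    rw [← matD_of u W]
    rfl
  rw [h2] at this
  exact this

theorem eventually_disc_ne {u : Fin m → Fin p → ℝ} (hu : disc u ≠ 0) :
    ∀ᶠ v in nhds u, disc v ≠ 0 :=
  isOpen_disc_ne.mem_nhds hu

theorem matDiffAt_spectralFun {u : Fin m → Fin p → ℝ} (hu : disc u ≠ 0)
    {d : (Fin m → Fin p → ℝ) → Fin (min p m) → ℝ}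
    (hd : ∀ k, DifferentiableAt ℝ (fun v => d v k) u) :
    MatDiffAt (fun v => spectralFun (d v) v) u :=
  differentiableAt_spectralFun hu hd

theorem SpectralData.conj_mul {u : Fin m → Fin p → ℝ} {O : Matrix (Fin p) (Fin p) ℝ}
    {e : Fin p → ℝ} (h : SpectralData u O e) (a b : Fin p → ℝ) :
    O * diagonal a * Oᵀ * (O * diagonal b * Oᵀ) = O * diagonal (fun k => a k * b k) * Oᵀ := by
  rw [show O * diagonal a * Oᵀ * (O * diagonal b * Oᵀ)
    = O * diagonal a * (Oᵀ * O) * diagonal b * Oᵀ by simp only [Matrix.mul_assoc], h.left,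
    Matrix.mul_one, Matrix.mul_assoc O, Matrix.diagonal_mul_diagonal]

/-- First-order perturbation of an eigenvalue. -/
theorem SpectralData.conj_matD_diag {u : Fin m → Fin p → ℝ} {O : Matrix (Fin p) (Fin p) ℝ}
    {e : Fin p → ℝ} (h : SpectralData u O e) (hu : disc u ≠ 0)
    {M : (Fin m → Fin p → ℝ) → Matrix (Fin p) (Fin p) ℝ} {b : (Fin m → Fin p → ℝ) → ℝ}
    (hM : MatDiffAt M u) (hb : DifferentiableAt ℝ b u) (i : Fin (min p m))
    (hMP : ∀ᶠ v in nhds u, M v * spectralFun (Pi.single i 1) v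
      = b v • spectralFun (Pi.single i 1) v) {β : Fin p → ℝ}
    (hMu : M u = O * diagonal β * Oᵀ) (W : Fin m → Fin p → ℝ) :
    (Oᵀ * matD M u W * O) (Fin.castLE (min_le_left p m) i) (Fin.castLE (min_le_left p m) i)
      = fderiv ℝ b u W := by
  set κ := Fin.castLE (min_le_left p m) i
  have hP : MatDiffAt (fun v : Fin m → Fin p → ℝ => spectralFun (Pi.single i 1) v) u :=
    matDiffAt_spectralFun hu fun k => differentiableAt_const _
  set P' := matD (fun v : Fin m → Fin p → ℝ => spectralFun (Pi.single i 1) v) u W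
  have hPu := h.spectralFun_eq hu (Pi.single i 1)
  have hext : ∀ k : Fin p, extend (m := m) (Pi.single i 1) k = if k = κ then 1 else 0 := by
    refine forall_fin_min (m := m) (fun j => ?_) (fun k hk => ?_)
    · rw [extend_castLE, Pi.single_apply]
      have : (j = i) ↔ Fin.castLE (min_le_left p m) j = κ := by simp [κ]
      simp only [this]
    · rw [extend_of_le _ hk, if_neg]
      rintro rfl
      have := i.2
      simp [κ] at hk
      omega
  have hβ : β κ = b u := by
    have h0 := hMP.self_of_nhds
    rw [hMu, hPu, h.conj_mul] at h0
    have h1 : Oᵀ * (O * diagonal (fun k => β k * extend (m := m) (Pi.single i 1) k) * Oᵀ) * O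
      = Oᵀ * (b u • (O * diagonal (extend (m := m) (Pi.single i 1)) * Oᵀ)) * O := by rw [h0]
    have h2 : ∀ D : Matrix (Fin p) (Fin p) ℝ, Oᵀ * (O * D * Oᵀ) * O = D := by
      intro D
      rw [show Oᵀ * (O * D * Oᵀ) * O = Oᵀ * O * D * (Oᵀ * O) by simp only [Matrix.mul_assoc],
        h.left, Matrix.one_mul, Matrix.mul_one]
    rw [Matrix.mul_smul, Matrix.smul_mul, h2, h2] at h1
    have := congrFun (congrFun h1 κ) κ
    simpa [hext] using this
  have key := matD_congr hMP W
  rw [matD_mul hM hP, matD_smul hb hP] at key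
  have key2 : Oᵀ * (matD M u W * spectralFun (Pi.single i 1) u + M u * P') * O
      = Oᵀ * (fderiv ℝ b u W • spectralFun (Pi.single i 1) u + b u • P') * O := by rw [key]
  rw [hPu, hMu, Matrix.mul_add, Matrix.add_mul, Matrix.mul_add, Matrix.add_mul] at key2
  have e1 : Oᵀ * (matD M u W * (O * diagonal (extend (m := m) (Pi.single i 1)) * Oᵀ)) * O
      = Oᵀ * matD M u W * O * diagonal (extend (m := m) (Pi.single i 1)) := by
    rw [show Oᵀ * (matD M u W * (O * diagonal (extend (m := m) (Pi.single i 1)) * Oᵀ)) * O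
      = Oᵀ * matD M u W * O * diagonal (extend (m := m) (Pi.single i 1)) * (Oᵀ * O) by
        simp only [Matrix.mul_assoc], h.left, Matrix.mul_one]
  have e2 : Oᵀ * (O * diagonal β * Oᵀ * P') * O = diagonal β * (Oᵀ * P' * O) := by
    rw [show Oᵀ * (O * diagonal β * Oᵀ * P') * O
      = Oᵀ * O * diagonal β * (Oᵀ * P' * O) by simp only [Matrix.mul_assoc], h.left,
      Matrix.one_mul]
  have e3 : Oᵀ * (fderiv ℝ b u W • (O * diagonal (extend (m := m) (Pi.single i 1)) * Oᵀ)) * O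
      = fderiv ℝ b u W • diagonal (extend (m := m) (Pi.single i 1)) := by
    rw [Matrix.mul_smul, Matrix.smul_mul,
      show Oᵀ * (O * diagonal (extend (m := m) (Pi.single i 1)) * Oᵀ) * O
      = Oᵀ * O * diagonal (extend (m := m) (Pi.single i 1)) * (Oᵀ * O) by
        simp only [Matrix.mul_assoc], h.left, Matrix.mul_one, Matrix.one_mul]
  rw [e1, e2, e3, Matrix.mul_smul, Matrix.smul_mul] at key2
  -- In the entry (κ, κ) the unknown derivative P' of the projector is multiplied by β κ on one side
  -- and by b u on the other; these agree, so it cancels.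
  have := congrFun (congrFun key2 κ) κ
  simp only [Matrix.add_apply, Matrix.mul_diagonal, Matrix.diagonal_mul, Matrix.smul_apply,
    diagonal_apply_eq, hext, if_true, smul_eq_mul, hβ] at this
  linarith

theorem SpectralData.fderiv_eig {u : Fin m → Fin p → ℝ} {O : Matrix (Fin p) (Fin p) ℝ}
    {e : Fin p → ℝ} (h : SpectralData u O e) (hu : disc u ≠ 0) (i : Fin (min p m))
    (W : Fin m → Fin p → ℝ) :
    fderiv ℝ (fun v => eig v i) u W = (Oᵀ * matD scatter u W * O)
      (Fin.castLE (min_le_left p m) i) (Fin.castLE (min_le_left p m) i) := by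
  refine (h.conj_matD_diag hu (matDiffAt_scatter u) (differentiableAt_eig hu i) i ?_
    h.scatter_eq W).symm
  filter_upwards [eventually_disc_ne hu] with v hv
  obtain ⟨O', e', h'⟩ := exists_spectralData v
  rw [h'.spectralFun_eq hv, h'.scatter_eq, h'.conj_mul, ← Matrix.smul_mul, ← Matrix.mul_smul]
  congr 2
  rw [← Matrix.diagonal_smul]
  congr 1
  ext k
  rw [Pi.smul_apply, smul_eq_mul, h'.eq_extend]
  revert k
  refine forall_fin_min (m := m) (fun j => ?_) (fun k hk => ?_)
  · rw [extend_castLE, extend_castLE]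
    by_cases hji : j = i
    · rw [hji]
    · simp [hji]
  · simp [extend_of_le _ hk]

/-- Here the i-th spectral projector P satisfies B P = d_i P, so the eigenvalue perturbation formula
applies to B itself. -/
theorem SpectralData.conj_matD_spectralFun_diag {u : Fin m → Fin p → ℝ}
    {O : Matrix (Fin p) (Fin p) ℝ} {e : Fin p → ℝ} (h : SpectralData u O e) (hu : disc u ≠ 0)
    {d : (Fin m → Fin p → ℝ) → Fin (min p m) → ℝ}
    (hd : ∀ k, DifferentiableAt ℝ (fun v => d v k) u) (i : Fin (min p m))
    (W : Fin m → Fin p → ℝ) :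
    (Oᵀ * matD (fun v => spectralFun (d v) v) u W * O)
      (Fin.castLE (min_le_left p m) i) (Fin.castLE (min_le_left p m) i)
      = fderiv ℝ (fun v => d v i) u W := by
  refine h.conj_matD_diag hu (matDiffAt_spectralFun hu hd) (hd i) i ?_ (h.spectralFun_eq hu _) W
  filter_upwards [eventually_disc_ne hu] with v hv
  obtain ⟨O', e', h'⟩ := exists_spectralData v
  rw [h'.spectralFun_eq hv, h'.spectralFun_eq hv, h'.conj_mul, ← Matrix.smul_mul,
    ← Matrix.mul_smul]
  congr 2
  rw [← Matrix.diagonal_smul]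
  congr 1
  ext k
  rw [Pi.smul_apply, smul_eq_mul]
  revert k
  refine forall_fin_min (m := m) (fun j => ?_) (fun k hk => ?_)
  · rw [extend_castLE, extend_castLE]
    by_cases hji : j = i
    · rw [hji]
    · simp [hji]
  · simp [extend_of_le _ hk]

/-- Differentiating S B = B S and conjugating by O gives the off-diagonal entries of B' without
differentiating eigenvectors. The form without division stays valid when e j = e k. -/
theorem SpectralData.conj_matD_spectralFun_mul_sub {u : Fin m → Fin p → ℝ}
    {O : Matrix (Fin p) (Fin p) ℝ} {e : Fin p → ℝ} (h : SpectralData u O e) (hu : disc u ≠ 0)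
    {d : (Fin m → Fin p → ℝ) → Fin (min p m) → ℝ}
    (hd : ∀ k, DifferentiableAt ℝ (fun v => d v k) u) (j k : Fin p) (W : Fin m → Fin p → ℝ) :
    (Oᵀ * matD (fun v => spectralFun (d v) v) u W * O) j k * (e k - e j)
      = (Oᵀ * matD scatter u W * O) j k * (extend (d u) k - extend (d u) j) := by
  have hB := matDiffAt_spectralFun hu hd
  have hS := matDiffAt_scatter u
  have key := matD_congr (M := fun v => scatter v * spectralFun (d v) v)
    (N := fun v => spectralFun (d v) v * scatter v) (x := u)
    (Filter.Eventually.of_forall fun v => scatter_mul_spectralFun (d v) v) W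
  rw [matD_mul hS hB, matD_mul hB hS, h.spectralFun_eq hu, h.scatter_eq] at key
  set B' := matD (fun v => spectralFun (d v) v) u W
  set S' := matD scatter u W
  set β := extend (d u)
  have key2 : Oᵀ * (S' * (O * diagonal β * Oᵀ) + O * diagonal e * Oᵀ * B') * O
    = Oᵀ * (B' * (O * diagonal e * Oᵀ) + O * diagonal β * Oᵀ * S') * O := by rw [key]
  have r1 : ∀ (A : Matrix (Fin p) (Fin p) ℝ) (f : Fin p → ℝ),
      Oᵀ * (A * (O * diagonal f * Oᵀ)) * O = Oᵀ * A * O * diagonal f := by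
    intro A f
    rw [show Oᵀ * (A * (O * diagonal f * Oᵀ)) * O = Oᵀ * A * O * diagonal f * (Oᵀ * O) by
        simp only [Matrix.mul_assoc], h.left, Matrix.mul_one]
  have r2 : ∀ (A : Matrix (Fin p) (Fin p) ℝ) (f : Fin p → ℝ),
      Oᵀ * (O * diagonal f * Oᵀ * A) * O = diagonal f * (Oᵀ * A * O) := by
    intro A f
    rw [show Oᵀ * (O * diagonal f * Oᵀ * A) * O = Oᵀ * O * diagonal f * (Oᵀ * A * O) by
        simp only [Matrix.mul_assoc], h.left, Matrix.one_mul]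
  simp only [Matrix.mul_add, Matrix.add_mul, r1, r2] at key2
  have := congrFun (congrFun key2 j) k
  simp only [Matrix.add_apply, Matrix.mul_diagonal, Matrix.diagonal_mul] at this
  linarith

end EllipticalModel

/-! ### The vector field and the tools for its divergence. -/

namespace EllipticalModel

variable {p m : ℕ}

/-- The vector field `u ↦ u H Φ(L) Hᵀ`. -/
noncomputable def field (φ : Fin (min p m) → (Fin (min p m) → ℝ) → ℝ) (u : Fin m → Fin p → ℝ) :
    Matrix (Fin m) (Fin p) ℝ :=
  Matrix.of u * spectralFun (fun k => φ k (eig u)) u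

/-- The divergence of `u ↦ u H Φ(L) Hᵀ` in terms of the eigenvalues. -/
noncomputable def steinHaff (p m : ℕ) (φ : Fin (min p m) → (Fin (min p m) → ℝ) → ℝ)
    (l : Fin (min p m) → ℝ) : ℝ :=
  ∑ i : Fin (min p m),
    ((((max p m : ℕ) : ℝ) - ((min p m : ℕ) : ℝ) + 1) * φ i l
      + 2 * l i * partialDeriv (φ i) i l
      + ∑ j ∈ Finset.univ.erase i, (l i * φ i l - l j * φ j l) / (l i - l j))

theorem differentiableAt_comp_eig {u : Fin m → Fin p → ℝ} (hu : disc u ≠ 0)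
    {g : (Fin (min p m) → ℝ) → ℝ} (hg : DifferentiableOn ℝ g (chamber (min p m))) :
    DifferentiableAt ℝ (fun v => g (eig v)) u := by
  have hch := (disc_ne_zero_iff u).mp hu
  have h1 : DifferentiableAt ℝ g (eig u) := hg.differentiableAt ((isOpen_chamber _).mem_nhds hch)
  exact h1.comp u (differentiableAt_pi.mpr fun i => differentiableAt_eig hu i)

theorem fderiv_comp_eig {u : Fin m → Fin p → ℝ} (hu : disc u ≠ 0)
    {g : (Fin (min p m) → ℝ) → ℝ} (hg : DifferentiableAt ℝ g (eig u)) (W : Fin m → Fin p → ℝ) :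
    fderiv ℝ (fun v => g (eig v)) u W
      = ∑ k, partialDeriv g k (eig u) * fderiv ℝ (fun v => eig v k) u W := by
  have h1 : HasFDerivAt (eig (p := p) (m := m))
      (ContinuousLinearMap.pi fun i => fderiv ℝ (fun v => eig v i) u) u :=
    hasFDerivAt_pi.mpr fun i => (differentiableAt_eig hu i).hasFDerivAt
  have h2 := (hg.hasFDerivAt.comp u h1).fderiv
  have h3 : (fun v => g (eig v)) = g ∘ eig (p := p) (m := m) := rfl
  rw [h3, h2, ContinuousLinearMap.comp_apply]
  set w := (ContinuousLinearMap.pi fun i => fderiv ℝ (fun v => eig v i) u) W with hw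
  have h4 : w = ∑ k, w k • Pi.single k (1 : ℝ) := by
    ext j
    simp [Finset.sum_apply, Pi.single_apply]
  rw [h4, map_sum]
  refine Finset.sum_congr rfl fun k _ => ?_
  rw [map_smul, smul_eq_mul, mul_comm]
  rfl

theorem matDiffAt_field {u : Fin m → Fin p → ℝ} (hu : disc u ≠ 0)
    {φ : Fin (min p m) → (Fin (min p m) → ℝ) → ℝ}
    (hφ : ∀ i, DifferentiableOn ℝ (φ i) (chamber (min p m))) : MatDiffAt (field φ) u :=
  (matDiffAt_of u).mul (matDiffAt_spectralFun hu fun k => differentiableAt_comp_eig hu (hφ k))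

/-- The trace of a linear map on matrices, in a rotated basis. -/
theorem sum_apply_single_eq {O : Matrix (Fin p) (Fin p) ℝ} (hO : O * Oᵀ = 1)
    (T : Fin m → Fin p → ((Fin m → Fin p → ℝ) →L[ℝ] ℝ)) :
    ∑ a, ∑ b, T a b (Pi.single a (Pi.single b 1))
      = ∑ a, ∑ k, ∑ b, T a b (Pi.single a fun c => O c k) * O b k := by
  refine Finset.sum_congr rfl fun a _ => ?_
  rw [Finset.sum_comm]
  refine Finset.sum_congr rfl fun b _ => ?_
  have : (Pi.single a (Pi.single b 1) : Fin m → Fin p → ℝ)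
      = ∑ k, O b k • Pi.single a fun c => O c k := by
    ext a' c
    simp only [Finset.sum_apply, Pi.smul_apply, smul_eq_mul]
    by_cases h : a' = a
    · subst h
      have := congrFun (congrFun hO b) c
      rw [Matrix.mul_apply, Matrix.one_apply] at this
      simp only [Pi.single_eq_same, Pi.single_apply]
      simp only [Matrix.transpose_apply] at this
      rw [this]
      simp [eq_comm]
    · simp [Pi.single_eq_of_ne h]
  rw [this, map_sum]
  refine Finset.sum_congr rfl fun k _ => ?_
  rw [map_smul, smul_eq_mul, mul_comm]

theorem SpectralData.sum_sq {u : Fin m → Fin p → ℝ} {O : Matrix (Fin p) (Fin p) ℝ}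
    {e : Fin p → ℝ} (h : SpectralData u O e) (j : Fin p) :
    ∑ a, (Matrix.of u * O) a j ^ 2 = e j := by
  have h1 : (Matrix.of u * O)ᵀ * (Matrix.of u * O) = diagonal e := by
    rw [Matrix.transpose_mul, show Oᵀ * (Matrix.of u)ᵀ * (Matrix.of u * O)
      = Oᵀ * scatter u * O by simp only [scatter, Matrix.mul_assoc], h.scatter_eq,
      show Oᵀ * (O * diagonal e * Oᵀ) * O = Oᵀ * O * diagonal e * (Oᵀ * O) by
        simp only [Matrix.mul_assoc], h.left, Matrix.one_mul, Matrix.mul_one]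
  have := congrFun (congrFun h1 j) j
  rw [Matrix.mul_apply, diagonal_apply_eq] at this
  rw [← this]
  exact Finset.sum_congr rfl fun a _ => by rw [Matrix.transpose_apply, sq]

/-- For the direction W with row a equal to the k-th column of O, W O is the matrix unit at (a, k),
and S' = Wᵀu + uᵀW. -/
theorem SpectralData.conj_matD_scatter_apply {u : Fin m → Fin p → ℝ}
    {O : Matrix (Fin p) (Fin p) ℝ} {e : Fin p → ℝ} (h : SpectralData u O e) (a : Fin m)
    (k i j : Fin p) :
    (Oᵀ * matD scatter u (Pi.single a fun c => O c k) * O) i j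
      = (if i = k then (Matrix.of u * O) a j else 0)
        + (if j = k then (Matrix.of u * O) a i else 0) := by
  set W : Fin m → Fin p → ℝ := Pi.single a fun c => O c k with hW
  have hWO : Matrix.of W * O = Matrix.of fun a' k' => if a' = a ∧ k' = k then 1 else 0 := by
    ext a' k'
    rw [Matrix.mul_apply, Matrix.of_apply]
    simp only [Matrix.of_apply, hW]
    by_cases ha : a' = a
    · subst ha
      have := congrFun (congrFun h.left k) k'
      rw [Matrix.mul_apply, Matrix.one_apply] at this
      simp only [Matrix.transpose_apply] at this
      simp [this, eq_comm]
    · simp [ha]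
  rw [matD_scatter, show Oᵀ * ((Matrix.of W)ᵀ * Matrix.of u + (Matrix.of u)ᵀ * Matrix.of W) * O
    = (Matrix.of W * O)ᵀ * (Matrix.of u * O) + (Matrix.of u * O)ᵀ * (Matrix.of W * O) by
      simp only [Matrix.transpose_mul, Matrix.mul_add, Matrix.add_mul, Matrix.mul_assoc], hWO]
  rw [Matrix.add_apply, Matrix.mul_apply, Matrix.mul_apply]
  simp only [Matrix.transpose_apply, Matrix.of_apply]
  congr 1
  · rw [Finset.sum_eq_single a]
    · simp
    · intro b _ hb; simp [hb]
    · simp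
  · rw [Finset.sum_eq_single a]
    · simp
    · intro b _ hb; simp [hb]
    · simp

/-- Termwise, l_j (f_i - f_j) / (l_i - l_j) = (l_i f_i - l_j f_j) / (l_i - l_j) - f_i, and -f_i
occurs r - 1 times. -/
theorem sum_offDiag_symm {r : ℕ} {l f : Fin r → ℝ} (hl : Function.Injective l) :
    ∑ i, ∑ j ∈ Finset.univ.erase i, l j * (f i - f j) / (l i - l j)
      = ∑ i, ((1 - (r : ℝ)) * f i
        + ∑ j ∈ Finset.univ.erase i, (l i * f i - l j * f j) / (l i - l j)) := by
  have e1 : ∀ i, ∑ j ∈ Finset.univ.erase i, l j * (f i - f j) / (l i - l j)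
      = ∑ j ∈ Finset.univ.erase i, (l i * f i - l j * f j) / (l i - l j) + (1 - (r : ℝ)) * f i := by
    intro i
    have : (1 - (r : ℝ)) * f i = ∑ j ∈ Finset.univ.erase i, (- f i) := by
      rw [Finset.sum_const, Finset.card_erase_of_mem (Finset.mem_univ i), Finset.card_univ,
        Fintype.card_fin, nsmul_eq_mul, Nat.cast_sub (by have := i.2; omega)]
      push_cast
      ring
    rw [this, ← Finset.sum_add_distrib]
    refine Finset.sum_congr rfl fun j hj => ?_
    have : l i - l j ≠ 0 := sub_ne_zero.mpr fun h => (Finset.ne_of_mem_erase hj) (hl h).symm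
    field_simp
    ring
  simp_rw [e1]
  exact Finset.sum_congr rfl fun i _ => add_comm _ _

end EllipticalModel

/-! ### The divergence of the field and the rate of change of the discriminant. -/

namespace EllipticalModel

variable {p m : ℕ}

theorem not_le_castLE (i : Fin (min p m)) :
    ¬ m ≤ ((Fin.castLE (min_le_left p m) i : Fin p) : ℕ) := by
  have := i.2
  simp only [Fin.val_castLE, not_le]
  omega

theorem sum_fin_eq_add (F : Fin p → ℝ) (C : ℝ) (hF : ∀ k : Fin p, m ≤ k → F k = C) :
    ∑ k, F k = ∑ i : Fin (min p m), F (Fin.castLE (min_le_left p m) i)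
      + ((p : ℝ) - (min p m : ℕ)) * C := by
  have h1 : ∑ k, (F k - C) = ∑ i : Fin (min p m), (F (Fin.castLE (min_le_left p m) i) - C) :=
    sum_eq_sum_castLE _ fun k hk => by rw [hF k hk, sub_self]
  rw [Finset.sum_sub_distrib, Finset.sum_sub_distrib, Finset.sum_const, Finset.sum_const,
    Finset.card_univ, Finset.card_univ, Fintype.card_fin, Fintype.card_fin, nsmul_eq_mul,
    nsmul_eq_mul] at h1
  linarith

/-- With N = uO, the rotated direction (a, k) contributes β_k + ∑_j N_aj X_jk, where X is the
conjugated derivative of B. Perturbation theory gives X_kk = 2 N_ak γ_k for k < r and X_jk = N_aj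
(β_k - β_j) / (e_k - e_j) when e_j ≠ e_k. Summing over a uses ∑_a N_aj² = e_j. -/
theorem SpectralData.divergence_field {u : Fin m → Fin p → ℝ} {O : Matrix (Fin p) (Fin p) ℝ}
    {e : Fin p → ℝ} (h : SpectralData u O e) (hu : disc u ≠ 0)
    {φ : Fin (min p m) → (Fin (min p m) → ℝ) → ℝ}
    (hφ : ∀ i, DifferentiableOn ℝ (φ i) (chamber (min p m))) {β γ : Fin p → ℝ}
    (hβ : β = extend fun k => φ k (eig u))
    (hγ : γ = extend fun k => partialDeriv (φ k) k (eig u)) :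
    ∑ a, ∑ b, fderiv ℝ (fun v => field φ v a b) u (Pi.single a (Pi.single b 1))
      = ∑ k, (m * β k + 2 * e k * γ k
        + ∑ j ∈ Finset.univ.erase k, e j * (β k - β j) / (e k - e j)) := by
  have hch := (disc_ne_zero_iff u).mp hu
  have hd : ∀ k, DifferentiableAt ℝ (fun v => φ k (eig (p := p) (m := m) v)) u :=
    fun k => differentiableAt_comp_eig hu (hφ k)
  have hB := matDiffAt_spectralFun hu (d := fun v k => φ k (eig v)) hd
  set N := Matrix.of u * O with hN
  have hNsq : ∀ j, ∑ a, N a j ^ 2 = e j := h.sum_sq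
  have hN0 : ∀ j, e j = 0 → ∀ a, N a j = 0 := by
    intro j hj a
    have h1 := hNsq j
    rw [hj, Finset.sum_eq_zero_iff_of_nonneg fun _ _ => sq_nonneg _] at h1
    exact pow_eq_zero_iff (two_ne_zero) |>.mp (h1 a (Finset.mem_univ a))
  -- On the regular set the only repeated eigenvalue is 0, where the column of N vanishes;
  -- undetermined entries of X therefore do not contribute.
  have hee : ∀ j k, j ≠ k → e k = e j → e j = 0 := by
    intro j
    refine forall_fin_min (m := m) (fun i hne heq => ?_) (fun k hk hne heq => ?_)
    · by_contra h0
      have hjm : (j : ℕ) < min p m := by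
        by_contra hc
        exact h0 (h.eq_zero j (by have := j.2; omega))
      have hj : j = Fin.castLE (min_le_left p m) ⟨j, hjm⟩ := rfl
      rw [hj, ← h.eig_eq, ← h.eig_eq] at heq
      have := hch.1.injective heq
      apply hne
      rw [hj, this]
    · rw [← heq, h.eq_zero k hk]
  set W : Fin m → Fin p → Fin m → Fin p → ℝ := fun a k => Pi.single a fun c => O c k with hW
  set X : Fin m → Fin p → Matrix (Fin p) (Fin p) ℝ := fun a k =>
    Oᵀ * matD (fun v => spectralFun (fun k => φ k (eig v)) v) u (W a k) * O with hX
  have hmain : ∀ a k, ∑ b, fderiv ℝ (fun v => field φ v a b) u (W a k) * O b k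
      = β k + ∑ j, N a j * X a k j k := by
    intro a k
    have e1 : ∑ b, fderiv ℝ (fun v => field φ v a b) u (W a k) * O b k
        = (matD (field φ) u (W a k) * O) a k := by
      rw [Matrix.mul_apply]; rfl
    have e2 : matD (field φ) u (W a k) = Matrix.of (W a k)
        * (O * diagonal β * Oᵀ)
        + Matrix.of u * matD (fun v => spectralFun (fun k => φ k (eig v)) v) u (W a k) := by
      have := matD_mul (matDiffAt_of u) hB (W a k)
      rw [matD_of, h.spectralFun_eq hu, ← hβ] at this
      exact this
    have e3 : matD (field φ) u (W a k) * O
        = Matrix.of (W a k) * O * diagonal β + N * X a k := by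
      rw [e2, Matrix.add_mul, hX, hN]
      congr 1
      · rw [show Matrix.of (W a k) * (O * diagonal β * Oᵀ) * O
          = Matrix.of (W a k) * O * diagonal β * (Oᵀ * O) by simp only [Matrix.mul_assoc],
          h.left, Matrix.mul_one]
      · rw [show Matrix.of u * O * (Oᵀ * matD (fun v => spectralFun (fun k => φ k (eig v)) v) u
          (W a k) * O) = Matrix.of u * (O * Oᵀ)
          * matD (fun v => spectralFun (fun k => φ k (eig v)) v) u (W a k) * O by
            simp only [Matrix.mul_assoc], h.right, Matrix.mul_one]
    rw [e1, e3, Matrix.add_apply, Matrix.mul_diagonal, Matrix.mul_apply (M := N)]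
    congr 1
    have : (Matrix.of (W a k) * O) a k = 1 := by
      have := congrFun (congrFun h.left k) k
      rw [Matrix.mul_apply, Matrix.one_apply_eq] at this
      rw [Matrix.mul_apply, ← this]
      simp [hW]
    rw [this, one_mul]
  have hdiag : ∀ a k, N a k * X a k k k = 2 * N a k ^ 2 * γ k := by
    intro a
    refine forall_fin_min (m := m) (fun i => ?_) (fun k hk => ?_)
    · set κ := Fin.castLE (min_le_left p m) i
      have e1 : X a κ κ κ = fderiv ℝ (fun v => φ i (eig v)) u (W a κ) :=
        h.conj_matD_spectralFun_diag hu (d := fun v k => φ k (eig v)) hd i (W a κ)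
      have e2 : ∀ l, fderiv ℝ (fun v => eig v l) u (W a κ) = if l = i then 2 * N a κ else 0 := by
        intro l
        rw [h.fderiv_eig hu, h.conj_matD_scatter_apply]
        by_cases hli : l = i
        · subst hli
          simp only [κ, if_true]
          ring
        · have : Fin.castLE (min_le_left p m) l ≠ κ := by simpa [κ] using hli
          simp [hli, this]
      rw [e1, fderiv_comp_eig hu ((hφ i).differentiableAt ((isOpen_chamber _).mem_nhds hch)), hγ,
        extend_castLE]
      simp only [e2, mul_ite, mul_zero, Finset.sum_ite_eq', Finset.mem_univ, if_true]
      ring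
    · rw [hN0 k (h.eq_zero k hk)]
      ring
  have hoff : ∀ a k j, j ≠ k → N a j * X a k j k = N a j ^ 2 * ((β k - β j) / (e k - e j)) := by
    intro a k j hjk
    by_cases he : e k = e j
    · rw [hN0 j (hee j k hjk he)]
      ring
    · have h1 := h.conj_matD_spectralFun_mul_sub hu (d := fun v k => φ k (eig v)) hd j k (W a k)
      rw [h.conj_matD_scatter_apply, if_neg hjk, if_pos rfl, zero_add] at h1
      have h2 : e k - e j ≠ 0 := sub_ne_zero.mpr he
      have h3 : X a k j k = N a j * ((β k - β j) / (e k - e j)) := by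
        rw [← mul_div_assoc, eq_div_iff h2, hβ]
        exact h1
      rw [h3]
      ring
  rw [sum_apply_single_eq h.right (fun a b => fderiv ℝ (fun v => field φ v a b) u)]
  simp_rw [show ∀ a k, (Pi.single a fun c => O c k) = W a k from fun _ _ => rfl, hmain]
  rw [Finset.sum_comm]
  refine Finset.sum_congr rfl fun k _ => ?_
  have e4 : ∀ a, β k + ∑ j, N a j * X a k j k = β k + 2 * N a k ^ 2 * γ k
      + ∑ j ∈ Finset.univ.erase k, N a j ^ 2 * ((β k - β j) / (e k - e j)) := by
    intro a
    rw [← Finset.add_sum_erase _ _ (Finset.mem_univ k), hdiag, add_assoc]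
    congr 2
    exact Finset.sum_congr rfl fun j hj => hoff a k j (Finset.ne_of_mem_erase hj)
  simp_rw [e4]
  rw [Finset.sum_add_distrib, Finset.sum_add_distrib, Finset.sum_comm]
  congr 1
  · congr 1
    · simp
    · rw [← Finset.sum_mul, ← Finset.mul_sum, hNsq]
  · refine Finset.sum_congr rfl fun j _ => ?_
    rw [← Finset.sum_mul, hNsq, mul_div_assoc]

/-- Each of the p - r null indices contributes ∑ φ_j, since e_j (0 - φ_j) / (0 - e_j) = φ_j. The
coefficient of φ_i becomes m + (p - r) - (r - 1) = v - r + 1. -/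
theorem divergence_field {u : Fin m → Fin p → ℝ} (hu : disc u ≠ 0)
    {φ : Fin (min p m) → (Fin (min p m) → ℝ) → ℝ}
    (hφ : ∀ i, DifferentiableOn ℝ (φ i) (chamber (min p m))) :
    ∑ a, ∑ b, fderiv ℝ (fun v => field φ v a b) u (Pi.single a (Pi.single b 1))
      = steinHaff p m φ (eig u) := by
  obtain ⟨O, e, h⟩ := exists_spectralData u
  have hch := (disc_ne_zero_iff u).mp hu
  rw [h.divergence_field hu hφ rfl rfl]
  set β : Fin p → ℝ := extend fun k => φ k (eig u) with hβ
  set γ : Fin p → ℝ := extend fun k => partialDeriv (φ k) k (eig u) with hγ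
  rw [sum_fin_eq_add (m := m) _ (∑ i, φ i (eig u))]
  · have e1 : ∀ i : Fin (min p m), (m * β (Fin.castLE (min_le_left p m) i)
        + 2 * e (Fin.castLE (min_le_left p m) i) * γ (Fin.castLE (min_le_left p m) i)
        + ∑ j ∈ Finset.univ.erase (Fin.castLE (min_le_left p m) i),
          e j * (β (Fin.castLE (min_le_left p m) i) - β j)
            / (e (Fin.castLE (min_le_left p m) i) - e j))
      = m * φ i (eig u) + 2 * eig u i * partialDeriv (φ i) i (eig u)
        + ∑ j ∈ Finset.univ.erase i, eig u j * (φ i (eig u) - φ j (eig u))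
            / (eig u i - eig u j) := by
      intro i
      rw [hγ, extend_castLE, hβ, extend_castLE, ← h.eig_eq]
      congr 1
      rw [← Finset.filter_ne', ← Finset.filter_ne', Finset.sum_filter, Finset.sum_filter,
        sum_eq_sum_castLE (m := m)]
      · refine Finset.sum_congr rfl fun j _ => ?_
        rw [extend_castLE, ← h.eig_eq]
        simp
      · intro k hk
        rw [h.eq_zero k hk]
        simp
    simp_rw [e1]
    rw [Finset.sum_add_distrib, sum_offDiag_symm (l := eig u) (f := fun i => φ i (eig u))
      hch.1.injective, Finset.mul_sum, ← Finset.sum_add_distrib, ← Finset.sum_add_distrib,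
      steinHaff]
    refine Finset.sum_congr rfl fun i _ => ?_
    have hmax : ((max p m : ℕ) : ℝ) = p + m - (min p m : ℕ) := by
      rw [eq_sub_iff_add_eq]
      exact_mod_cast max_add_min p m
    rw [hmax]
    ring
  · intro k hk
    rw [hγ, hβ, extend_of_le _ hk, extend_of_le _ hk, h.eq_zero k hk, ← Finset.filter_ne',
      Finset.sum_filter, sum_eq_sum_castLE (m := m)]
    · simp only [mul_zero, zero_add, zero_sub, mul_neg]
      refine Finset.sum_congr rfl fun j _ => ?_
      rw [extend_castLE, ← h.eig_eq, if_pos]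
      · have := (hch.2 j).ne'
        field_simp
      · rintro rfl
        exact not_le_castLE j hk
    · intro j hj
      rw [h.eq_zero j hj]
      simp

/-- The derivative of an eigenvalue of `S` along the field `u H Φ(L) Hᵀ`. -/
theorem fderiv_eig_field {u : Fin m → Fin p → ℝ} (hu : disc u ≠ 0)
    (φ : Fin (min p m) → (Fin (min p m) → ℝ) → ℝ) (i : Fin (min p m)) :
    fderiv ℝ (fun v => eig v i) u (fun a b => field φ u a b) = 2 * eig u i * φ i (eig u) := by
  obtain ⟨O, e, h⟩ := exists_spectralData u
  rw [h.fderiv_eig hu, matD_scatter]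
  set B := spectralFun (fun k => φ k (eig u)) u with hB
  have hBe : B = O * diagonal (extend fun k => φ k (eig u)) * Oᵀ := h.spectralFun_eq hu _
  have hBt : Bᵀ = B := by
    rw [hBe]
    simp [Matrix.transpose_mul, Matrix.mul_assoc]
  have e1 : (Matrix.of fun a b => field φ u a b) = Matrix.of u * B := rfl
  have e2 : (Matrix.of fun a b => field φ u a b)ᵀ * Matrix.of u
      + (Matrix.of u)ᵀ * (Matrix.of fun a b => field φ u a b) = B * scatter u + scatter u * B := by
    rw [e1, Matrix.transpose_mul, hBt, scatter, Matrix.mul_assoc, Matrix.mul_assoc]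
  have r2 : ∀ f : Fin p → ℝ, Oᵀ * (O * diagonal f * Oᵀ) * O = diagonal f := by
    intro f
    rw [show Oᵀ * (O * diagonal f * Oᵀ) * O = Oᵀ * O * diagonal f * (Oᵀ * O) by
        simp only [Matrix.mul_assoc], h.left, Matrix.one_mul, Matrix.mul_one]
  rw [e2, hBe, h.scatter_eq, h.conj_mul, h.conj_mul, Matrix.mul_add, Matrix.add_mul, r2, r2,
    Matrix.add_apply, diagonal_apply_eq, diagonal_apply_eq, extend_castLE, ← h.eig_eq]
  ring

/-- The logarithmic derivative of `disc` along the field `u H Φ(L) Hᵀ`. -/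
noncomputable def discRate (φ : Fin (min p m) → (Fin (min p m) → ℝ) → ℝ)
    (l : Fin (min p m) → ℝ) : ℝ :=
  2 * ∑ i, ∑ j ∈ Finset.Ioi i, 2 * ((l j * φ j l - l i * φ i l) / (l j - l i))
    + ∑ i, 2 * φ i l

/-- Logarithmic derivatives add; the form c with f' = f c avoids division. -/
theorem hasFDerivAt_prod_of_eq_mul {E ι : Type*} [NormedAddCommGroup E] [NormedSpace ℝ E]
    {s : Finset ι} {f : ι → E → ℝ} {c : ι → ℝ} {x W : E}
    (hf : ∀ i ∈ s, DifferentiableAt ℝ (f i) x) (hc : ∀ i ∈ s, fderiv ℝ (f i) x W = f i x * c i) :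
    DifferentiableAt ℝ (fun v => ∏ i ∈ s, f i v) x ∧
      fderiv ℝ (fun v => ∏ i ∈ s, f i v) x W = (∏ i ∈ s, f i x) * ∑ i ∈ s, c i := by
  classical
  induction s using Finset.induction_on with
  | empty => simp
  | insert a s ha ih =>
    obtain ⟨h1, h2⟩ := ih (fun i hi => hf i (Finset.mem_insert_of_mem hi))
      fun i hi => hc i (Finset.mem_insert_of_mem hi)
    have h3 := hf a (Finset.mem_insert_self a s)
    simp_rw [Finset.prod_insert ha]
    refine ⟨h3.mul h1, ?_⟩
    rw [fderiv_fun_mul h3 h1, Finset.sum_insert ha]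
    simp only [_root_.add_apply, _root_.smul_apply, smul_eq_mul]
    rw [h2, hc a (Finset.mem_insert_self a s)]
    ring

/-- Along the field l_i moves at rate 2 l_i φ_i, so l_j - l_i has logarithmic derivative 2 (l_j φ_j
- l_i φ_i) / (l_j - l_i). These are precisely the quotients assumed integrable under E*. -/
theorem fderiv_disc_field {u : Fin m → Fin p → ℝ} (hu : disc u ≠ 0)
    (φ : Fin (min p m) → (Fin (min p m) → ℝ) → ℝ) :
    fderiv ℝ disc u (fun a b => field φ u a b) = disc u * discRate φ (eig u) := by
  have hch := (disc_ne_zero_iff u).mp hu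
  set V : Fin m → Fin p → ℝ := fun a b => field φ u a b
  have hd := fun i : Fin (min p m) => differentiableAt_eig hu i
  have hV := fun i : Fin (min p m) => fderiv_eig_field hu φ i
  have h1 : ∀ i j : Fin (min p m), i ≠ j →
      fderiv ℝ (fun v => eig v j - eig v i) u V = (eig u j - eig u i)
        * (2 * ((eig u j * φ j (eig u) - eig u i * φ i (eig u)) / (eig u j - eig u i))) := by
    intro i j hij
    have : eig u j - eig u i ≠ 0 := sub_ne_zero.mpr fun h => hij (hch.1.injective h).symm
    rw [fderiv_fun_sub (hd j) (hd i), _root_.sub_apply, hV, hV]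
    field_simp
  have h2 : ∀ i : Fin (min p m), _ := fun i => hasFDerivAt_prod_of_eq_mul
    (s := Finset.Ioi i) (f := fun j v => eig v j - eig (p := p) (m := m) v i) (x := u) (W := V)
    (c := fun j => 2 * ((eig u j * φ j (eig u) - eig u i * φ i (eig u)) / (eig u j - eig u i)))
    (fun j _ => (hd j).sub (hd i)) (fun j hj => h1 i j (Finset.mem_Ioi.mp hj).ne)
  have h3 := hasFDerivAt_prod_of_eq_mul (s := Finset.univ)
    (f := fun i v => ∏ j ∈ Finset.Ioi i, (eig v j - eig (p := p) (m := m) v i)) (x := u) (W := V)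
    (fun i _ => (h2 i).1) (fun i _ => (h2 i).2)
  have h4 := hasFDerivAt_prod_of_eq_mul (s := Finset.univ)
    (f := fun i v => eig (p := p) (m := m) v i) (x := u) (W := V) (c := fun i => 2 * φ i (eig u))
    (fun i _ => hd i) (fun i _ => by rw [hV]; ring)
  have h5 : (disc : (Fin m → Fin p → ℝ) → ℝ) = fun v =>
      (∏ i, ∏ j ∈ Finset.Ioi i, (eig v j - eig v i)) ^ 2 * ∏ k, eig v k := by
    ext v
    rw [disc_eq, det_vandermonde]
  rw [h5]
  rw [fderiv_fun_mul (h3.1.fun_pow 2) h4.1, fderiv_fun_pow 2 h3.1]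
  simp only [_root_.add_apply, _root_.smul_apply, smul_eq_mul]
  rw [h3.2, h4.2, discRate]
  simp only [nsmul_eq_mul]
  push_cast
  ring

end EllipticalModel

/-! ### Null sets through rays, and the divergence theorem. -/

namespace EllipticalModel

section Rays
variable {E : Type*} [NormedAddCommGroup E] [NormedSpace ℝ E] [FiniteDimensional ℝ E]
  [MeasurableSpace E] [BorelSpace E]

/-- A measurable set which almost every ray from `c` meets in a null set of parameters is null. -/
theorem measure_eq_zero_of_rays (μ : Measure E) [μ.IsAddHaarMeasure] {N : Set E}
    (hN : MeasurableSet N) (c : E)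
    (h : ∀ w : E, ∀ᵐ t ∂(volume.restrict (Set.Icc (1 : ℝ) 2)), c + t • w ∉ N) : μ N = 0 := by
  have hm : MeasurableSet {x : E × ℝ | c + x.2 • x.1 ∉ N} := by
    have : Measurable fun x : E × ℝ => c + x.2 • x.1 := by fun_prop
    exact this hN.compl
  have h1 : ∀ᵐ w ∂μ, ∀ᵐ t ∂(volume.restrict (Set.Icc (1 : ℝ) 2)), c + t • w ∉ N :=
    Filter.Eventually.of_forall h
  rw [Measure.ae_ae_comm (p := fun w t => c + t • w ∉ N) hm] at h1
  have h2 := h1.and (ae_restrict_mem measurableSet_Icc)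
  have hne : (volume.restrict (Set.Icc (1 : ℝ) 2)) ≠ 0 := by
    rw [Ne, Measure.restrict_eq_zero]
    simp
  have : (ae (volume.restrict (Set.Icc (1 : ℝ) 2))).NeBot := ae_neBot.mpr hne
  -- After Fubini, one nonzero scale t suffices: the set of w with c + t w in N is an affine image
  -- of N.
  obtain ⟨t, ht, ht1⟩ := h2.exists
  have ht0 : t ≠ 0 := by have := ht1.1; linarith
  have h3 : μ ((t • ·) ⁻¹' ((c + ·) ⁻¹' N)) = 0 := by
    rw [ae_iff] at ht
    simp only [not_not] at ht
    exact ht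
  rw [Measure.addHaar_preimage_smul μ ht0, mul_eq_zero, measure_preimage_add] at h3
  refine h3.resolve_left ?_
  rw [ENNReal.ofReal_eq_zero, not_le, abs_pos]
  exact inv_ne_zero (pow_ne_zero _ ht0)

end Rays

variable {p m : ℕ}

theorem exists_disc_ne_zero (p m : ℕ) : ∃ u : Fin m → Fin p → ℝ, disc u ≠ 0 := by
  let d : Fin p → ℝ := fun b => if (b : ℕ) < m then ((b : ℝ) + 1) ^ 2 else 0
  -- A rectangular diagonal matrix with singular values 1, ..., r.
  let u : Fin m → Fin p → ℝ := fun a b => if (a : ℕ) = b then (b : ℝ) + 1 else 0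
  have hS : scatter u = diagonal d := by
    ext b c
    rw [scatter, Matrix.mul_apply]
    simp only [Matrix.transpose_apply, Matrix.of_apply, u]
    by_cases hbc : b = c
    · subst hbc
      rw [diagonal_apply_eq]
      by_cases hb : (b : ℕ) < m
      · rw [Finset.sum_eq_single ⟨b, hb⟩]
        · simp [d, hb, sq]
        · intro a _ ha
          rw [if_neg, zero_mul]
          exact fun h => ha (Fin.ext h)
        · simp
      · refine (Finset.sum_eq_zero fun a _ => ?_).trans (by simp [d, hb])
        rw [if_neg, zero_mul]
        have := a.2
        omega
    · rw [diagonal_apply_ne _ hbc]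
      refine Finset.sum_eq_zero fun a _ => ?_
      by_cases h1 : (a : ℕ) = b
      · rw [if_neg (c := (a : ℕ) = c), mul_zero]
        exact fun h2 => hbc (Fin.ext (h1.symm.trans h2))
      · rw [if_neg h1, zero_mul]
  refine ⟨u, ?_⟩
  let l : Fin (min p m) → ℝ := fun i => ((i : ℝ) + 1) ^ 2
  have htr : ∀ n : ℕ, (scatter u ^ (n + 1)).trace = ∑ k, l k ^ (n + 1) := by
    intro n
    rw [hS, Matrix.diagonal_pow, Matrix.trace_diagonal, sum_eq_sum_castLE (m := m)]
    · refine Finset.sum_congr rfl fun k _ => ?_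
      have := not_le_castLE k
      simp only [not_le, Fin.val_castLE] at this
      simp only [Pi.pow_apply, d, Fin.val_castLE, if_pos this, l]
    · intro k hk
      simp [d, not_lt.mpr hk]
  rw [disc]
  simp_rw [htr]
  rw [det_sum_pow]
  refine mul_ne_zero (pow_ne_zero _ (det_vandermonde_ne_zero_iff.mpr ?_))
    (Finset.prod_ne_zero_iff.mpr fun i _ => ?_)
  · intro i j hij
    simp only [l] at hij
    have := (pow_left_inj₀ (by positivity) (by positivity) two_ne_zero).mp hij
    have : (i : ℝ) = j := by linarith
    exact Fin.ext (by exact_mod_cast this)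
  · simp only [l]
    positivity

/-- On every line through a point c where the polynomial is nonzero, it restricts to an analytic
function that is not identically zero, whose zeros form a null set. -/
theorem ae_disc_ne_zero : ∀ᵐ u : Fin m → Fin p → ℝ, disc u ≠ 0 := by
  obtain ⟨c, hc⟩ := exists_disc_ne_zero p m
  refine measure_eq_zero_of_rays volume (N := {u | ¬ disc u ≠ 0}) ?_ c fun w => ?_
  · exact isOpen_disc_ne.measurableSet.compl
  · have ha : AnalyticOnNhd ℝ (fun t : ℝ => disc (c + t • w)) Set.univ := by
      have : ContDiff ℝ (⊤ : WithTop ℕ∞) fun t : ℝ => disc (c + t • w) :=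
        contDiff_disc.comp (contDiff_const.add (contDiff_id.smul contDiff_const))
      exact ContDiff.analyticOnNhd this
    have h0 := ha.preimage_zero_mem_codiscrete (x := 0) (by simpa using hc)
    have h1 := ae_restrict_le_codiscreteWithin (μ := volume) MeasurableSet.univ h0
    rw [Measure.restrict_univ] at h1
    refine ae_restrict_of_ae ?_
    filter_upwards [h1] with t ht
    simpa using ht

/-- The divergence of a differentiable compactly supported vector field has integral zero as soon
as it is integrable. -/
theorem integral_divergence_eq_zero {n : ℕ} (V : Fin n → (Fin n → ℝ) → ℝ)
    (hV : ∀ i, Differentiable ℝ (V i)) (R : ℝ) (hR : ∀ x, R ≤ ‖x‖ → ∀ i, V i x = 0)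
    (hint : Integrable fun x => ∑ i, fderiv ℝ (V i) x (Pi.single i 1)) :
    ∫ x, ∑ i, fderiv ℝ (V i) x (Pi.single i 1) = 0 := by
  cases n with
  | zero => simp
  | succ n =>
    -- Every face of this cube lies at norm at least R, where the field vanishes.
    set b : Fin (n + 1) → ℝ := fun _ => |R| + 1 with hb
    set a : Fin (n + 1) → ℝ := fun _ => -(|R| + 1) with ha
    have hpos : 0 < |R| + 1 := by positivity
    have hout : ∀ x : Fin (n + 1) → ℝ, x ∉ Set.Icc a b →
        ∑ i, fderiv ℝ (V i) x (Pi.single i 1) = 0 := by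
      intro x hx
      have hxR : R < ‖x‖ := by
        by_contra hle
        apply hx
        have h1 : ∀ i, |x i| ≤ |R| + 1 := fun i =>
          (norm_le_pi_norm x i).trans (by linarith [le_abs_self R])
        exact ⟨fun i => (abs_le.mp (h1 i)).1, fun i => (abs_le.mp (h1 i)).2⟩
      refine Finset.sum_eq_zero fun i _ => ?_
      have : V i =ᶠ[nhds x] fun _ => 0 := by
        filter_upwards [(isOpen_lt continuous_const continuous_norm).mem_nhds hxR] with y hy
        exact hR y (le_of_lt hy) i
      rw [this.fderiv_eq]
      simp
    have hface : ∀ (i : Fin (n + 1)) (c : ℝ) (y : Fin n → ℝ), |c| = |R| + 1 →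
        V i (i.insertNth c y) = 0 := by
      intro i c y hc
      refine hR _ ?_ i
      have := norm_le_pi_norm (i.insertNth c y : Fin (n + 1) → ℝ) i
      rw [Fin.insertNth_apply_same, Real.norm_eq_abs, hc] at this
      linarith [le_abs_self R]
    rw [← setIntegral_eq_integral_of_forall_compl_eq_zero hout]
    -- This version requires pointwise differentiability and an integrable divergence, not
    -- continuous derivatives; the φ_i are only assumed differentiable.
    rw [integral_divergence_of_hasFDerivAt_off_countable' a b
      (fun i => by simp only [ha, hb]; linarith) V (fun i x => fderiv ℝ (V i) x) ∅
      Set.countable_empty (fun i => (hV i).continuous.continuousOn)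
      (fun x _ i => (hV i x).hasFDerivAt) hint.integrableOn]
    refine Finset.sum_eq_zero fun i _ => ?_
    have e1 : ∀ y : Fin n → ℝ, V i (i.insertNth (b i) y) = 0 :=
      fun y => hface i _ y (abs_of_pos hpos)
    have e2 : ∀ y : Fin n → ℝ, V i (i.insertNth (a i) y) = 0 :=
      fun y => hface i _ y (by simp only [ha, abs_neg, abs_of_pos hpos])
    simp_rw [e1, e2]
    simp

/-- Flattening to coordinates transports volume to a Haar measure, hence to a multiple of volume,
and the factor is irrelevant for a vanishing integral. -/
theorem integral_divergence_matrix_eq_zero (V : Fin m → Fin p → (Fin m → Fin p → ℝ) → ℝ)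
    (hV : ∀ a b, Differentiable ℝ (V a b)) (R : ℝ) (hR : ∀ x, R ≤ ‖x‖ → ∀ a b, V a b x = 0)
    (hint : Integrable fun x => ∑ a, ∑ b, fderiv ℝ (V a b) x (Pi.single a (Pi.single b 1))) :
    ∫ x, ∑ a, ∑ b, fderiv ℝ (V a b) x (Pi.single a (Pi.single b 1)) = 0 := by
  let e : Fin (Fintype.card (Fin m × Fin p)) ≃ Fin m × Fin p := (Fintype.equivFin _).symm
  set n := Fintype.card (Fin m × Fin p)
  let L₀ : (Fin n → ℝ) ≃ₗ[ℝ] (Fin m → Fin p → ℝ) :=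
    (LinearEquiv.funCongrLeft ℝ ℝ e.symm).trans (LinearEquiv.curry ℝ ℝ (Fin m) (Fin p))
  let L : (Fin n → ℝ) ≃L[ℝ] (Fin m → Fin p → ℝ) := L₀.toContinuousLinearEquiv
  have hL : ∀ x a b, L x a b = x (e.symm (a, b)) := fun x a b => rfl
  have hLs : ∀ i, L (Pi.single i 1) = Pi.single (e i).1 (Pi.single (e i).2 1) := by
    intro i
    ext a b
    rw [hL, Pi.single_apply]
    by_cases h1 : a = (e i).1
    · subst h1
      rw [Pi.single_eq_same, Pi.single_apply]
      congr 1
      rw [eq_iff_iff, Equiv.symm_apply_eq]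
      constructor
      · intro h; rw [← h]
      · rintro rfl; rfl
    · rw [Pi.single_eq_of_ne h1, if_neg]
      · rfl
      · intro h
        rw [Equiv.symm_apply_eq] at h
        exact h1 (by rw [← h])
  have hnorm : ∀ x, ‖L x‖ = ‖x‖ := by
    intro x
    refine le_antisymm ?_ ?_
    · refine (pi_norm_le_iff_of_nonneg (norm_nonneg _)).mpr fun a =>
        (pi_norm_le_iff_of_nonneg (norm_nonneg _)).mpr fun b => ?_
      rw [hL]
      exact norm_le_pi_norm _ _
    · refine (pi_norm_le_iff_of_nonneg (norm_nonneg _)).mpr fun i => ?_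
      have : x i = L x (e i).1 (e i).2 := by rw [hL]; simp
      rw [this]
      exact (norm_le_pi_norm _ _).trans (norm_le_pi_norm _ _)
  set g : (Fin m → Fin p → ℝ) → ℝ := fun x =>
    ∑ a, ∑ b, fderiv ℝ (V a b) x (Pi.single a (Pi.single b 1))
  have hg : ∀ x, g (L x)
      = ∑ i, fderiv ℝ (fun y => V (e i).1 (e i).2 (L y)) x (Pi.single i 1) := by
    intro x
    have h1 : ∀ i, fderiv ℝ (fun y => V (e i).1 (e i).2 (L y)) x (Pi.single i 1)
        = fderiv ℝ (V (e i).1 (e i).2) (L x) (Pi.single (e i).1 (Pi.single (e i).2 1)) := by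
      intro i
      have := ((hV (e i).1 (e i).2 (L x)).hasFDerivAt.comp x L.hasFDerivAt).fderiv
      rw [← hLs, show (fun y => V (e i).1 (e i).2 (L y)) = V (e i).1 (e i).2 ∘ L from rfl, this]
      rfl
    simp_rw [h1]
    rw [Equiv.sum_comp e fun ab : Fin m × Fin p =>
      fderiv ℝ (V ab.1 ab.2) (L x) (Pi.single ab.1 (Pi.single ab.2 1)), Fintype.sum_prod_type]
  have : (Measure.map L.symm (volume : Measure (Fin m → Fin p → ℝ))).IsAddHaarMeasure :=
    L.symm.isAddHaarMeasure_map volume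
  have hmap : Measure.map L.symm (volume : Measure (Fin m → Fin p → ℝ))
      = Measure.addHaarScalarFactor (Measure.map L.symm volume) volume • volume :=
    Measure.isAddLeftInvariant_eq_smul _ _
  set c := Measure.addHaarScalarFactor (Measure.map L.symm volume)
    (volume : Measure (Fin n → ℝ))
  have hc : c ≠ 0 := by
    intro h
    rw [h, zero_smul] at hmap
    exact NeZero.ne _ hmap
  have hemb : MeasurableEmbedding L.symm := L.symm.toHomeomorph.measurableEmbedding
  have hint2 : Integrable (fun x => g (L x)) := by
    have h1 : Integrable (fun x => g (L x))
        (Measure.map L.symm (volume : Measure (Fin m → Fin p → ℝ))) := by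
      rw [hemb.integrable_map_iff]
      refine hint.congr (Filter.Eventually.of_forall fun x => ?_)
      simp [g]
    rw [hmap] at h1
    exact (integrable_smul_measure (c := (c : ℝ≥0∞)) (by simpa using hc) (by simp)).mp h1
  have h2 : ∫ x, g x = ∫ x, g (L x) ∂(Measure.map L.symm volume) := by
    rw [hemb.integral_map]
    simp
  have h3 : ∫ x, g (L x) = 0 := by
    simp_rw [hg] at hint2 ⊢
    refine integral_divergence_eq_zero (fun i y => V (e i).1 (e i).2 (L y))
      (fun i => (hV _ _).comp L.differentiable) R (fun x hx i => hR _ ?_ _ _) hint2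
    rwa [hnorm]
  rw [h2, hmap, integral_smul_nnreal_measure, h3, smul_zero]

end EllipticalModel

/-! ### Cutting off near the discriminant locus and integrating by parts. -/

namespace EllipticalModel

/-- A smooth step, `0` on `(-∞, 1]` and `1` on `[2, ∞)`. -/
noncomputable def smoothStep (t : ℝ) : ℝ := Real.smoothTransition (t - 1)

theorem contDiff_smoothStep {n : ℕ∞} : ContDiff ℝ n smoothStep :=
  Real.smoothTransition.contDiff.comp (contDiff_id.sub contDiff_const)

theorem smoothStep_of_le {t : ℝ} (ht : t ≤ 1) : smoothStep t = 0 :=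
  Real.smoothTransition.zero_of_nonpos (by linarith)

theorem smoothStep_of_ge {t : ℝ} (ht : 2 ≤ t) : smoothStep t = 1 :=
  Real.smoothTransition.one_of_one_le (by linarith)

theorem abs_smoothStep_le (t : ℝ) : |smoothStep t| ≤ 1 := by
  rw [smoothStep, abs_of_nonneg (Real.smoothTransition.nonneg _)]
  exact Real.smoothTransition.le_one _

theorem deriv_smoothStep_of_lt {t : ℝ} (ht : t < 1) : deriv smoothStep t = 0 := by
  have : smoothStep =ᶠ[nhds t] fun _ => 0 := by
    filter_upwards [Iio_mem_nhds ht] with s hs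
    exact smoothStep_of_le (le_of_lt hs)
  rw [this.deriv_eq, deriv_const]

theorem deriv_smoothStep_of_gt {t : ℝ} (ht : 2 < t) : deriv smoothStep t = 0 := by
  have : smoothStep =ᶠ[nhds t] fun _ => 1 := by
    filter_upwards [Ioi_mem_nhds ht] with s hs
    exact smoothStep_of_ge (le_of_lt hs)
  rw [this.deriv_eq, deriv_const]

theorem continuous_deriv_smoothStep : Continuous (deriv smoothStep) :=
  (contDiff_smoothStep (n := 1)).continuous_deriv le_rfl

/-- The derivative lives on [1, 2], so t χ'(t) is bounded. Applied at t = n · disc, this makes the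
cutoff error bounded uniformly in n. -/
theorem exists_bound_mul_deriv_smoothStep : ∃ C, ∀ t, |t * deriv smoothStep t| ≤ C := by
  have hc : Continuous fun t => t * deriv smoothStep t :=
    continuous_id.mul continuous_deriv_smoothStep
  obtain ⟨C, hC⟩ := (isCompact_Icc (a := (1 : ℝ)) (b := 2)).exists_bound_of_continuousOn
    hc.continuousOn
  refine ⟨max C 0, fun t => ?_⟩
  by_cases ht : t ∈ Set.Icc (1 : ℝ) 2
  · exact (hC t ht).trans (le_max_left _ _)
  · have : deriv smoothStep t = 0 := by
      rw [Set.mem_Icc, not_and_or, not_le, not_le] at ht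
      exact ht.elim deriv_smoothStep_of_lt deriv_smoothStep_of_gt
    rw [this]
    simp

variable {p m : ℕ}

theorem sum_clm_single_mul (T : (Fin m → Fin p → ℝ) →L[ℝ] ℝ) (V : Fin m → Fin p → ℝ) :
    ∑ a, ∑ b, T (Pi.single a (Pi.single b 1)) * V a b = T V := by
  have : V = ∑ a, ∑ b, V a b • (Pi.single a (Pi.single b 1) : Fin m → Fin p → ℝ) := by
    ext a b
    simp only [Finset.sum_apply, Pi.smul_apply, smul_eq_mul]
    rw [Finset.sum_eq_single a, Finset.sum_eq_single b]
    · simp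
    · intro c _ hc; simp [Pi.single_eq_of_ne hc.symm]
    · simp
    · intro c _ hc; simp [Pi.single_eq_of_ne hc.symm]
    · simp
  conv_rhs => rw [this]
  simp only [map_sum, map_smul, smul_eq_mul]
  exact Finset.sum_congr rfl fun a _ => Finset.sum_congr rfl fun b _ => mul_comm _ _

/-- Integration by parts for the field `u H Φ(L) Hᵀ` against a compactly supported weight. -/
theorem integral_mul_steinHaff {φ : Fin (min p m) → (Fin (min p m) → ℝ) → ℝ}
    (hφ : ∀ i, DifferentiableOn ℝ (φ i) (chamber (min p m)))
    {w : (Fin m → Fin p → ℝ) → ℝ} (hw : Differentiable ℝ w) {R : ℝ}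
    (hR : ∀ u, R ≤ ‖u‖ → w u = 0)
    (h1 : Integrable fun u => w u * steinHaff p m φ (eig u))
    (h2 : Integrable fun u => fderiv ℝ w u (fun a b => field φ u a b))
    (h3 : Integrable fun u => w u * discRate φ (eig u)) :
    ∫ u, w u * steinHaff p m φ (eig u) = - ∫ u, fderiv ℝ w u (fun a b => field φ u a b) := by
  set κ : ℕ → (Fin m → Fin p → ℝ) → ℝ := fun n u => smoothStep (n * disc u) with hκ
  -- The derivative of `κ n` along the field is `κ' n` times `discRate`.
  set κ' : ℕ → (Fin m → Fin p → ℝ) → ℝ := fun n u =>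
    (n * disc u) * deriv smoothStep (n * disc u) with hκ'
  set F : ℕ → (Fin m → Fin p → ℝ) → ℝ := fun n u =>
    κ n u * (w u * steinHaff p m φ (eig u) + fderiv ℝ w u (fun a b => field φ u a b))
      + κ' n u * (w u * discRate φ (eig u)) with hF
  set V : ℕ → Fin m → Fin p → (Fin m → Fin p → ℝ) → ℝ := fun n a b u =>
    κ n u * w u * field φ u a b with hV
  have hκd : ∀ n, Differentiable ℝ (κ n) := fun n =>
    ((contDiff_smoothStep (n := 1)).differentiable one_ne_zero).comp
      (((contDiff_disc (n := 1)).differentiable one_ne_zero).const_mul _)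
  -- The cut-off field vanishes identically near the singular set, so it is differentiable
  -- everywhere whatever values the φ_i take there.
  have hzero : ∀ n u, disc u = 0 → ∀ a b, V n a b =ᶠ[nhds u] fun _ => 0 := by
    intro n u hu a b
    have hc : Continuous fun v : Fin m → Fin p → ℝ => (n : ℝ) * disc v :=
      continuous_const.mul continuous_disc
    filter_upwards [(isOpen_lt hc continuous_const).mem_nhds
      (show (n : ℝ) * disc u < 1 by rw [hu]; simp)] with v hv
    simp only [hV, hκ]
    rw [smoothStep_of_le (le_of_lt hv)]
    ring
  have hVd : ∀ n a b, Differentiable ℝ (V n a b) := by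
    intro n a b u
    by_cases hu : disc u = 0
    · exact (differentiableAt_const 0).congr_of_eventuallyEq (hzero n u hu a b)
    · exact ((hκd n u).mul (hw u)).mul (matDiffAt_field hu hφ a b)
  have hdiv : ∀ n u, disc u ≠ 0 →
      ∑ a, ∑ b, fderiv ℝ (V n a b) u (Pi.single a (Pi.single b 1)) = F n u := by
    intro n u hu
    have e1 : ∀ a b, fderiv ℝ (V n a b) u (Pi.single a (Pi.single b 1))
        = fderiv ℝ (fun v => κ n v * w v) u (Pi.single a (Pi.single b 1)) * field φ u a b
          + κ n u * w u * fderiv ℝ (fun v => field φ v a b) u (Pi.single a (Pi.single b 1)) := by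
      intro a b
      simp only [hV]
      rw [fderiv_fun_mul ((hκd n u).fun_mul (hw u)) (matDiffAt_field hu hφ a b)]
      simp only [_root_.add_apply, _root_.smul_apply, smul_eq_mul]
      ring
    simp_rw [e1, Finset.sum_add_distrib, ← Finset.mul_sum]
    rw [divergence_field hu hφ,
      sum_clm_single_mul (fderiv ℝ (fun v => κ n v * w v) u) fun a b => field φ u a b,
      fderiv_fun_mul (hκd n u) (hw u)]
    simp only [_root_.add_apply, _root_.smul_apply, smul_eq_mul]
    have e2 : fderiv ℝ (κ n) u (fun a b => field φ u a b) = κ' n u * discRate φ (eig u) := by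
      have hs : DifferentiableAt ℝ smoothStep (n * disc u) :=
        (contDiff_smoothStep (n := 1)).differentiable one_ne_zero _
      have hd : DifferentiableAt ℝ disc u := (contDiff_disc (n := 1)).differentiable one_ne_zero u
      have := (hs.hasDerivAt.comp_hasFDerivAt u (hd.hasFDerivAt.const_mul (n : ℝ))).fderiv
      rw [show κ n = smoothStep ∘ fun v => (n : ℝ) * disc v from rfl, this]
      simp only [_root_.smul_apply, smul_eq_mul]
      rw [fderiv_disc_field hu]
      simp only [hκ']
      ring
    rw [e2]
    simp only [hF]
    ring
  have hdivae : ∀ n, (fun u => ∑ a, ∑ b, fderiv ℝ (V n a b) u (Pi.single a (Pi.single b 1)))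
      =ᵐ[volume] F n := by
    intro n
    filter_upwards [ae_disc_ne_zero] with u hu using hdiv n u hu
  obtain ⟨C, hC⟩ := exists_bound_mul_deriv_smoothStep
  have hκm : ∀ n, AEStronglyMeasurable (κ n) volume := fun n =>
    (hκd n).continuous.aestronglyMeasurable
  have hκm' : ∀ n, AEStronglyMeasurable (κ' n) volume := fun n =>
    Continuous.aestronglyMeasurable ((continuous_const.mul continuous_disc).mul
      (continuous_deriv_smoothStep.comp (continuous_const.mul continuous_disc)))
  have hFint : ∀ n, Integrable (F n) := fun n =>
    ((h1.add h2).bdd_mul (hκm n)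
      (Filter.Eventually.of_forall fun u => abs_smoothStep_le _)).add
    (h3.bdd_mul (hκm' n) (Filter.Eventually.of_forall fun u => hC _))
  have hF0 : ∀ n, ∫ u, F n u = 0 := by
    intro n
    rw [← integral_congr_ae (hdivae n)]
    refine integral_divergence_matrix_eq_zero (V n) (hVd n) R (fun u hu a b => ?_)
      ((hFint n).congr (hdivae n).symm)
    simp only [hV]
    rw [hR u hu]
    ring
  -- Where disc u > 0, once n · disc u > 2 the step equals 1 and its derivative 0, so the integrand
  -- is eventually equal to its limit.
  have hlim := tendsto_integral_of_dominated_convergence (F := F) (μ := volume)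
    (f := fun u => w u * steinHaff p m φ (eig u) + fderiv ℝ w u (fun a b => field φ u a b))
    (fun u => ‖w u * steinHaff p m φ (eig u) + fderiv ℝ w u (fun a b => field φ u a b)‖
      + C * ‖w u * discRate φ (eig u)‖)
    (fun n => (hFint n).aestronglyMeasurable)
    ((h1.add h2).norm.add (h3.norm.const_mul C))
    (fun n => Filter.Eventually.of_forall fun u => by
      refine (norm_add_le _ _).trans (add_le_add ?_ ?_)
      · rw [norm_mul]
        exact mul_le_of_le_one_left (norm_nonneg _) (abs_smoothStep_le _)
      · rw [norm_mul]
        exact mul_le_mul_of_nonneg_right (hC _) (norm_nonneg _))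
    (by
      filter_upwards [ae_disc_ne_zero] with u hu
      have hpos : 0 < disc u := lt_of_le_of_ne (disc_nonneg u) hu.symm
      refine tendsto_const_nhds.congr' ?_
      have : Filter.Tendsto (fun n : ℕ => (n : ℝ) * disc u) Filter.atTop Filter.atTop :=
        tendsto_natCast_atTop_atTop.atTop_mul_const hpos
      filter_upwards [this.eventually_gt_atTop 2] with n hn
      simp only [hF, hκ, hκ']
      rw [smoothStep_of_ge (le_of_lt hn), deriv_smoothStep_of_gt hn]
      ring)
  simp_rw [hF0] at hlim
  have h4 := tendsto_nhds_unique hlim tendsto_const_nhds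
  rw [integral_add h1 h2] at h4
  linarith

end EllipticalModel

/-! ### The quadratic form and its derivative along the field. -/

namespace EllipticalModel

variable {p m : ℕ}

/-- `tr u Σ⁻¹ uᵀ`. -/
noncomputable def rowForm (Sig : Matrix (Fin p) (Fin p) ℝ) (u : Fin m → Fin p → ℝ) : ℝ :=
  (Matrix.of u * Sig⁻¹ * (Matrix.of u)ᵀ).trace

theorem rowForm_eq_trace (Sig : Matrix (Fin p) (Fin p) ℝ) (u : Fin m → Fin p → ℝ) :
    rowForm Sig u = (Sig⁻¹ * scatter u).trace := by
  rw [rowForm, Matrix.mul_assoc, Matrix.trace_mul_comm, scatter, Matrix.mul_assoc]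

theorem rowForm_eq_sum (Sig : Matrix (Fin p) (Fin p) ℝ) (u : Fin m → Fin p → ℝ) :
    rowForm Sig u = ∑ a, star (u a) ⬝ᵥ (Sig⁻¹ *ᵥ u a) := by
  simp only [rowForm, Matrix.trace, Matrix.diag, Matrix.mul_apply, Matrix.transpose_apply,
    Matrix.of_apply, dotProduct, Matrix.mulVec, Finset.sum_mul, Finset.mul_sum, star_trivial]
  refine Finset.sum_congr rfl fun a _ => ?_
  rw [Finset.sum_comm]
  exact Finset.sum_congr rfl fun b _ => Finset.sum_congr rfl fun c _ => by ring

theorem rowForm_nonneg {Sig : Matrix (Fin p) (Fin p) ℝ} (hSig : Sig.PosDef)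
    (u : Fin m → Fin p → ℝ) : 0 ≤ rowForm Sig u := by
  rw [rowForm_eq_sum]
  exact Finset.sum_nonneg fun a _ => hSig.inv.posSemidef.dotProduct_mulVec_nonneg _

theorem rowForm_pos {Sig : Matrix (Fin p) (Fin p) ℝ} (hSig : Sig.PosDef)
    {u : Fin m → Fin p → ℝ} (hu : u ≠ 0) : 0 < rowForm Sig u := by
  rw [rowForm_eq_sum]
  obtain ⟨a, ha⟩ := Function.ne_iff.mp hu
  exact Finset.sum_pos' (fun a _ => hSig.inv.posSemidef.dotProduct_mulVec_nonneg _)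
    ⟨a, Finset.mem_univ a, hSig.inv.dotProduct_mulVec_pos ha⟩

theorem rowForm_smul (Sig : Matrix (Fin p) (Fin p) ℝ) (s : ℝ) (u : Fin m → Fin p → ℝ) :
    rowForm Sig (s • u) = s ^ 2 * rowForm Sig u := by
  simp only [rowForm_eq_sum, Pi.smul_apply, Matrix.mulVec_smul, smul_dotProduct,
    dotProduct_smul, smul_eq_mul, star_trivial, Finset.mul_sum]
  exact Finset.sum_congr rfl fun a _ => by ring

theorem contDiff_rowForm (Sig : Matrix (Fin p) (Fin p) ℝ) {n : WithTop ℕ∞} :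
    ContDiff ℝ n (rowForm Sig : (Fin m → Fin p → ℝ) → ℝ) := by
  have : (rowForm Sig : (Fin m → Fin p → ℝ) → ℝ) = fun u =>
      ∑ b, ∑ c, Sig⁻¹ b c * scatter u c b := by
    ext u
    rw [rowForm_eq_trace]
    simp [Matrix.trace, Matrix.mul_apply]
  rw [this]
  exact ContDiff.sum fun b _ => ContDiff.sum fun c _ =>
    contDiff_const.mul (contDiff_scatter c b)

theorem continuous_rowForm (Sig : Matrix (Fin p) (Fin p) ℝ) :
    Continuous (rowForm Sig : (Fin m → Fin p → ℝ) → ℝ) :=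
  (contDiff_rowForm Sig (n := 0)).continuous

/-- By homogeneity and a positive minimum on the unit sphere, q grows at least quadratically.
Weights in q supported below a level are thus compactly supported in u. -/
theorem exists_le_rowForm {Sig : Matrix (Fin p) (Fin p) ℝ} (hSig : Sig.PosDef) (t : ℝ) :
    ∃ R : ℝ, ∀ u : Fin m → Fin p → ℝ, R ≤ ‖u‖ → t ≤ rowForm Sig u := by
  by_cases hne : (Metric.sphere (0 : Fin m → Fin p → ℝ) 1).Nonempty
  · obtain ⟨v, hv, hmin⟩ := (isCompact_sphere (0 : Fin m → Fin p → ℝ) 1).exists_isMinOn hne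
      (continuous_rowForm Sig).continuousOn
    have hv1 : ‖v‖ = 1 := by simpa using hv
    have hpos : 0 < rowForm Sig v := rowForm_pos hSig (by
      rintro rfl
      simp at hv1)
    refine ⟨max 1 (t / rowForm Sig v), fun u hu => ?_⟩
    have h1 : 1 ≤ ‖u‖ := (le_max_left _ _).trans hu
    have h2 : t / rowForm Sig v ≤ ‖u‖ := (le_max_right _ _).trans hu
    have h3 : rowForm Sig v ≤ rowForm Sig (‖u‖⁻¹ • u) := hmin (by
      simp [norm_smul]
      field_simp)
    rw [rowForm_smul] at h3
    have h4 : ‖u‖ ^ 2 * rowForm Sig v ≤ rowForm Sig u := by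
      have := mul_le_mul_of_nonneg_left h3 (sq_nonneg ‖u‖)
      rwa [← mul_assoc, ← mul_pow, mul_inv_cancel₀ (by positivity), one_pow, one_mul] at this
    rw [div_le_iff₀ hpos] at h2
    refine h2.trans (le_trans ?_ h4)
    exact mul_le_mul_of_nonneg_right (le_self_pow₀ h1 two_ne_zero) hpos.le
  · refine ⟨1, fun u hu => ?_⟩
    exfalso
    apply hne
    refine ⟨‖u‖⁻¹ • u, ?_⟩
    have : ‖u‖ ≠ 0 := by positivity
    simp [norm_smul, this]

theorem transpose_spectralFun (d : Fin (min p m) → ℝ) (u : Fin m → Fin p → ℝ) :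
    (spectralFun d u)ᵀ = spectralFun d u := by
  have h : (scatter u)ᵀ = scatter u := by
    simp [scatter, Matrix.transpose_mul]
  simp only [spectralFun, Matrix.transpose_sum, Matrix.transpose_smul, Matrix.transpose_pow, h]

/-- `tr (Σ⁻¹ H L Φ(L) Hᵀ)`, without reference to a choice of eigenvectors. -/
noncomputable def scoreTerm (Sig : Matrix (Fin p) (Fin p) ℝ)
    (φ : Fin (min p m) → (Fin (min p m) → ℝ) → ℝ) (u : Fin m → Fin p → ℝ) : ℝ :=
  (Sig⁻¹ * (scatter u * spectralFun (fun k => φ k (eig u)) u)).trace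

theorem IsEigenvectorMatrix.traceTerm_eq {Sig : Matrix (Fin p) (Fin p) ℝ}
    {φ : Fin (min p m) → (Fin (min p m) → ℝ) → ℝ} {u : Fin m → Fin p → ℝ}
    {H : Matrix (Fin p) (Fin (min p m)) ℝ} (h : IsEigenvectorMatrix u H) (hu : disc u ≠ 0) :
    traceTerm Sig H (eig u) φ = scoreTerm Sig φ u := by
  rw [traceTerm, scoreTerm, h.scatter_mul_spectralFun hu]

/-- Along uB the derivative of S is B S + S B, and both products have the same trace against the
symmetric matrix Σ⁻¹. -/
theorem fderiv_rowForm_field {Sig : Matrix (Fin p) (Fin p) ℝ} (hSig : Sig.PosDef)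
    (φ : Fin (min p m) → (Fin (min p m) → ℝ) → ℝ) (u : Fin m → Fin p → ℝ) :
    fderiv ℝ (rowForm Sig) u (fun a b => field φ u a b) = 2 * scoreTerm Sig φ u := by
  set W : Fin m → Fin p → ℝ := fun a b => field φ u a b
  have e0 : (rowForm Sig : (Fin m → Fin p → ℝ) → ℝ) = fun u =>
      ∑ b, ∑ c, Sig⁻¹ b c * scatter u c b := by
    ext u
    rw [rowForm_eq_trace]
    simp [Matrix.trace, Matrix.mul_apply]
  have hS := matDiffAt_scatter u
  have e1 : fderiv ℝ (rowForm Sig) u W = (Sig⁻¹ * matD scatter u W).trace := by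
    rw [e0, fderiv_fun_sum (A := fun b v => ∑ c, Sig⁻¹ b c * scatter v c b)
      (fun b _ => DifferentiableAt.fun_sum fun c _ => (hS c b).const_mul _)]
    rw [_root_.sum_apply]
    simp only [Matrix.trace, Matrix.diag, Matrix.mul_apply]
    refine Finset.sum_congr rfl fun b _ => ?_
    rw [fderiv_fun_sum (A := fun c v => Sig⁻¹ b c * scatter v c b)
      (fun c _ => (hS c b).const_mul _), _root_.sum_apply]
    refine Finset.sum_congr rfl fun c _ => ?_
    rw [fderiv_const_mul (hS c b)]
    rfl
  set B := spectralFun (fun k => φ k (eig u)) u with hB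
  have e2 : matD scatter u W = B * scatter u + scatter u * B := by
    rw [matD_scatter, show Matrix.of W = Matrix.of u * B from rfl, Matrix.transpose_mul,
      transpose_spectralFun, scatter, Matrix.mul_assoc, Matrix.mul_assoc]
  have hSt : (scatter u)ᵀ = scatter u := by
    simp [scatter, Matrix.transpose_mul]
  have hSigt : (Sig⁻¹)ᵀ = Sig⁻¹ := by
    have := hSig.inv.isHermitian
    rwa [Matrix.IsHermitian, Matrix.conjTranspose_eq_transpose_of_trivial] at this
  have e3 : (Sig⁻¹ * (B * scatter u)).trace = (Sig⁻¹ * (scatter u * B)).trace := by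
    rw [← Matrix.trace_transpose, Matrix.transpose_mul, Matrix.transpose_mul, hSt, hSigt,
      hB, transpose_spectralFun, Matrix.trace_mul_comm]
  rw [e1, e2, Matrix.mul_add, Matrix.trace_add, e3, scoreTerm]
  ring

/-- In an eigenbasis of S the two sides are ∑ G_kk e_k β_k and ∑ G_kk e_k with all G_kk e_k ≥ 0.
This supplies integrability below a level, which the hypothesis under E cannot give where f
vanishes. -/
theorem abs_scoreTerm_le {Sig : Matrix (Fin p) (Fin p) ℝ} (hSig : Sig.PosDef)
    (φ : Fin (min p m) → (Fin (min p m) → ℝ) → ℝ) {u : Fin m → Fin p → ℝ} (hu : disc u ≠ 0) :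
    |scoreTerm Sig φ u| ≤ rowForm Sig u * ∑ i, |φ i (eig u)| := by
  obtain ⟨O, e, h⟩ := exists_spectralData u
  set β : Fin p → ℝ := extend fun k => φ k (eig u) with hβ
  set G := Oᵀ * Sig⁻¹ * O with hG
  have hGnn : ∀ k, 0 ≤ G k k := by
    have := hSig.inv.posSemidef.conjTranspose_mul_mul_same O
    rw [Matrix.conjTranspose_eq_transpose_of_trivial] at this
    exact fun k => this.diag_nonneg
  have htr : ∀ f : Fin p → ℝ, (Sig⁻¹ * (O * diagonal f * Oᵀ)).trace = ∑ k, G k k * f k := by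
    intro f
    rw [← Matrix.mul_assoc, Matrix.trace_mul_comm, ← Matrix.mul_assoc, ← Matrix.mul_assoc]
    simp only [Matrix.trace, Matrix.diag, Matrix.mul_diagonal, hG]
  have e1 : scoreTerm Sig φ u = ∑ k, G k k * (e k * β k) := by
    rw [scoreTerm, h.spectralFun_eq hu, h.scatter_eq, h.conj_mul, htr]
  have e2 : rowForm Sig u = ∑ k, G k k * e k := by
    rw [rowForm_eq_trace, h.scatter_eq, htr]
  rw [e1, e2, Finset.sum_mul]
  refine (Finset.abs_sum_le_sum_abs _ _).trans (Finset.sum_le_sum fun k _ => ?_)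
  rw [← mul_assoc, abs_mul, abs_of_nonneg (mul_nonneg (hGnn k) (h.nonneg k))]
  refine mul_le_mul_of_nonneg_left ?_ (mul_nonneg (hGnn k) (h.nonneg k))
  refine forall_fin_min (m := m) (P := fun k => |β k| ≤ ∑ i, |φ i (eig u)|)
    (fun i => ?_) (fun k hk => ?_) k
  · rw [hβ, extend_castLE]
    exact Finset.single_le_sum (f := fun i => |φ i (eig u)|) (fun _ _ => abs_nonneg _)
      (Finset.mem_univ i)
  · rw [hβ, extend_of_le _ hk, abs_zero]
    exact Finset.sum_nonneg fun _ _ => abs_nonneg _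

theorem differentiableAt_scoreTerm (Sig : Matrix (Fin p) (Fin p) ℝ)
    {φ : Fin (min p m) → (Fin (min p m) → ℝ) → ℝ}
    (hφ : ∀ i, DifferentiableOn ℝ (φ i) (chamber (min p m))) {u : Fin m → Fin p → ℝ}
    (hu : disc u ≠ 0) : DifferentiableAt ℝ (scoreTerm Sig φ) u := by
  have h1 : MatDiffAt (fun v => scatter v * spectralFun (fun k => φ k (eig v)) v) u :=
    (matDiffAt_scatter u).mul (matDiffAt_spectralFun hu fun k => differentiableAt_comp_eig hu (hφ k))
  have : scoreTerm Sig φ = fun v => ∑ b, ∑ c,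
      Sig⁻¹ b c * (scatter v * spectralFun (fun k => φ k (eig v)) v) c b := by
    ext v
    simp only [scoreTerm, Matrix.trace, Matrix.diag]
    simp_rw [Matrix.mul_apply (M := Sig⁻¹)]
  rw [this]
  exact DifferentiableAt.fun_sum fun b _ => DifferentiableAt.fun_sum fun c _ =>
    (h1 c b).const_mul _

/-- A function which is continuous where `disc` does not vanish is almost everywhere measurable. -/
theorem aestronglyMeasurable_of_continuousAt {h : (Fin m → Fin p → ℝ) → ℝ}
    (hc : ∀ u, disc u ≠ 0 → ContinuousAt h u) : AEStronglyMeasurable h volume := by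
  have h1 : ContinuousOn h {u | disc u ≠ 0} := fun u hu => (hc u hu).continuousWithinAt
  have h2 := h1.aestronglyMeasurable (μ := volume) isOpen_disc_ne.measurableSet
  have h3 : volume.restrict {u : Fin m → Fin p → ℝ | disc u ≠ 0} = volume :=
    Measure.restrict_eq_self_of_ae_mem ae_disc_ne_zero
  rwa [h3] at h2

/-- The preimage of a null set under the quadratic form is null. -/
theorem ae_rowForm_of_ae {Sig : Matrix (Fin p) (Fin p) ℝ} (hSig : Sig.PosDef) (hp : 0 < p)
    (hm : 0 < m) {P : ℝ → Prop} (hP : ∀ᵐ s, P s) :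
    ∀ᵐ u : Fin m → Fin p → ℝ, P (rowForm Sig u) := by
  obtain ⟨N, hN, hNm, hN0⟩ := exists_measurable_superset_of_null (ae_iff.mp hP)
  have hmeas : Measurable (rowForm Sig : (Fin m → Fin p → ℝ) → ℝ) :=
    (continuous_rowForm Sig).measurable
  have h1 : volume {u : Fin m → Fin p → ℝ | rowForm Sig u ∈ N ∩ Set.Ioi 0} = 0 := by
    refine measure_eq_zero_of_rays volume (hmeas (hNm.inter measurableSet_Ioi)) 0 fun w => ?_
    simp only [zero_add, Set.mem_ofPred_eq, rowForm_smul]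
    by_cases hw : rowForm Sig w = 0
    · refine Filter.Eventually.of_forall fun t ht => ?_
      rw [hw, mul_zero] at ht
      exact lt_irrefl (0 : ℝ) ht.2
    · have hw0 : 0 < rowForm Sig w := lt_of_le_of_ne (rowForm_nonneg hSig w) (Ne.symm hw)
      -- On a ray q equals t² q(w), so the bad parameters t lie in the image of a null set of levels
      -- s > 0 under √(s / q(w)), which is differentiable there.
      have himg : volume ((fun s => √(s / rowForm Sig w)) '' (N ∩ Set.Ioi 0)) = 0 := by
        refine addHaar_image_eq_zero_of_differentiableOn_of_addHaar_eq_zero volume (fun s hs => ?_)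
          (measure_mono_null Set.inter_subset_left hN0)
        have : s / rowForm Sig w ≠ 0 := (div_pos hs.2 hw0).ne'
        exact ((differentiableAt_id.div_const _).sqrt this).differentiableWithinAt
      rw [ae_restrict_iff' measurableSet_Icc, ae_iff]
      refine measure_mono_null (fun t ht => ?_) himg
      simp only [Set.mem_ofPred_eq, Classical.not_imp, not_not] at ht
      refine ⟨t ^ 2 * rowForm Sig w, ht.2, ?_⟩
      simp only
      rw [mul_div_cancel_right₀ _ hw, Real.sqrt_sq (by linarith [ht.1.1])]
  -- The level 0 was excluded above. It is attained only at u = 0, a null set because p, m > 0.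
  have hne : ∀ᵐ u : Fin m → Fin p → ℝ, u ≠ 0 := by
    have : Nonempty (Fin p) := ⟨⟨0, hp⟩⟩
    have : Nonempty (Fin m) := ⟨⟨0, hm⟩⟩
    exact Measure.ae_ne volume 0
  have h1' : ∀ᵐ u : Fin m → Fin p → ℝ, ¬ rowForm Sig u ∈ N ∩ Set.Ioi 0 := by
    rw [ae_iff]; simpa using h1
  filter_upwards [h1', hne] with u hu hu0
  by_contra hc
  exact hu ⟨hN hc, rowForm_pos hSig hu0⟩

end EllipticalModel

/-! ### From continuous test functions to measurable densities. -/

namespace EllipticalModel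

section Duality
variable {X : Type*} [MeasurableSpace X] {μ : Measure X} [SFinite μ] {q : X → ℝ}

/-- The measure on the line with `∫ h = ∫ h(q) (t - q)⁺ a + ∫ b ∫_{s > q} h(s) (t - s)⁺`. -/
noncomputable def levelMeasure (μ : Measure X) (q : X → ℝ) (t : ℝ) (a b : X → ℝ≥0∞) : Measure ℝ :=
  (μ.withDensity fun x => ENNReal.ofReal (t - q x) * a x).map q
    + volume.withDensity fun s => ENNReal.ofReal (t - s) * ∫⁻ x in {x | q x < s}, b x ∂μ

theorem lintegral_levelMeasure (hq : Measurable q) (t : ℝ) {a b : X → ℝ≥0∞}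
    (ha : AEMeasurable a μ) (hb : AEMeasurable b μ) {h : ℝ → ℝ≥0∞} (hh : Measurable h) :
    ∫⁻ s, h s ∂(levelMeasure μ q t a b)
      = ∫⁻ x, h (q x) * ENNReal.ofReal (t - q x) * a x ∂μ
        + ∫⁻ x, (∫⁻ s in Set.Ioi (q x), h s * ENNReal.ofReal (t - s)) * b x ∂μ := by
  have hk : Measurable fun s : ℝ => ENNReal.ofReal (t - s) := by fun_prop
  rw [levelMeasure, lintegral_add_measure]
  congr 1
  · rw [lintegral_map hh hq, lintegral_withDensity_eq_lintegral_mul₀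
      (f := fun x => ENNReal.ofReal (t - q x) * a x) (g := fun x => h (q x))
      ((hk.comp hq).aemeasurable.mul ha) (hh.comp hq).aemeasurable]
    refine lintegral_congr fun x => ?_
    simp only [Pi.mul_apply]
    ring
  · have hmono : Monotone fun s : ℝ => ∫⁻ x in {x | q x < s}, b x ∂μ := fun s s' hs =>
      lintegral_mono_set fun x hx => lt_of_lt_of_le hx hs
    rw [lintegral_withDensity_eq_lintegral_mul₀
      (f := fun s => ENNReal.ofReal (t - s) * ∫⁻ x in {x | q x < s}, b x ∂μ) (hk.mul hmono.measurable).aemeasurable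
      hh.aemeasurable]
    have hset : MeasurableSet {z : ℝ × X | q z.2 < z.1} :=
      measurableSet_lt (hq.comp measurable_snd) measurable_fst
    have e1 : ∀ s, ENNReal.ofReal (t - s) * (∫⁻ x in {x | q x < s}, b x ∂μ) * h s
        = ∫⁻ x, Set.indicator {z : ℝ × X | q z.2 < z.1}
          (fun z => h z.1 * ENNReal.ofReal (t - z.1) * b z.2) (s, x) ∂μ := by
      intro s
      rw [show ENNReal.ofReal (t - s) * (∫⁻ x in {x | q x < s}, b x ∂μ) * h s
        = (h s * ENNReal.ofReal (t - s)) * ∫⁻ x in {x | q x < s}, b x ∂μ by ring,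
        ← lintegral_const_mul'' _ hb.restrict, ← lintegral_indicator (s := {x | q x < s}) (hq measurableSet_Iio)]
      rfl
    have e2 : ∀ x, (∫⁻ s in Set.Ioi (q x), h s * ENNReal.ofReal (t - s)) * b x
        = ∫⁻ s, Set.indicator {z : ℝ × X | q z.2 < z.1}
          (fun z => h z.1 * ENNReal.ofReal (t - z.1) * b z.2) (s, x) := by
      intro x
      rw [← lintegral_mul_const (f := fun s => h s * ENNReal.ofReal (t - s)) _ (hh.mul hk),
        ← lintegral_indicator measurableSet_Ioi]
      rfl
    simp only [Pi.mul_apply]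
    simp_rw [e1, e2]
    refine lintegral_lintegral_swap ?_
    refine AEMeasurable.indicator ?_ hset
    exact ((hh.mul hk).comp measurable_fst).aemeasurable.mul hb.comp_snd

/-- If an identity between level integrals holds for continuous test functions, it holds for all
nonnegative measurable functions vanishing on `[t, ∞)`. -/
theorem lintegral_level_eq (hq : Measurable q) (t : ℝ) {a a' b b' : X → ℝ≥0∞}
    (ha : AEMeasurable a μ) (ha' : AEMeasurable a' μ) (hb : AEMeasurable b μ)
    (hb' : AEMeasurable b' μ)
    (hfin1 : ∫⁻ x, ENNReal.ofReal (t - q x) * a x ∂μ ≠ ∞)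
    (hfin2 : ∫⁻ x, (∫⁻ s in Set.Ioi (q x), ENNReal.ofReal (t - s)) * b x ∂μ ≠ ∞)
    (hη : ∀ η : BoundedContinuousFunction ℝ NNReal,
      ∫⁻ x, η (q x) * ENNReal.ofReal (t - q x) * a x ∂μ
        + ∫⁻ x, (∫⁻ s in Set.Ioi (q x), η s * ENNReal.ofReal (t - s)) * b x ∂μ
      = ∫⁻ x, η (q x) * ENNReal.ofReal (t - q x) * a' x ∂μ
        + ∫⁻ x, (∫⁻ s in Set.Ioi (q x), η s * ENNReal.ofReal (t - s)) * b' x ∂μ)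
    {g : ℝ → ℝ≥0∞} (hg : Measurable g) (hgt : ∀ s, t ≤ s → g s = 0) :
    ∫⁻ x, g (q x) * a x ∂μ + ∫⁻ x, (∫⁻ s in Set.Ioi (q x), g s) * b x ∂μ
      = ∫⁻ x, g (q x) * a' x ∂μ + ∫⁻ x, (∫⁻ s in Set.Ioi (q x), g s) * b' x ∂μ := by
  have hfin : IsFiniteMeasure (levelMeasure μ q t a b) := by
    refine ⟨?_⟩
    have := lintegral_levelMeasure hq t ha hb (h := fun _ => 1) measurable_const
    simp only [lintegral_one, one_mul] at this
    rw [this]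
    exact ENNReal.add_lt_top.mpr ⟨hfin1.lt_top, hfin2.lt_top⟩
  have hηm : ∀ η : BoundedContinuousFunction ℝ NNReal, Measurable fun s => (η s : ℝ≥0∞) :=
    fun η => (ENNReal.continuous_coe.comp η.continuous).measurable
  -- The factor (t - s)⁺ is built into the measures, so η ranges over all bounded continuous
  -- functions, which determine a finite measure.
  have heq : levelMeasure μ q t a b = levelMeasure μ q t a' b' := by
    refine ext_of_forall_lintegral_eq_of_IsFiniteMeasure fun η => ?_
    rw [lintegral_levelMeasure hq t ha hb (hηm η), lintegral_levelMeasure hq t ha' hb' (hηm η)]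
    exact hη η
  have hk : Measurable fun s : ℝ => ENNReal.ofReal (t - s) := by fun_prop
  -- The test function is g / (t - s)⁺, which undoes the built-in factor; for s ≥ t both sides are
  -- 0.
  have hcancel : ∀ s, g s / ENNReal.ofReal (t - s) * ENNReal.ofReal (t - s) = g s := by
    intro s
    by_cases hs : t ≤ s
    · rw [hgt s hs]
      simp
    · refine ENNReal.div_mul_cancel ?_ ENNReal.ofReal_ne_top
      rw [Ne, ENNReal.ofReal_eq_zero, not_le]
      linarith
  have h1 := lintegral_levelMeasure hq t ha hb (hg.div hk)
  have h2 := lintegral_levelMeasure hq t ha' hb' (hg.div hk)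
  rw [heq, h2] at h1
  simp only [Pi.div_apply, hcancel] at h1
  exact h1.symm

end Duality

/-- Almost every point where `g` is positive lies strictly below a rational `t` with
`∫_t^∞ g > 0`. -/
theorem ae_exists_rat_lt {g : ℝ → ℝ≥0∞} (hg : Measurable g) :
    ∀ᵐ s, g s ≠ 0 → ∃ t : ℚ, s < t ∧ ∫⁻ r in Set.Ioi (t : ℝ), g r ≠ 0 := by
  set Z : Set ℝ := {s | g s ≠ 0 ∧ ∀ t : ℚ, s < t → ∫⁻ r in Set.Ioi (t : ℝ), g r = 0} with hZ
  suffices h : volume Z = 0 by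
    rw [ae_iff]
    convert h using 2
    ext s
    simp [hZ]
  have hsub : Z ⊆ (⋃ t ∈ {t : ℚ | ∫⁻ r in Set.Ioi (t : ℝ), g r = 0},
      {s | (t : ℝ) < s ∧ g s ≠ 0}) ∪
        {s | s ∈ Z ∧ ∀ t : ℚ, (t : ℝ) < s → ∫⁻ r in Set.Ioi (t : ℝ), g r ≠ 0} := by
    intro s hs
    by_cases h : ∃ t : ℚ, (t : ℝ) < s ∧ ∫⁻ r in Set.Ioi (t : ℝ), g r = 0
    · obtain ⟨t, h1, h2⟩ := h
      left
      simp only [Set.mem_iUnion]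
      exact ⟨t, h2, h1, hs.1⟩
    · right
      refine ⟨hs, fun t ht h0 => h ⟨t, ht, h0⟩⟩
  refine measure_mono_null hsub (measure_union_null ?_ ?_)
  · refine (measure_biUnion_null_iff (Set.to_countable _)).mpr fun t ht => ?_
    have h1 := (lintegral_eq_zero_iff hg).mp ht
    rw [Filter.EventuallyEq, ae_restrict_iff' measurableSet_Ioi, ae_iff] at h1
    refine measure_mono_null (fun s hs => ?_) h1
    simp only [Set.mem_ofPred_eq, Classical.not_imp]
    exact ⟨hs.1, hs.2⟩
  -- Two such points would have a rational between them, at which the tail integral would be both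
  -- zero and nonzero.
  · refine Set.Subsingleton.measure_zero ?_ _
    intro s hs s' hs'
    by_contra hne
    rcases lt_or_gt_of_ne hne with hlt | hlt
    · obtain ⟨r, h1, h2⟩ := exists_rat_btwn hlt
      exact hs'.2 r h2 (hs.1.2 r h1)
    · obtain ⟨r, h1, h2⟩ := exists_rat_btwn hlt
      exact hs.2 r h2 (hs'.1.2 r h1)

/-- Truncating g at levels t with nonzero tail, taken along a cofinal sequence, increases to g
almost everywhere, and monotone convergence applies to all four integrals. If no such level exists,
g vanishes almost everywhere. -/
theorem lintegral_level_eq_of_forall_rat {X : Type*} [MeasurableSpace X] {μ : Measure X}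
    {q : X → ℝ} (hq : Measurable q) {a a' b b' : X → ℝ≥0∞}
    (ha : AEMeasurable a μ) (ha' : AEMeasurable a' μ) (hb : AEMeasurable b μ)
    (hb' : AEMeasurable b' μ) (hta : ∀ x, a x ≠ ∞) (hta' : ∀ x, a' x ≠ ∞) (htb : ∀ x, b x ≠ ∞)
    (htb' : ∀ x, b' x ≠ ∞) {g : ℝ → ℝ≥0∞} (hg : Measurable g)
    (hac : ∀ P : ℝ → Prop, (∀ᵐ s, P s) → ∀ᵐ x ∂μ, P (q x))
    (h : ∀ t : ℚ, ∫⁻ r in Set.Ioi (t : ℝ), g r ≠ 0 → ∀ k : ℝ → ℝ≥0∞, Measurable k →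
      (∀ s, (t : ℝ) ≤ s → k s = 0) →
      ∫⁻ x, k (q x) * a x ∂μ + ∫⁻ x, (∫⁻ s in Set.Ioi (q x), k s) * b x ∂μ
        = ∫⁻ x, k (q x) * a' x ∂μ + ∫⁻ x, (∫⁻ s in Set.Ioi (q x), k s) * b' x ∂μ) :
    ∫⁻ x, g (q x) * a x ∂μ + ∫⁻ x, (∫⁻ s in Set.Ioi (q x), g s) * b x ∂μ
      = ∫⁻ x, g (q x) * a' x ∂μ + ∫⁻ x, (∫⁻ s in Set.Ioi (q x), g s) * b' x ∂μ := by
  let ι := {t : ℚ // ∫⁻ r in Set.Ioi (t : ℝ), g r ≠ 0}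
  have hae := ae_exists_rat_lt hg
  rcases isEmpty_or_nonempty ι with hι | hι
  · have h0 : ∀ᵐ s, g s = 0 := by
      filter_upwards [hae] with s hs
      by_contra hc
      obtain ⟨t, -, ht⟩ := hs hc
      exact hι.false ⟨t, ht⟩
    have h1 : ∀ x, ∫⁻ s in Set.Ioi (q x), g s = 0 := fun x =>
      (lintegral_eq_zero_iff hg).mpr (ae_restrict_of_ae h0)
    have h2 : ∀ c : X → ℝ≥0∞, ∫⁻ x, g (q x) * c x ∂μ = 0 := by
      intro c
      rw [← lintegral_zero (μ := μ)]
      refine lintegral_congr_ae ?_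
      filter_upwards [hac _ h0] with x hx
      rw [hx, zero_mul]
    simp [h1, h2]
  · obtain ⟨τ, hτm, hτ⟩ := Filter.exists_seq_monotone_tendsto_atTop_atTop ι
    let k : ℕ → ℝ → ℝ≥0∞ := fun n => Set.indicator (Set.Iio ((τ n : ℚ) : ℝ)) g
    have hkm : ∀ n, Measurable (k n) := fun n => hg.indicator measurableSet_Iio
    have hkmono : ∀ s, Monotone fun n => k n s := by
      intro s n n' hnn
      have hle : ((τ n : ℚ) : ℝ) ≤ ((τ n' : ℚ) : ℝ) := by exact_mod_cast hτm hnn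
      exact Set.indicator_le_indicator_of_subset (Set.Iio_subset_Iio hle) (fun _ => bot_le) s
    have hlim : ∀ᵐ s, Filter.Tendsto (fun n => k n s) Filter.atTop (nhds (g s)) := by
      filter_upwards [hae] with s hs
      by_cases hgs : g s = 0
      · have : ∀ n, k n s = g s := fun n => by
          simp only [k, Set.indicator_apply, hgs, ite_self]
        simp only [this]
        exact tendsto_const_nhds
      · obtain ⟨t, hst, ht⟩ := hs hgs
        refine tendsto_const_nhds.congr' ?_
        filter_upwards [hτ.eventually_ge_atTop ⟨t, ht⟩] with n hn
        have : s < ((τ n : ℚ) : ℝ) := lt_of_lt_of_le hst (by exact_mod_cast hn)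
        simp only [k]
        rw [Set.indicator_of_mem]
        exact this
    have hl1 : ∀ c : X → ℝ≥0∞, AEMeasurable c μ → (∀ x, c x ≠ ∞) →
        Filter.Tendsto (fun n => ∫⁻ x, k n (q x) * c x ∂μ) Filter.atTop
          (nhds (∫⁻ x, g (q x) * c x ∂μ)) := by
      intro c hc hct
      refine lintegral_tendsto_of_tendsto_of_monotone
        (fun n => ((hkm n).comp hq).aemeasurable.mul hc) ?_ ?_
      · exact Filter.Eventually.of_forall fun x n n' hnn =>
          mul_le_mul' (hkmono (q x) hnn) le_rfl
      · filter_upwards [hac _ hlim] with x hx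
        exact ENNReal.Tendsto.mul_const hx (Or.inr (hct x))
    have hl2 : ∀ c : X → ℝ≥0∞, AEMeasurable c μ → (∀ x, c x ≠ ∞) →
        Filter.Tendsto (fun n => ∫⁻ x, (∫⁻ s in Set.Ioi (q x), k n s) * c x ∂μ) Filter.atTop
          (nhds (∫⁻ x, (∫⁻ s in Set.Ioi (q x), g s) * c x ∂μ)) := by
      intro c hc hct
      have hin : ∀ x, Filter.Tendsto (fun n => ∫⁻ s in Set.Ioi (q x), k n s) Filter.atTop
          (nhds (∫⁻ s in Set.Ioi (q x), g s)) := fun x =>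
        lintegral_tendsto_of_tendsto_of_monotone (fun n => (hkm n).aemeasurable)
          (Filter.Eventually.of_forall fun s => hkmono s) (ae_restrict_of_ae hlim)
      refine lintegral_tendsto_of_tendsto_of_monotone (fun n => ?_) ?_ ?_
      · have hanti : Antitone fun y : ℝ => ∫⁻ s in Set.Ioi y, k n s := fun y y' hy =>
          lintegral_mono_set (Set.Ioi_subset_Ioi hy)
        exact (hanti.measurable.comp hq).aemeasurable.mul hc
      · exact Filter.Eventually.of_forall fun x n n' hnn =>
          mul_le_mul' (lintegral_mono fun s => hkmono s hnn) le_rfl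
      · exact Filter.Eventually.of_forall fun x =>
          ENNReal.Tendsto.mul_const (hin x) (Or.inr (hct x))
    have hk0 : ∀ n s, ((τ n : ℚ) : ℝ) ≤ s → k n s = 0 := fun n s hs =>
      Set.indicator_of_notMem (fun hc => absurd (Set.mem_Iio.mp hc) (not_lt.mpr hs)) g
    refine tendsto_nhds_unique ((hl1 a ha hta).add (hl2 b hb htb)) ?_
    refine ((hl1 a' ha' hta').add (hl2 b' hb' htb')).congr fun n => ?_
    exact (h (τ n) (τ n).2 (k n) (hkm n) (hk0 n)).symm

end EllipticalModel

/-! ### The identity for fixed z. -/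

namespace EllipticalModel

/-- The subtraction-free form lets the signed identity be treated as an equality of measures in [0,
∞]. -/
theorem integral_eq_iff_lintegral {X Y : Type*} [MeasurableSpace X] [MeasurableSpace Y]
    {μ : Measure X} {ν : Measure Y} {f : X → ℝ} {g : Y → ℝ}
    (hf : Integrable f μ) (hg : Integrable g ν) :
    ∫ x, f x ∂μ = ∫ y, g y ∂ν ↔
      ∫⁻ x, ENNReal.ofReal (f x) ∂μ + ∫⁻ y, ENNReal.ofReal (-g y) ∂ν
        = ∫⁻ x, ENNReal.ofReal (-f x) ∂μ + ∫⁻ y, ENNReal.ofReal (g y) ∂ν := by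
  have h1 : ∫⁻ x, ENNReal.ofReal (f x) ∂μ ≠ ∞ := hf.lintegral_lt_top.ne
  have h2 : ∫⁻ x, ENNReal.ofReal (-f x) ∂μ ≠ ∞ := hf.neg.lintegral_lt_top.ne
  have h3 : ∫⁻ x, ENNReal.ofReal (g x) ∂ν ≠ ∞ := hg.lintegral_lt_top.ne
  have h4 : ∫⁻ x, ENNReal.ofReal (-g x) ∂ν ≠ ∞ := hg.neg.lintegral_lt_top.ne
  rw [integral_eq_lintegral_pos_part_sub_lintegral_neg_part hf,
    integral_eq_lintegral_pos_part_sub_lintegral_neg_part hg,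
    ← ENNReal.toReal_eq_toReal_iff' (by simp [h1, h4]) (by simp [h2, h3]),
    ENNReal.toReal_add h1 h4, ENNReal.toReal_add h2 h3]
  constructor <;> intro h <;> linarith

variable {p m : ℕ}

theorem integrable_mul_steinHaff {X : Type*} [MeasurableSpace X] {μ : Measure X}
    {l : X → Fin (min p m) → ℝ}
    {φ : Fin (min p m) → (Fin (min p m) → ℝ) → ℝ} {w : X → ℝ}
    (h1 : ∀ i, Integrable (fun u => w u * φ i (l u)) μ)
    (h2 : ∀ i, Integrable (fun u => w u * (l u i * partialDeriv (φ i) i (l u))) μ)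
    (h3 : ∀ i j, j ≠ i → Integrable (fun u => w u * ((l u i * φ i (l u)
      - l u j * φ j (l u)) / (l u i - l u j))) μ) :
    Integrable (fun u => w u * steinHaff p m φ (l u)) μ := by
  simp only [steinHaff, Finset.mul_sum]
  refine integrable_finsetSum _ fun i _ => ?_
  have e1 : (fun u => w u * ((((max p m : ℕ) : ℝ) - ((min p m : ℕ) : ℝ) + 1) * φ i (l u)
      + 2 * l u i * partialDeriv (φ i) i (l u)
      + ∑ j ∈ Finset.univ.erase i, (l u i * φ i (l u) - l u j * φ j (l u))
        / (l u i - l u j)))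
    = fun u => (((max p m : ℕ) : ℝ) - ((min p m : ℕ) : ℝ) + 1) * (w u * φ i (l u))
      + 2 * (w u * (l u i * partialDeriv (φ i) i (l u)))
      + ∑ j ∈ Finset.univ.erase i, w u * ((l u i * φ i (l u) - l u j * φ j (l u))
        / (l u i - l u j)) := by
    ext u
    rw [← Finset.mul_sum]
    ring
  rw [e1]
  exact (((h1 i).const_mul _).add ((h2 i).const_mul _)).add
    (integrable_finsetSum _ fun j hj => h3 i j (Finset.ne_of_mem_erase hj))

/-- This provides the dominating function for the error created by the discriminant cutoff. -/
theorem integrable_mul_discRate {μ : Measure (Fin m → Fin p → ℝ)}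
    {φ : Fin (min p m) → (Fin (min p m) → ℝ) → ℝ} {w : (Fin m → Fin p → ℝ) → ℝ}
    (h1 : ∀ i, Integrable (fun u => w u * φ i (eig u)) μ)
    (h3 : ∀ i j, j ≠ i → Integrable (fun u => w u * ((eig u i * φ i (eig u)
      - eig u j * φ j (eig u)) / (eig u i - eig u j))) μ) :
    Integrable (fun u => w u * discRate φ (eig u)) μ := by
  have e1 : (fun u => w u * discRate φ (eig u)) = fun u =>
      2 * ∑ i, ∑ j ∈ Finset.Ioi i, 2 * (w u * ((eig u j * φ j (eig u) - eig u i * φ i (eig u))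
        / (eig u j - eig u i))) + ∑ i, 2 * (w u * φ i (eig u)) := by
    ext u
    simp only [discRate, mul_add, Finset.mul_sum]
    congr 1
    · exact Finset.sum_congr rfl fun i _ => Finset.sum_congr rfl fun j _ => by ring
    · exact Finset.sum_congr rfl fun i _ => by ring
  rw [e1]
  refine (Integrable.const_mul ?_ _).add ?_
  · exact integrable_finsetSum _ fun i _ => integrable_finsetSum _ fun j hj =>
      (h3 j i (Finset.mem_Ioi.mp hj).ne).const_mul _
  · exact integrable_finsetSum _ fun i _ => (h1 i).const_mul _

theorem aestronglyMeasurable_eig (i : Fin (min p m)) :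
    AEStronglyMeasurable (fun u : Fin m → Fin p → ℝ => eig u i) volume :=
  aestronglyMeasurable_of_continuousAt fun _ hu => (differentiableAt_eig hu i).continuousAt

theorem aemeasurable_steinHaff {φ : Fin (min p m) → (Fin (min p m) → ℝ) → ℝ}
    (hφ : ∀ i, DifferentiableOn ℝ (φ i) (chamber (min p m))) :
    AEMeasurable (fun u : Fin m → Fin p → ℝ => steinHaff p m φ (eig u)) volume := by
  have he := fun i => (aestronglyMeasurable_eig (p := p) (m := m) i).aemeasurable
  have hf : ∀ i, AEMeasurable (fun u : Fin m → Fin p → ℝ => φ i (eig u)) volume := fun i =>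
    (aestronglyMeasurable_of_continuousAt fun u hu =>
      (differentiableAt_comp_eig hu (hφ i)).continuousAt).aemeasurable
  have hd : ∀ i, AEMeasurable (fun u : Fin m → Fin p → ℝ => partialDeriv (φ i) i (eig u)) volume :=
    fun i => (measurable_fderiv_apply_const ℝ (φ i) (Pi.single i 1)).comp_aemeasurable
      (aemeasurable_pi_lambda _ he)
  simp only [steinHaff]
  refine Finset.aemeasurable_fun_sum _ fun i _ => ?_
  refine ((((hf i).const_mul _).add (((he i).const_mul _).mul (hd i)))).add
    (Finset.aemeasurable_fun_sum _ fun j _ => ?_)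
  exact (((he i).mul (hf i)).sub ((he j).mul (hf j))).div ((he i).sub (he j))

/-- The primitive `y ↦ ∫_y^t η(s) (t - s)⁺ ds`. -/
noncomputable def levelPrimitive (η : BoundedContinuousFunction ℝ NNReal) (t y : ℝ) : ℝ :=
  -∫ s in t..y, (η s : ℝ) * max (t - s) 0

theorem continuous_levelWeight (η : BoundedContinuousFunction ℝ NNReal) (t : ℝ) :
    Continuous fun s => (η s : ℝ) * max (t - s) 0 :=
  (NNReal.continuous_coe.comp η.continuous).mul
    ((continuous_const.sub continuous_id).max continuous_const)

theorem hasDerivAt_levelPrimitive (η : BoundedContinuousFunction ℝ NNReal) (t y : ℝ) :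
    HasDerivAt (levelPrimitive η t) (-((η y : ℝ) * max (t - y) 0)) y :=
  ((continuous_levelWeight η t).integral_hasStrictDerivAt t y).hasDerivAt.neg

theorem levelPrimitive_of_ge (η : BoundedContinuousFunction ℝ NNReal) {t y : ℝ} (h : t ≤ y) :
    levelPrimitive η t y = 0 := by
  rw [levelPrimitive, neg_eq_zero]
  refine (intervalIntegral.integral_congr (g := fun _ => 0) fun s hs => ?_).trans (by simp)
  rw [Set.uIcc_of_le h] at hs
  simp only
  rw [max_eq_right (by linarith [hs.1]), mul_zero]

theorem levelPrimitive_nonneg (η : BoundedContinuousFunction ℝ NNReal) (t y : ℝ) :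
    0 ≤ levelPrimitive η t y := by
  rcases le_total t y with h | h
  · rw [levelPrimitive_of_ge η h]
  · rw [levelPrimitive, ← intervalIntegral.integral_symm]
    exact intervalIntegral.integral_nonneg h fun s _ =>
      mul_nonneg (NNReal.coe_nonneg _) (le_max_right _ _)

theorem ofReal_levelWeight (η : BoundedContinuousFunction ℝ NNReal) (t s : ℝ) :
    ENNReal.ofReal ((η s : ℝ) * max (t - s) 0) = η s * ENNReal.ofReal (t - s) := by
  rw [ENNReal.ofReal_mul (NNReal.coe_nonneg _), ENNReal.ofReal_coe_nnreal,
    show ENNReal.ofReal (max (t - s) 0) = ENNReal.ofReal (t - s) by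
      rw [ENNReal.ofReal_max]; simp]

theorem ofReal_levelPrimitive (η : BoundedContinuousFunction ℝ NNReal) (t y : ℝ) :
    ENNReal.ofReal (levelPrimitive η t y)
      = ∫⁻ s in Set.Ioi y, η s * ENNReal.ofReal (t - s) := by
  simp_rw [← ofReal_levelWeight]
  rcases le_total t y with h | h
  · rw [levelPrimitive_of_ge η h, ENNReal.ofReal_zero, eq_comm,
      setLIntegral_congr_fun (g := fun _ => 0) measurableSet_Ioi]
    · simp
    · intro s hs
      have : y < s := hs
      simp only
      rw [max_eq_right (by linarith), mul_zero, ENNReal.ofReal_zero]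
  · have h0 : ∀ s ∈ Set.Ioi y \ Set.Ioc y t,
        ENNReal.ofReal ((η s : ℝ) * max (t - s) 0) = 0 := by
      intro s hs
      have h1 : y < s := hs.1
      have h2 : t < s := by
        by_contra hc
        exact hs.2 ⟨h1, not_lt.mp hc⟩
      rw [max_eq_right (by linarith), mul_zero, ENNReal.ofReal_zero]
    have h1 : ∫⁻ s in Set.Ioi y, ENNReal.ofReal ((η s : ℝ) * max (t - s) 0)
        = ∫⁻ s in Set.Ioc y t, ENNReal.ofReal ((η s : ℝ) * max (t - s) 0) := by
      rw [← lintegral_indicator measurableSet_Ioi, ← lintegral_indicator measurableSet_Ioc]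
      refine lintegral_congr fun s => ?_
      by_cases hs : s ∈ Set.Ioc y t
      · rw [Set.indicator_of_mem hs, Set.indicator_of_mem (show s ∈ Set.Ioi y from hs.1)]
      · rw [Set.indicator_of_notMem hs]
        by_cases hs' : s ∈ Set.Ioi y
        · rw [Set.indicator_of_mem hs', h0 s ⟨hs', hs⟩]
        · rw [Set.indicator_of_notMem hs']
    rw [h1, levelPrimitive, ← intervalIntegral.integral_symm, intervalIntegral.integral_of_le h,
      ofReal_integral_eq_lintegral_ofReal]
    · exact ((continuous_levelWeight η t).integrableOn_Icc).mono_set Set.Ioc_subset_Icc_self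
    · exact Filter.Eventually.of_forall fun s =>
        mul_nonneg (NNReal.coe_nonneg _) (le_max_right _ _)

theorem exists_bound_of_continuous_of_ge {k : ℝ → ℝ} (hk : Continuous k) {t : ℝ}
    (ht : ∀ y, t ≤ y → k y = 0) : ∃ C, ∀ y, 0 ≤ y → |k y| ≤ C := by
  obtain ⟨C, hC⟩ := (isCompact_Icc (a := (0 : ℝ)) (b := t)).exists_bound_of_continuousOn
    hk.continuousOn
  refine ⟨max C 0, fun y hy => ?_⟩
  rcases le_total t y with h | h
  · rw [ht y h]
    simp
  · exact (hC y ⟨hy, h⟩).trans (le_max_left _ _)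

theorem integrable_comp_rowForm_mul {Sig : Matrix (Fin p) (Fin p) ℝ} (hSig : Sig.PosDef)
    {h : (Fin m → Fin p → ℝ) → ℝ} {t : ℝ}
    (hh : IntegrableOn h {u | rowForm Sig u < t}) {k : ℝ → ℝ} (hk : Continuous k)
    (ht : ∀ y, t ≤ y → k y = 0) : Integrable fun u => k (rowForm Sig u) * h u := by
  obtain ⟨C, hC⟩ := exists_bound_of_continuous_of_ge hk ht
  have h1 : IntegrableOn (fun u => k (rowForm Sig u) * h u) {u | rowForm Sig u < t} :=
    Integrable.bdd_mul hh (hk.comp (continuous_rowForm Sig)).aestronglyMeasurable.restrict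
      (Filter.Eventually.of_forall fun u => hC _ (rowForm_nonneg hSig u))
  refine h1.integrable_of_forall_notMem_eq_zero fun u hu => ?_
  rw [ht _ (not_lt.mp hu), zero_mul]

/-- The integration by parts formula for a radial weight vanishing above level `t`. -/
theorem integral_levelPrimitive_mul {Sig : Matrix (Fin p) (Fin p) ℝ} (hSig : Sig.PosDef)
    {φ : Fin (min p m) → (Fin (min p m) → ℝ) → ℝ}
    (hφ : ∀ i, DifferentiableOn ℝ (φ i) (chamber (min p m))) {t : ℝ}
    (h1 : IntegrableOn (fun u : Fin m → Fin p → ℝ => steinHaff p m φ (eig u))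
      {u | rowForm Sig u < t})
    (h2 : IntegrableOn (fun u : Fin m → Fin p → ℝ => 2 * scoreTerm Sig φ u)
      {u | rowForm Sig u < t})
    (h3 : IntegrableOn (fun u : Fin m → Fin p → ℝ => discRate φ (eig u)) {u | rowForm Sig u < t})
    (η : BoundedContinuousFunction ℝ NNReal) :
    ∫ u : Fin m → Fin p → ℝ, (η (rowForm Sig u) * max (t - rowForm Sig u) 0)
        * (2 * scoreTerm Sig φ u)
      = ∫ u, levelPrimitive η t (rowForm Sig u) * steinHaff p m φ (eig u) := by
  obtain ⟨R, hR⟩ := exists_le_rowForm (m := m) hSig t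
  have hq : Differentiable ℝ (rowForm Sig : (Fin m → Fin p → ℝ) → ℝ) :=
    (contDiff_rowForm Sig (n := 1)).differentiable one_ne_zero
  have hψd : Differentiable ℝ (levelPrimitive η t) := fun y =>
    (hasDerivAt_levelPrimitive η t y).differentiableAt
  have hψ0 : ∀ y, t ≤ y → levelPrimitive η t y = 0 := fun y hy => levelPrimitive_of_ge η hy
  have hk0 : ∀ y, t ≤ y → (η y : ℝ) * max (t - y) 0 = 0 := fun y hy => by
    rw [max_eq_right (by linarith), mul_zero]
  have hderiv : ∀ u : Fin m → Fin p → ℝ,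
      fderiv ℝ (fun v => levelPrimitive η t (rowForm Sig v)) u (fun a b => field φ u a b)
      = -((η (rowForm Sig u) * max (t - rowForm Sig u) 0) * (2 * scoreTerm Sig φ u)) := by
    intro u
    have := ((hasDerivAt_levelPrimitive η t (rowForm Sig u)).comp_hasFDerivAt u
      (hq u).hasFDerivAt).fderiv
    rw [show (fun v => levelPrimitive η t (rowForm Sig v)) = levelPrimitive η t ∘ rowForm Sig
      from rfl, this]
    simp only [_root_.smul_apply, smul_eq_mul]
    rw [fderiv_rowForm_field hSig]
    ring
  have key := integral_mul_steinHaff hφ (w := fun v => levelPrimitive η t (rowForm Sig v))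
    (hψd.comp hq) (R := R) (fun u hu => hψ0 _ (hR u hu))
    (integrable_comp_rowForm_mul hSig h1 hψd.continuous hψ0) (by
      simp_rw [hderiv]
      exact (integrable_comp_rowForm_mul hSig h2 (continuous_levelWeight η t) hk0).neg)
    (integrable_comp_rowForm_mul hSig h3 hψd.continuous hψ0)
  simp_rw [hderiv] at key
  rw [key, integral_neg, neg_neg]

theorem antitone_lintegral_Ioi (g : ℝ → ℝ≥0∞) : Antitone fun y : ℝ => ∫⁻ s in Set.Ioi y, g s :=
  fun _ _ hy => lintegral_mono_set (Set.Ioi_subset_Ioi hy)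

/-- The tail is decreasing, so below level t it is bounded below by a positive constant and may be
divided out. -/
theorem integrableOn_of_integrable_tail_mul {Sig : Matrix (Fin p) (Fin p) ℝ} {g : ℝ → ℝ≥0∞}
    (hfin : ∀ᵐ u : Fin m → Fin p → ℝ, ∫⁻ s in Set.Ioi (rowForm Sig u), g s ≠ ∞) {t : ℝ}
    (ht : ∫⁻ s in Set.Ioi t, g s ≠ 0) {h : (Fin m → Fin p → ℝ) → ℝ}
    (hh : Integrable fun u => (∫⁻ s in Set.Ioi (rowForm Sig u), g s).toReal * h u) :
    IntegrableOn h {u | rowForm Sig u < t} := by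
  set G : ℝ → ℝ≥0∞ := fun y => ∫⁻ s in Set.Ioi y, g s with hG
  have hanti : Antitone G := antitone_lintegral_Ioi g
  -- The minimum with 1 covers an infinite tail at t, whose `toReal` would be 0.
  set c := (min (G t) 1).toReal with hc
  have hc0 : 0 < c := ENNReal.toReal_pos (by simp [ht, hG]) (by simp)
  have hmeas : Measurable fun u : Fin m → Fin p → ℝ => ((G (rowForm Sig u)).toReal)⁻¹ :=
    ((hanti.measurable.comp (continuous_rowForm Sig).measurable).ennreal_toReal).inv
  have hset : MeasurableSet {u : Fin m → Fin p → ℝ | rowForm Sig u < t} :=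
    (continuous_rowForm Sig).measurable measurableSet_Iio
  have hle : ∀ᵐ u ∂(volume.restrict {u : Fin m → Fin p → ℝ | rowForm Sig u < t}),
      c ≤ (G (rowForm Sig u)).toReal := by
    filter_upwards [ae_restrict_mem hset, ae_restrict_of_ae hfin] with u hu hu'
    exact ENNReal.toReal_mono hu' ((min_le_left _ _).trans (hanti (le_of_lt hu)))
  have h1 : IntegrableOn (fun u => ((G (rowForm Sig u)).toReal)⁻¹
      * ((G (rowForm Sig u)).toReal * h u)) {u | rowForm Sig u < t} := by
    refine Integrable.bdd_mul (c := c⁻¹) hh.integrableOn hmeas.aestronglyMeasurable ?_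
    filter_upwards [hle] with u hu
    rw [Real.norm_eq_abs, abs_inv, abs_of_nonneg (hc0.le.trans hu)]
    exact inv_anti₀ hc0 hu
  refine h1.congr ?_
  filter_upwards [hle] with u hu
  rw [← mul_assoc, inv_mul_cancel₀ (hc0.trans_le hu).ne', one_mul]

/-- The identity for the `u`-marginal: `∫ g(q) 2 tr(Σ⁻¹ H L Φ Hᵀ) = ∫ (∫_q^∞ g) div`. -/
theorem integral_scoreTerm_eq {Sig : Matrix (Fin p) (Fin p) ℝ} (hSig : Sig.PosDef)
    (hp : 0 < p) (hm : 0 < m) {φ : Fin (min p m) → (Fin (min p m) → ℝ) → ℝ}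
    (hφ : ∀ i, DifferentiableOn ℝ (φ i) (chamber (min p m)))
    {g : ℝ → ℝ≥0∞} (hg : Measurable g) (hgtop : ∀ s, g s ≠ ∞)
    (hfin : ∀ᵐ u : Fin m → Fin p → ℝ, ∫⁻ s in Set.Ioi (rowForm Sig u), g s ≠ ∞)
    (h0 : Integrable fun u : Fin m → Fin p → ℝ =>
      (g (rowForm Sig u)).toReal * scoreTerm Sig φ u)
    (h1 : ∀ i, Integrable fun u : Fin m → Fin p → ℝ =>
      (∫⁻ s in Set.Ioi (rowForm Sig u), g s).toReal * φ i (eig u))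
    (h2 : ∀ i, Integrable fun u : Fin m → Fin p → ℝ =>
      (∫⁻ s in Set.Ioi (rowForm Sig u), g s).toReal * (eig u i * partialDeriv (φ i) i (eig u)))
    (h3 : ∀ i j, j ≠ i → Integrable fun u : Fin m → Fin p → ℝ =>
      (∫⁻ s in Set.Ioi (rowForm Sig u), g s).toReal * ((eig u i * φ i (eig u)
        - eig u j * φ j (eig u)) / (eig u i - eig u j))) :
    ∫ u : Fin m → Fin p → ℝ, (g (rowForm Sig u)).toReal * (2 * scoreTerm Sig φ u)
      = ∫ u : Fin m → Fin p → ℝ,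
        (∫⁻ s in Set.Ioi (rowForm Sig u), g s).toReal * steinHaff p m φ (eig u) := by
  have hA : Integrable fun u : Fin m → Fin p → ℝ =>
      (g (rowForm Sig u)).toReal * (2 * scoreTerm Sig φ u) := by
    refine (h0.const_mul 2).congr (Filter.Eventually.of_forall fun u => ?_)
    simp only
    ring
  have hSH := integrable_mul_steinHaff h1 h2 h3
  have hqm : Measurable (rowForm Sig : (Fin m → Fin p → ℝ) → ℝ) :=
    (continuous_rowForm Sig).measurable
  have hscm : AEStronglyMeasurable (fun u : Fin m → Fin p → ℝ => 2 * scoreTerm Sig φ u) volume :=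
    (aestronglyMeasurable_of_continuousAt fun u hu =>
      (differentiableAt_scoreTerm Sig hφ hu).continuousAt).const_mul 2
  have hshm := aemeasurable_steinHaff (p := p) (m := m) hφ
  rw [integral_eq_iff_lintegral hA hSH]
  have e1 : ∀ c : (Fin m → Fin p → ℝ) → ℝ,
      ∫⁻ u, ENNReal.ofReal ((g (rowForm Sig u)).toReal * c u)
        = ∫⁻ u, g (rowForm Sig u) * ENNReal.ofReal (c u) := by
    intro c
    refine lintegral_congr fun u => ?_
    rw [ENNReal.ofReal_mul ENNReal.toReal_nonneg, ENNReal.ofReal_toReal (hgtop _)]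
  have e2 : ∀ c : (Fin m → Fin p → ℝ) → ℝ,
      ∫⁻ u, ENNReal.ofReal ((∫⁻ s in Set.Ioi (rowForm Sig u), g s).toReal * c u)
        = ∫⁻ u, (∫⁻ s in Set.Ioi (rowForm Sig u), g s) * ENNReal.ofReal (c u) := by
    intro c
    refine lintegral_congr_ae ?_
    filter_upwards [hfin] with u hu
    rw [ENNReal.ofReal_mul ENNReal.toReal_nonneg, ENNReal.ofReal_toReal hu]
  have hscn : AEMeasurable (fun u : Fin m → Fin p → ℝ => ENNReal.ofReal (2 * -scoreTerm Sig φ u))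
      volume := by
    have h : AEMeasurable (fun u : Fin m → Fin p → ℝ => -(2 * scoreTerm Sig φ u)) volume :=
      hscm.aemeasurable.neg
    simp_rw [← mul_neg] at h
    exact h.ennreal_ofReal
  simp_rw [← mul_neg]
  rw [e1, e1, e2, e2]
  refine lintegral_level_eq_of_forall_rat hqm hscm.aemeasurable.ennreal_ofReal
    hscn hshm.neg.ennreal_ofReal hshm.ennreal_ofReal
    (fun _ => ENNReal.ofReal_ne_top) (fun _ => ENNReal.ofReal_ne_top)
    (fun _ => ENNReal.ofReal_ne_top) (fun _ => ENNReal.ofReal_ne_top) hg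
    (fun P hP => ae_rowForm_of_ae hSig hp hm hP) fun t ht k hk hkt => ?_
  have hφi : ∀ i, IntegrableOn (fun u : Fin m → Fin p → ℝ => φ i (eig u))
      {u | rowForm Sig u < (t : ℝ)} := fun i =>
    integrableOn_of_integrable_tail_mul hfin ht (h1 i)
  have hi1 : IntegrableOn (fun u : Fin m → Fin p → ℝ => steinHaff p m φ (eig u))
      {u | rowForm Sig u < (t : ℝ)} := integrableOn_of_integrable_tail_mul hfin ht hSH
  have hi3 : IntegrableOn (fun u : Fin m → Fin p → ℝ => discRate φ (eig u))
      {u | rowForm Sig u < (t : ℝ)} :=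
    integrableOn_of_integrable_tail_mul hfin ht (integrable_mul_discRate h1 h3)
  have hi2 : IntegrableOn (fun u : Fin m → Fin p → ℝ => 2 * scoreTerm Sig φ u)
      {u | rowForm Sig u < (t : ℝ)} := by
    have hset : MeasurableSet {u : Fin m → Fin p → ℝ | rowForm Sig u < t} :=
      hqm measurableSet_Iio
    -- Below level t the bound q ∑ |φ_i| is at most t ∑ |φ_i|.
    refine Integrable.mono' (g := fun u => 2 * (t * ∑ i, |φ i (eig u)|))
      (((integrable_finsetSum _ fun i _ => (hφi i).abs).const_mul _).const_mul _)
      hscm.restrict ?_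
    filter_upwards [ae_restrict_mem hset, ae_restrict_of_ae ae_disc_ne_zero] with u hu hud
    rw [Real.norm_eq_abs, abs_mul, abs_two]
    refine mul_le_mul_of_nonneg_left ((abs_scoreTerm_le hSig φ hud).trans ?_) zero_le_two
    exact mul_le_mul_of_nonneg_right (le_of_lt hu) (Finset.sum_nonneg fun _ _ => abs_nonneg _)
  have hη : ∀ η : BoundedContinuousFunction ℝ NNReal, _ := fun η =>
    (integral_eq_iff_lintegral
      (integrable_comp_rowForm_mul hSig hi2 (continuous_levelWeight η t) fun y hy => by
        rw [max_eq_right (by linarith), mul_zero])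
      (integrable_comp_rowForm_mul hSig hi1
        (k := levelPrimitive η t)
        (continuous_iff_continuousAt.mpr fun y =>
          (hasDerivAt_levelPrimitive η t y).continuousAt)
        fun y hy => levelPrimitive_of_ge η hy)).mp
      (integral_levelPrimitive_mul hSig hφ hi1 hi2 hi3 η)
  have e3 : ∀ (η : BoundedContinuousFunction ℝ NNReal) (c : (Fin m → Fin p → ℝ) → ℝ),
      ∫⁻ u, ENNReal.ofReal ((η (rowForm Sig u) * max (t - rowForm Sig u) 0) * c u)
        = ∫⁻ u, η (rowForm Sig u) * ENNReal.ofReal (t - rowForm Sig u)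
          * ENNReal.ofReal (c u) := by
    intro η c
    refine lintegral_congr fun u => ?_
    rw [ENNReal.ofReal_mul (mul_nonneg (NNReal.coe_nonneg _) (le_max_right _ _)),
      ofReal_levelWeight]
  have e4 : ∀ (η : BoundedContinuousFunction ℝ NNReal) (c : (Fin m → Fin p → ℝ) → ℝ),
      ∫⁻ u, ENNReal.ofReal (levelPrimitive η t (rowForm Sig u) * c u)
        = ∫⁻ u, (∫⁻ s in Set.Ioi (rowForm Sig u), η s * ENNReal.ofReal (t - s))
          * ENNReal.ofReal (c u) := by
    intro η c
    refine lintegral_congr fun u => ?_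
    rw [ENNReal.ofReal_mul (levelPrimitive_nonneg _ _ _), ofReal_levelPrimitive]
  simp_rw [← mul_neg, e3, e4] at hη
  refine lintegral_level_eq hqm t hscm.aemeasurable.ennreal_ofReal
    hscn hshm.neg.ennreal_ofReal hshm.ennreal_ofReal ?_ ?_ hη
    hk hkt
  -- The choice η = 1 gives the finite total mass required of the level measure.
  · have := (integrable_comp_rowForm_mul hSig hi2 (continuous_levelWeight 1 t) fun y hy => by
        rw [max_eq_right (by linarith), mul_zero]).lintegral_lt_top.ne
    rw [e3] at this
    simpa using this
  · have := (integrable_comp_rowForm_mul hSig hi1.neg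
        (k := levelPrimitive 1 t)
        (continuous_iff_continuousAt.mpr fun y =>
          (hasDerivAt_levelPrimitive 1 t y).continuousAt)
        fun y hy => levelPrimitive_of_ge 1 hy).lintegral_lt_top.ne
    rw [e4] at this
    simpa using this

end EllipticalModel

/-! ### Unnormalized expectations and Fubini over z. -/

namespace EllipticalModel

variable {p q m : ℕ}

theorem continuous_quadForm (Sig : Matrix (Fin p) (Fin p) ℝ) (θ : Matrix (Fin q) (Fin p) ℝ) :
    Continuous (quadForm Sig θ : (Fin q → Fin p → ℝ) × (Fin m → Fin p → ℝ) → ℝ) := by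
  have h1 : Continuous fun x : (Fin q → Fin p → ℝ) × (Fin m → Fin p → ℝ) =>
      (fun a b => x.1 a b - θ a b : Fin q → Fin p → ℝ) := by fun_prop
  exact ((continuous_rowForm Sig).comp h1).add ((continuous_rowForm Sig).comp continuous_snd)

theorem measurable_Fstar (f : ℝ → ℝ) : Measurable (Fstar f) :=
  (antitone_lintegral_Ioi _).measurable.const_mul _

theorem setLIntegral_Ioi_comp_add (h : ℝ → ℝ≥0∞) (c y : ℝ) :
    ∫⁻ s in Set.Ioi y, h (c + s) = ∫⁻ s in Set.Ioi (c + y), h s := by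
  have := (measurePreserving_add_left (volume : Measure ℝ) c).setLIntegral_comp_preimage_emb
    (MeasurableEquiv.addLeft c).measurableEmbedding h (Set.Ioi (c + y))
  rwa [Set.preimage_const_add_Ioi, add_sub_cancel_left] at this

theorem setLIntegral_Ioi_eq_Fstar (f : ℝ → ℝ) (c y : ℝ) :
    ∫⁻ s in Set.Ioi y, ENNReal.ofReal (f (c + s)) = 2 * Fstar f (c + y) := by
  rw [setLIntegral_Ioi_comp_add fun s => ENNReal.ofReal (f s), Fstar, ← mul_assoc,
    ENNReal.mul_inv_cancel two_ne_zero (by simp), one_mul]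

theorem measurable_ellDensity (Sig : Matrix (Fin p) (Fin p) ℝ) (θ : Matrix (Fin q) (Fin p) ℝ)
    {g : ℝ → ℝ≥0∞} (hg : Measurable g) :
    Measurable (ellDensity (m := m) Sig θ g) :=
  (hg.comp (continuous_quadForm Sig θ).measurable).const_mul _

theorem det_rpow_pos {Sig : Matrix (Fin p) (Fin p) ℝ} (hSig : Sig.PosDef) (n : ℝ) :
    0 < Sig.det ^ n := Real.rpow_pos_of_pos hSig.det_pos n

section Expectations

variable {Sig : Matrix (Fin p) (Fin p) ℝ} {θ : Matrix (Fin q) (Fin p) ℝ} {f : ℝ → ℝ}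
  {h : (Fin q → Fin p → ℝ) × (Fin m → Fin p → ℝ) → ℝ}

theorem integral_law (hSig : Sig.PosDef) (hf : Measurable f) :
    ∫ x, h x ∂(law m Sig θ f) = Sig.det ^ (-((q + m : ℕ) : ℝ) / 2) *
      ∫ x, (ENNReal.ofReal (f (quadForm Sig θ x))).toReal * h x := by
  rw [law, integral_withDensity_eq_integral_toReal_smul
    (measurable_ellDensity Sig θ hf.ennreal_ofReal)
    (Filter.Eventually.of_forall fun x => ENNReal.mul_lt_top ENNReal.ofReal_lt_top
      ENNReal.ofReal_lt_top), ← integral_const_mul]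
  refine integral_congr_ae (Filter.Eventually.of_forall fun x => ?_)
  simp only [ellDensity, ENNReal.toReal_mul, smul_eq_mul,
    ENNReal.toReal_ofReal (det_rpow_pos hSig _).le, mul_assoc]

theorem integrable_of_integrable_law (hSig : Sig.PosDef) (hf : Measurable f)
    (hh : Integrable h (law m Sig θ f)) :
    Integrable fun x => (ENNReal.ofReal (f (quadForm Sig θ x))).toReal * h x := by
  rw [law, integrable_withDensity_iff_integrable_smul'
    (measurable_ellDensity Sig θ hf.ennreal_ofReal)
    (Filter.Eventually.of_forall fun x => ENNReal.mul_lt_top ENNReal.ofReal_lt_top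
      ENNReal.ofReal_lt_top)] at hh
  simp only [ellDensity, ENNReal.toReal_mul, smul_eq_mul,
    ENNReal.toReal_ofReal (det_rpow_pos hSig _).le, mul_assoc] at hh
  exact (integrable_const_mul_iff (det_rpow_pos hSig _).ne'.isUnit _).mp hh

theorem ae_Fstar_ne_top (hSig : Sig.PosDef) (hK : Kstar m Sig θ f ≠ ∞) :
    ∀ᵐ x : (Fin q → Fin p → ℝ) × (Fin m → Fin p → ℝ), Fstar f (quadForm Sig θ x) ≠ ∞ := by
  filter_upwards [ae_lt_top (measurable_ellDensity Sig θ (measurable_Fstar f)) hK] with x hx htop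
  rw [ellDensity, htop, ENNReal.mul_top
    (ENNReal.ofReal_pos.mpr (det_rpow_pos hSig _)).ne'] at hx
  exact lt_irrefl _ hx

theorem ae_Fstar_eq_zero (hSig : Sig.PosDef) (hK : Kstar m Sig θ f = 0) :
    ∀ᵐ x : (Fin q → Fin p → ℝ) × (Fin m → Fin p → ℝ), Fstar f (quadForm Sig θ x) = 0 := by
  filter_upwards [(lintegral_eq_zero_iff
    (measurable_ellDensity Sig θ (measurable_Fstar f))).mp hK] with x hx
  exact (mul_eq_zero.mp hx).resolve_left (ENNReal.ofReal_pos.mpr (det_rpow_pos hSig _)).ne'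

theorem ae_density_lawStar_lt_top (hK : Kstar m Sig θ f ≠ ∞) (hK0 : Kstar m Sig θ f ≠ 0) :
    ∀ᵐ x : (Fin q → Fin p → ℝ) × (Fin m → Fin p → ℝ),
      (Kstar m Sig θ f)⁻¹ * ellDensity Sig θ (Fstar f) x < ∞ := by
  filter_upwards [ae_lt_top (measurable_ellDensity Sig θ (measurable_Fstar f)) hK] with x hx
  exact ENNReal.mul_lt_top (ENNReal.inv_lt_top.mpr (pos_iff_ne_zero.mpr hK0)) hx

theorem integrable_of_integrable_lawStar (hSig : Sig.PosDef) (hK : Kstar m Sig θ f ≠ ∞)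
    (hh : Integrable h (lawStar m Sig θ f)) :
    Integrable fun x => (Fstar f (quadForm Sig θ x)).toReal * h x := by
  -- If K* = 0 the normalized density is not meaningful, but then F* vanishes almost everywhere
  -- along the quadratic form and the weighted function is zero.
  by_cases hK0 : Kstar m Sig θ f = 0
  · refine (integrable_zero _ ℝ _).congr ?_
    filter_upwards [ae_Fstar_eq_zero hSig hK0] with x hx
    simp [hx]
  · rw [lawStar, integrable_withDensity_iff_integrable_smul'
      ((measurable_ellDensity Sig θ (measurable_Fstar f)).const_mul _)
      (ae_density_lawStar_lt_top hK hK0)] at hh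
    simp only [ellDensity, ENNReal.toReal_mul, smul_eq_mul,
      ENNReal.toReal_ofReal (det_rpow_pos hSig _).le, mul_assoc] at hh
    rw [integrable_const_mul_iff, integrable_const_mul_iff] at hh
    · exact hh
    · exact (det_rpow_pos hSig _).ne'.isUnit
    · exact (ENNReal.toReal_pos (ENNReal.inv_ne_zero.mpr hK)
        (ENNReal.inv_ne_top.mpr hK0)).ne'.isUnit

theorem Kstar_mul_integral_lawStar (hSig : Sig.PosDef) (hK : Kstar m Sig θ f ≠ ∞) :
    (Kstar m Sig θ f).toReal * ∫ x, h x ∂(lawStar m Sig θ f)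
      = Sig.det ^ (-((q + m : ℕ) : ℝ) / 2) *
        ∫ x, (Fstar f (quadForm Sig θ x)).toReal * h x := by
  by_cases hK0 : Kstar m Sig θ f = 0
  · rw [hK0, ENNReal.toReal_zero, zero_mul, integral_eq_zero_of_ae, mul_zero]
    filter_upwards [ae_Fstar_eq_zero hSig hK0] with x hx
    simp [hx]
  · rw [lawStar, integral_withDensity_eq_integral_toReal_smul
      ((measurable_ellDensity Sig θ (measurable_Fstar f)).const_mul _)
      (ae_density_lawStar_lt_top hK hK0)]
    simp only [ellDensity, ENNReal.toReal_mul, smul_eq_mul, ENNReal.toReal_inv,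
      ENNReal.toReal_ofReal (det_rpow_pos hSig _).le, mul_assoc]
    rw [integral_const_mul, integral_const_mul,
      mul_inv_cancel_left₀ (ENNReal.toReal_pos hK0 hK).ne']

end Expectations

/-- The identity for the unnormalized densities on the product space. -/
theorem integral_quadForm_mul_scoreTerm {Sig : Matrix (Fin p) (Fin p) ℝ} (hSig : Sig.PosDef)
    (hp : 0 < p) (hm : 0 < m) (θ : Matrix (Fin q) (Fin p) ℝ)
    {φ : Fin (min p m) → (Fin (min p m) → ℝ) → ℝ}
    (hφ : ∀ i, DifferentiableOn ℝ (φ i) (chamber (min p m)))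
    {f : ℝ → ℝ} (hf : Measurable f)
    (hfin : ∀ᵐ x : (Fin q → Fin p → ℝ) × (Fin m → Fin p → ℝ), Fstar f (quadForm Sig θ x) ≠ ∞)
    (h0 : Integrable fun x : (Fin q → Fin p → ℝ) × (Fin m → Fin p → ℝ) =>
      (ENNReal.ofReal (f (quadForm Sig θ x))).toReal * scoreTerm Sig φ x.2)
    (h1 : ∀ i, Integrable fun x : (Fin q → Fin p → ℝ) × (Fin m → Fin p → ℝ) =>
      (Fstar f (quadForm Sig θ x)).toReal * φ i (eig x.2))
    (h2 : ∀ i, Integrable fun x : (Fin q → Fin p → ℝ) × (Fin m → Fin p → ℝ) =>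
      (Fstar f (quadForm Sig θ x)).toReal * (eig x.2 i * partialDeriv (φ i) i (eig x.2)))
    (h3 : ∀ i j, j ≠ i → Integrable fun x : (Fin q → Fin p → ℝ) × (Fin m → Fin p → ℝ) =>
      (Fstar f (quadForm Sig θ x)).toReal * ((eig x.2 i * φ i (eig x.2)
        - eig x.2 j * φ j (eig x.2)) / (eig x.2 i - eig x.2 j))) :
    ∫ x : (Fin q → Fin p → ℝ) × (Fin m → Fin p → ℝ),
        (ENNReal.ofReal (f (quadForm Sig θ x))).toReal * scoreTerm Sig φ x.2
      = ∫ x : (Fin q → Fin p → ℝ) × (Fin m → Fin p → ℝ),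
        (Fstar f (quadForm Sig θ x)).toReal * steinHaff p m φ (eig x.2) := by
  have hSH := integrable_mul_steinHaff h1 h2 h3
  rw [Measure.volume_eq_prod] at hfin h0 hSH ⊢
  simp only [Measure.volume_eq_prod] at h1 h2 h3
  rw [integral_prod _ h0, integral_prod _ hSH]
  refine integral_congr_ae ?_
  filter_upwards [Measure.ae_ae_of_ae_prod hfin, h0.prod_right_ae,
    ae_all_iff.mpr fun i => (h1 i).prod_right_ae, ae_all_iff.mpr fun i => (h2 i).prod_right_ae,
    ae_all_iff.mpr fun i => ae_all_iff.mpr fun j => ae_all_iff.mpr fun hj =>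
      (h3 i j hj).prod_right_ae] with z kfin k0 k1 k2 k3
  set c := rowForm Sig (fun a b => z a b - θ a b) with hc
  have hq : ∀ u : Fin m → Fin p → ℝ, quadForm Sig θ (z, u) = c + rowForm Sig u := fun u => rfl
  simp only [hq] at kfin k0 k1 k2 k3 ⊢
  -- For fixed z the generator is s ↦ f(c + s), whose tail is 2 F*(c + ·); this 2 cancels the one
  -- from differentiating q.
  have key := integral_scoreTerm_eq hSig hp hm hφ (g := fun s => ENNReal.ofReal (f (c + s)))
    (hf.comp (measurable_const_add c)).ennreal_ofReal (fun _ => ENNReal.ofReal_ne_top)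
    (by
      filter_upwards [kfin] with u hu
      rw [setLIntegral_Ioi_eq_Fstar]
      exact ENNReal.mul_ne_top (by simp) hu)
    k0
    (fun i => by
      simp only [setLIntegral_Ioi_eq_Fstar, ENNReal.toReal_mul, mul_assoc]
      exact (k1 i).const_mul _)
    (fun i => by
      simp only [setLIntegral_Ioi_eq_Fstar, ENNReal.toReal_mul, mul_assoc]
      exact (k2 i).const_mul _)
    (fun i j hj => by
      simp only [setLIntegral_Ioi_eq_Fstar, ENNReal.toReal_mul, mul_assoc]
      exact (k3 i j hj).const_mul _)
  simp only [setLIntegral_Ioi_eq_Fstar, ENNReal.toReal_mul, mul_assoc, ENNReal.toReal_ofNat,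
    mul_left_comm _ (2 : ℝ), integral_const_mul] at key
  exact mul_left_cancel₀ two_ne_zero key

end EllipticalModel

theorem corollaryA1 (p q m : ℕ)
    (Sig : Matrix (Fin p) (Fin p) ℝ) (hSig : Sig.PosDef)
    (θ : Matrix (Fin q) (Fin p) ℝ)
    (f : ℝ → ℝ) (hf_meas : Measurable f) (hf_nonneg : ∀ t, 0 ≤ t → 0 ≤ f t)
    (hf_prob : IsProbabilityMeasure (EllipticalModel.law m Sig θ f))
    (hK : EllipticalModel.Kstar m Sig θ f ≠ ∞)
    (H : (Fin m → Fin p → ℝ) → Matrix (Fin p) (Fin (min p m)) ℝ)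
    (hH : ∀ᵐ u, EllipticalModel.IsEigenvectorMatrix u (H u))
    (φ : Fin (min p m) → (Fin (min p m) → ℝ) → ℝ)
    (hφ : ∀ i, DifferentiableOn ℝ (φ i) (EllipticalModel.chamber (min p m)))
    (hE : Integrable
      (fun x => EllipticalModel.traceTerm Sig (H x.2) (EllipticalModel.eig x.2) φ)
      (EllipticalModel.law m Sig θ f))
    -- the expectations of the individual terms on the right-hand side exist
    (hE1 : ∀ i, Integrable (fun x => φ i (EllipticalModel.eig x.2))
      (EllipticalModel.lawStar m Sig θ f))
    (hE2 : ∀ i, Integrable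
      (fun x => EllipticalModel.eig x.2 i *
        EllipticalModel.partialDeriv (φ i) i (EllipticalModel.eig x.2))
      (EllipticalModel.lawStar m Sig θ f))
    (hE3 : ∀ i j, j ≠ i → Integrable
      (fun x =>
        (EllipticalModel.eig x.2 i * φ i (EllipticalModel.eig x.2)
          - EllipticalModel.eig x.2 j * φ j (EllipticalModel.eig x.2))
        / (EllipticalModel.eig x.2 i - EllipticalModel.eig x.2 j))
      (EllipticalModel.lawStar m Sig θ f)) :
    ∫ x, EllipticalModel.traceTerm Sig (H x.2) (EllipticalModel.eig x.2) φ
        ∂(EllipticalModel.law m Sig θ f)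
      = (EllipticalModel.Kstar m Sig θ f).toReal *
        ∫ x, ∑ i : Fin (min p m),
          ((((max p m : ℕ) : ℝ) - ((min p m : ℕ) : ℝ) + 1) * φ i (EllipticalModel.eig x.2)
            + 2 * EllipticalModel.eig x.2 i *
                EllipticalModel.partialDeriv (φ i) i (EllipticalModel.eig x.2)
            + ∑ j ∈ Finset.univ.erase i,
                (EllipticalModel.eig x.2 i * φ i (EllipticalModel.eig x.2)
                  - EllipticalModel.eig x.2 j * φ j (EllipticalModel.eig x.2))
                / (EllipticalModel.eig x.2 i - EllipticalModel.eig x.2 j))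
        ∂(EllipticalModel.lawStar m Sig θ f) := by
  rcases Nat.eq_zero_or_pos (min p m) with h0 | h0
  -- When r = 0 the matrix H has no columns and both sides are 0; otherwise p and m are positive.
  · have : IsEmpty (Fin (min p m)) := by rw [h0]; infer_instance
    simp [EllipticalModel.traceTerm, Matrix.trace, Matrix.mul_apply]
  have hp : 0 < p := lt_of_lt_of_le h0 (min_le_left p m)
  have hm : 0 < m := lt_of_lt_of_le h0 (min_le_right p m)
  have hae : ∀ᵐ x : (Fin q → Fin p → ℝ) × (Fin m → Fin p → ℝ),
      EllipticalModel.traceTerm Sig (H x.2) (EllipticalModel.eig x.2) φ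
        = EllipticalModel.scoreTerm Sig φ x.2 := by
    rw [Measure.volume_eq_prod]
    refine Measure.quasiMeasurePreserving_snd.ae
      (p := fun u => EllipticalModel.traceTerm Sig (H u) (EllipticalModel.eig u) φ
        = EllipticalModel.scoreTerm Sig φ u) ?_
    filter_upwards [hH, EllipticalModel.ae_disc_ne_zero] with u hu hd
    exact hu.traceTerm_eq hd
  have hae' : ∀ᵐ x : (Fin q → Fin p → ℝ) × (Fin m → Fin p → ℝ),
      (ENNReal.ofReal (f (EllipticalModel.quadForm Sig θ x))).toReal
          * EllipticalModel.traceTerm Sig (H x.2) (EllipticalModel.eig x.2) φ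
        = (ENNReal.ofReal (f (EllipticalModel.quadForm Sig θ x))).toReal
          * EllipticalModel.scoreTerm Sig φ x.2 := by
    filter_upwards [hae] with x hx
    rw [hx]
  rw [EllipticalModel.integral_law hSig hf_meas,
    EllipticalModel.Kstar_mul_integral_lawStar hSig hK, integral_congr_ae hae',
    EllipticalModel.integral_quadForm_mul_scoreTerm hSig hp hm θ hφ hf_meas
      (EllipticalModel.ae_Fstar_ne_top hSig hK)
      ((EllipticalModel.integrable_of_integrable_law hSig hf_meas hE).congr hae')
      (fun i => EllipticalModel.integrable_of_integrable_lawStar hSig hK (hE1 i))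
      (fun i => EllipticalModel.integrable_of_integrable_lawStar hSig hK (hE2 i))
      (fun i j hj => EllipticalModel.integrable_of_integrable_lawStar hSig hK (hE3 i j hj))]
  rfl
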